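/- Let $m\ge 2$ and let $\mathcal M$ be the set of $m\times m$ row-stochastic matrices. A pair $(P,\mu)$, with $P\in\mathcal M$ and $\mu$ a probability vector on $[m]=\{1,\dots,m\}$, generates a Markov chain $X_0,X_1,\dots$ with initial distribution $\mu$ and transition matrix $P$; $\mathbb P_{P,\mu}$ and $\mathbb E_{P,\mu}$ denote its law and expectation. Let $\mathcal P,\mathcal Q\subset\mathcal M$ be disjoint. $P$ is ergodic if it is irreducible and aperiodic; then $\pi_P$ is its stationary distribution and $\pi_P^*=\min_i\pi_P(i)$. For ergodic $Q$ put $D_{\mathcal M}(Q,P)=\sum_i\pi_Q(i)\,\mathrm{KL}(Q(i,\cdot),P(i,\cdot))\in[0,\infty]$, where $\mathrm{KL}(q,p)=\sum_j q_j\log(q_j/p_j)$ if $q\ll p$ and $\infty$ otherwise, and $D_{\mathcal M}^{\inf}(Q,\mathcal P)=\inf_{P\in\mathcal P}D_{\mathcal M}(Q,P)$ ($=\infty$ if $\mathcal P=\varnothing$). Let $d(x,y)=x\log\frac xy+(1-x)\log\frac{1-x}{1-y}$ and $x^+=\max\{x,0\}$. For ergodic $P$ let $P^*(i,j)=P(j,i)\pi_P(j)/\pi_P(i)$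 and let $\gamma_{\rm ps}=\gamma_{\rm ps}(P)=\max_{k\ge1}\frac1k\big(1-\lambda_2((P^*)^kP^k)\big)\in(0,1]$ be the pseudo-spectral gap, where $\lambda_2$ is the second largest eigenvalue, counted with multiplicity. Put $$C_P=\frac{(1-\gamma_{\rm ps})^{-1/(2\gamma_{\rm ps})}}{\sqrt{\pi_P^*}}\cdot\frac1{1-\sqrt{1-\gamma_{\rm ps}}}\ \text{ if }\gamma_{\rm ps}<1,\qquad C_P=2\ \text{ if }\gamma_{\rm ps}=1 .$$ A level-$(\alpha,\beta)$ two-sided test consists of a stopping time $\tau\in\{0,1,2,\dots\}\cup\{\infty\}$ of the filtration $\mathcal F_n=\sigma(X_0,\dots,X_n)$ and an $\mathcal F_\tau$-measurable decision $D\in\{0,1\}$ such that, for every initial distribution $\mu$, $\mathbb P_{P,\mu}(\tau<\infty,D=1)\le\alpha$ for all $P\in\mathcal P$ and $\mathbb P_{Q,\mu}(\tau<\infty,D=0)\le\beta$ for all $Q\in\mathcal Q$. (Lower bound.) Let $\alpha,\beta\in(0,1/2)$ and let $(\tau,D)$ be any level-$(\alpha,\beta)$ two-sided test. For every initial distribution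 $\mu$, every ergodic $Q\in\mathcal Q$ and every ergodic $P\in\mathcal P$, with expectations in $[0,\infty]$ and the conventions $x/\infty=0$ and $x/0=\infty$ for $x>0$, $$\mathbb E_{Q,\mu}[\tau]\ge\Big(\frac{d(\beta,1-\alpha)}{D_{\mathcal M}^{\inf}(Q,\mathcal P)}-\frac{2C_Q}{\pi_Q^*}\Big)^+,\qquad \mathbb E_{P,\mu}[\tau]\ge\Big(\frac{d(\alpha,1-\beta)}{D_{\mathcal M}^{\inf}(P,\mathcal Q)}-\frac{2C_P}{\pi_P^*}\Big)^+ .$$ (Optimal test.) Let moreover $\mathcal P$ and $\mathcal Q$ be compact. Let $N_x(t)$ and $N_{x,y}(t)$ be the numbers of $s\in\{0,\dots,t-1\}$ with $X_s=x$, respectively with $X_s=x$ and $X_{s+1}=y$. Let $\widehat Q_t(x,y)=N_{x,y}(t)/N_x(t)$ if $N_x(t)>0$. For a null set $\mathcal P$ and $\alpha\in(0,1)$ let $\tau^{\mathcal P}_\alpha$ be the first $t\ge1$ with $$\inf_{P\in\mathcal P}\ \sum_{x:\,N_x(t)>0}N_x(t)\,\mathrm{KL}\big(\widehat Q_t(x,\cdot),P(x,\cdot)\big)\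 \ge\ \log\frac1\alpha+(m-1)\sum_{x\in[m]}\log\Big(e\Big(1+\frac{N_x(t)}{m-1}\Big)\Big)$$ ($\infty$ if there is none), and let $\tau^{\mathcal Q}_\beta$ be the same test with null set $\mathcal Q$ and level $\beta$. Run both in parallel: $\tau_{\alpha,\beta}=\min\{\tau^{\mathcal P}_\alpha,\tau^{\mathcal Q}_\beta\}$, with $D=1$ if $\tau^{\mathcal P}_\alpha\le\tau^{\mathcal Q}_\beta$ and $D=0$ otherwise. Then for all $\alpha,\beta\in(0,1)$ this is a level-$(\alpha,\beta)$ two-sided test, and for every initial distribution $\mu$, as $(\alpha,\beta)\to(0,0)$ jointly with $\alpha,\beta>0$, $$\frac{\mathbb E_{Q,\mu}[\tau_{\alpha,\beta}]}{\log(1/\alpha)}\to\frac1{D_{\mathcal M}^{\inf}(Q,\mathcal P)}\ \ \forall\text{ ergodic }Q\in\mathcal Q,\qquad \frac{\mathbb E_{P,\mu}[\tau_{\alpha,\beta}]}{\log(1/\beta)}\to\frac1{D_{\mathcal M}^{\inf}(P,\mathcal Q)}\ \ \forall\text{ ergodic }P\in\mathcal P .$$ -/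

import Mathlib

open MeasureTheory ProbabilityTheory Filter Topology
open scoped ENNReal Matrix

noncomputable section

namespace MarkovTest

variable {m : ℕ}

/-- The set of `m × m` row-stochastic matrices, with the topology inherited from `ℝ^{m × m}`. -/
abbrev TransitionMatrix (m : ℕ) : Type :=
  {P : Matrix (Fin m) (Fin m) ℝ // P ∈ Matrix.rowStochastic ℝ (Fin m)}

/-- The `i`-th row of a transition matrix, as a probability vector. -/
def TransitionMatrix.row (P : TransitionMatrix m) (i : Fin m) : stdSimplex ℝ (Fin m) :=
  ⟨P.1 i, fun j => P.2.1 i j, by simpa [Matrix.mulVec, dotProduct] using congrFun P.2.2 i⟩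

/-- The probability measure on the states with probability vector `v`. -/
def vecMeasure (v : stdSimplex ℝ (Fin m)) : Measure (Fin m) :=
  ∑ j, ENNReal.ofReal (v.1 j) • Measure.dirac j

instance (v : stdSimplex ℝ (Fin m)) : IsProbabilityMeasure (vecMeasure v) :=
  ⟨by simp [vecMeasure, ← ENNReal.ofReal_sum_of_nonneg fun i _ => v.2.1 i, v.2.2]⟩

/-- The one-step kernel `x ↦ P(x, ·)`. -/
def stepKernel (P : TransitionMatrix m) : Kernel (Fin m) (Fin m) :=
  Kernel.ofFunOfCountable fun i => vecMeasure (P.row i)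

instance (P : TransitionMatrix m) : IsMarkovKernel (stepKernel P) :=
  ⟨fun i => inferInstanceAs (IsProbabilityMeasure (vecMeasure (P.row i)))⟩

/-- The kernel giving the law of `X_{n+1}` from the past `X_0, …, X_n`: it only looks at `X_n`. -/
def pastKernel (P : TransitionMatrix m) (n : ℕ) :
    Kernel ((i : Finset.Iic n) → (fun _ : ℕ => Fin m) i) ((fun _ : ℕ => Fin m) (n + 1)) :=
  (stepKernel P).comap (fun h => h ⟨n, Finset.mem_Iic.2 le_rfl⟩) (by fun_prop)

instance (P : TransitionMatrix m) (n : ℕ) : IsMarkovKernel (pastKernel P n) := by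
  unfold pastKernel; infer_instance

/-- The law on the path space `ℕ → [m]` of the Markov chain `X_0, X_1, …` with transition
matrix `P` and initial distribution `μ` (the coordinate process is `X_t ω = ω t`). -/
def chainLaw (P : TransitionMatrix m) (μ : stdSimplex ℝ (Fin m)) : Measure (ℕ → Fin m) :=
  Kernel.trajMeasure (X := fun _ : ℕ => Fin m) (vecMeasure μ) (pastKernel P)

instance (P : TransitionMatrix m) (μ : stdSimplex ℝ (Fin m)) :
    IsProbabilityMeasure (chainLaw P μ) := by
  unfold chainLaw; infer_instance

theorem vecMeasure_singleton (v : stdSimplex ℝ (Fin m)) (j : Fin m) :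
    vecMeasure v {j} = ENNReal.ofReal (v.1 j) := by
  simp [vecMeasure, Measure.dirac_apply', Set.indicator]

/-- Finite-dimensional laws: `ℙ(X_0 = x_0, …, X_n = x_n) = μ(x_0) ∏_{t < n} P(x_t, x_{t+1})`. -/
theorem chainLaw_cylinder (P : TransitionMatrix m) (μ : stdSimplex ℝ (Fin m)) (n : ℕ)
    (x : ℕ → Fin m) :
    chainLaw P μ {ω | ∀ t ≤ n, ω t = x t} =
      ENNReal.ofReal (μ.1 (x 0) * ∏ t ∈ Finset.range n, P.1 (x t) (x (t + 1))) := by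
  induction n with
  | zero =>
    have h0 : {ω : ℕ → Fin m | ∀ t ≤ 0, ω t = x t} =
        (fun ω : ℕ → Fin m => ω 0) ⁻¹' {x 0} := by ext ω; simp
    have h1 : (chainLaw P μ).map (Preorder.frestrictLe 0) =
        (vecMeasure μ).map (MeasurableEquiv.piUnique
          (fun i : Finset.Iic 0 => (fun _ : ℕ => Fin m) i)).symm := by
      unfold chainLaw Kernel.trajMeasure
      rw [Measure.map_comp _ _ (by fun_prop), Kernel.traj_map_frestrictLe,
        Kernel.partialTraj_self, Measure.id_comp]
    have h2 : (chainLaw P μ).map (fun ω => ω 0) = vecMeasure μ := by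
      have : (fun ω : ℕ → Fin m => ω 0) =
          (fun h : (i : Finset.Iic 0) → Fin m => h ⟨0, by simp⟩) ∘ (Preorder.frestrictLe 0) := rfl
      rw [this, ← Measure.map_map (by fun_prop) (by fun_prop), h1,
        Measure.map_map (by fun_prop) (by fun_prop)]
      exact Measure.map_id
    rw [h0, ← Measure.map_apply (by fun_prop) (measurableSet_singleton _), h2,
      vecMeasure_singleton]
    simp
  | succ n ih =>
    have key := Kernel.map_frestrictLe_trajMeasure_compProd_eq_map_trajMeasure
      (X := fun _ : ℕ => Fin m) (μ₀ := vecMeasure μ) (κ := pastKernel P) (a := n)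
    change (chainLaw P μ).map _ ⊗ₘ _ = (chainLaw P μ).map _ at key
    let S : Set ((i : Finset.Iic n) → Fin m) := {fun i : Finset.Iic n => x i}
    have hS : MeasurableSet S := measurableSet_singleton _
    have e1 : {ω : ℕ → Fin m | ∀ t ≤ n + 1, ω t = x t} =
        (fun ω : ℕ → Fin m => (Preorder.frestrictLe (π := fun _ => Fin m) n ω, ω (n + 1))) ⁻¹'
          (S ×ˢ {x (n + 1)}) := by
      ext ω
      simp only [Set.mem_ofPred_eq, Set.mem_preimage, Set.mem_prod, S, Set.mem_singleton_iff,
        funext_iff, Subtype.forall, Finset.mem_Iic, Preorder.frestrictLe_apply]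
      constructor
      · exact fun h => ⟨fun t ht => h t (by omega), h _ le_rfl⟩
      · rintro ⟨h, h'⟩ t ht
        rcases Nat.lt_or_eq_of_le ht with h1 | rfl
        · exact h t (by omega)
        · exact h'
    have e2 : {ω : ℕ → Fin m | ∀ t ≤ n, ω t = x t} =
        (Preorder.frestrictLe (π := fun _ => Fin m) n) ⁻¹' S := by
      ext ω
      simp [S, funext_iff]
    rw [e1, ← Measure.map_apply (by fun_prop) (hS.prod (measurableSet_singleton _)), ← key,
      Measure.compProd_apply_prod hS (measurableSet_singleton _)]
    have e3 : (chainLaw P μ).map (Preorder.frestrictLe (π := fun _ => Fin m) n) S =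
        ENNReal.ofReal (μ.1 (x 0) * ∏ t ∈ Finset.range n, P.1 (x t) (x (t + 1))) := by
      rw [Measure.map_apply (by fun_prop) hS, ← e2, ih]
    have e4 : pastKernel P n (fun i => x i) {x (n + 1)} =
        ENNReal.ofReal (P.1 (x n) (x (n + 1))) := vecMeasure_singleton (P.row (x n)) (x (n + 1))
    rw [show S = {fun i : Finset.Iic n => x i} from rfl] at e3 ⊢
    rw [lintegral_singleton, e3, e4, Finset.prod_range_succ, ← mul_assoc, mul_comm,
      ← ENNReal.ofReal_mul]
    exact mul_nonneg (μ.2.1 _) (Finset.prod_nonneg fun t _ => P.2.1 _ _)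

/-- The natural filtration `ℱ_n = σ(X_0, …, X_n)` of the coordinate process. -/
def natFiltration (m : ℕ) : Filtration ℕ (inferInstance : MeasurableSpace (ℕ → Fin m)) :=
  Filtration.natural (fun n (ω : ℕ → Fin m) => ω n)
    fun n => (measurable_pi_apply n).stronglyMeasurable

/-! ### Ergodicity, stationary distribution, pseudo-spectral gap -/

/-- Every state has period `1`: the gcd of the return times with positive probability is `1`. -/
def IsAperiodic (P : TransitionMatrix m) : Prop :=
  ∀ i, ∀ d : ℕ, (∀ n : ℕ, 1 ≤ n → 0 < (P.1 ^ n) i i → d ∣ n) → d = 1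

/-- Ergodic: irreducible and aperiodic. -/
def IsErgodic (P : TransitionMatrix m) : Prop := P.1.IsIrreducible ∧ IsAperiodic P

/-- `π` is a stationary distribution of `P`: a probability vector with `π P = π`. -/
def IsStationary (P : TransitionMatrix m) (π : Fin m → ℝ) : Prop :=
  π ∈ stdSimplex ℝ (Fin m) ∧ π ᵥ* P.1 = π

/-- A stationary distribution always exists. -/
theorem exists_isStationary [Nonempty (Fin m)] (P : TransitionMatrix m) :
    ∃ π, IsStationary P π := by
  have hdet : (P.1 - 1).det = 0 := by
    refine Matrix.exists_mulVec_eq_zero_iff.1 ⟨1, one_ne_zero, ?_⟩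
    rw [Matrix.sub_mulVec, P.2.2, Matrix.one_mulVec, sub_self]
  obtain ⟨v, hv, h⟩ := Matrix.exists_vecMul_eq_zero_iff.2 hdet
  have hrow : ∀ i, ∑ j, P.1 i j = 1 := fun i => (P.row i).2.2
  have hvP : ∀ j, ∑ i, v i * P.1 i j = v j := fun j => by
    have := congrFun h j
    rw [Matrix.vecMul_sub, Matrix.vecMul_one, Pi.sub_apply, Pi.zero_apply, sub_eq_zero] at this
    simpa [Matrix.vecMul, dotProduct] using this
  have hle : ∀ j, |v j| ≤ ∑ i, |v i| * P.1 i j := fun j => by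
    conv_lhs => rw [← hvP j]
    refine (Finset.abs_sum_le_sum_abs _ _).trans (Finset.sum_le_sum fun i _ => ?_)
    rw [abs_mul, abs_of_nonneg (P.2.1 i j)]
  have hsum : ∑ j, ∑ i, |v i| * P.1 i j = ∑ j, |v j| := by
    rw [Finset.sum_comm]
    exact Finset.sum_congr rfl fun i _ => by rw [← Finset.mul_sum, hrow, mul_one]
  have heq := (Finset.sum_eq_sum_iff_of_le fun j _ => hle j).1 hsum.symm
  have hpos : 0 < ∑ j, |v j| := by
    obtain ⟨i, hi⟩ := Function.ne_iff.1 hv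
    exact Finset.sum_pos' (fun _ _ => abs_nonneg _) ⟨i, Finset.mem_univ _, abs_pos.2 hi⟩
  refine ⟨fun j => |v j| / ∑ k, |v k|, ⟨fun j => by positivity, ?_⟩, ?_⟩
  · rw [← Finset.sum_div, div_self hpos.ne']
  · ext j
    simp only [Matrix.vecMul, dotProduct]
    rw [heq j (Finset.mem_univ _), Finset.sum_div]
    exact Finset.sum_congr rfl fun i _ => by ring
/-- The stationary distribution (unique when `P` is ergodic). -/
def stationaryDist (P : TransitionMatrix m) : Fin m → ℝ :=
  Classical.epsilon (IsStationary P)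

/-- `π_* = min_i π(i)`. -/
def minStationary (P : TransitionMatrix m) : ℝ := ⨅ i, stationaryDist P i

/-- The time reversal `P^*(i,j) = P(j,i) π(j) / π(i)`. -/
def timeReversal (P : TransitionMatrix m) : Matrix (Fin m) (Fin m) ℝ :=
  Matrix.of fun i j => P.1 j i * stationaryDist P j / stationaryDist P i

/-- The spectral gap `1 - λ₂` of a matrix with real eigenvalues `λ₁ ≥ λ₂ ≥ ⋯ ≥ λ_m`, which are
listed with multiplicity as the roots of the characteristic polynomial. -/
def spectralGap (A : Matrix (Fin m) (Fin m) ℝ) : ℝ :=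
  1 - (A.charpoly.roots.sort (· ≥ ·)).getD 1 0

/-- The pseudo-spectral gap `max_{k ≥ 1} γ((P^*)^k P^k) / k`. -/
def pseudoSpectralGap (P : TransitionMatrix m) : ℝ :=
  ⨆ k : ℕ+, spectralGap (timeReversal P ^ (k : ℕ) * P.1 ^ (k : ℕ)) / (k : ℕ)

/-- The constant `C_P` controlling the solutions of the Poisson equation of `P`. -/
def poissonConst (P : TransitionMatrix m) : ℝ :=
  if pseudoSpectralGap P = 1 then 2
  else (1 - pseudoSpectralGap P) ^ (-(1 / (2 * pseudoSpectralGap P))) / √(minStationary P) *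
    (1 / (1 - √(1 - pseudoSpectralGap P)))

/-! ### Divergences -/

open Classical in
/-- `KL(q, p) = ∑_j q_j log (q_j / p_j)` for probability vectors, and `∞` unless `q ≪ p`. -/
def kl (q p : Fin m → ℝ) : ℝ≥0∞ :=
  if ∀ j, p j = 0 → q j = 0 then ENNReal.ofReal (∑ j, q j * Real.log (q j / p j)) else ⊤

/-- The binary divergence `d(x, y)` between `Ber(x)` and `Ber(y)`. -/
def binaryKL (x y : ℝ) : ℝ := x * Real.log (x / y) + (1 - x) * Real.log ((1 - x) / (1 - y))

/-- The stationary-weighted divergence `D_ℳ(Q, P) = ∑_i π_Q(i) KL(Q(i,·), P(i,·))`. -/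
def stationaryKL (Q P : TransitionMatrix m) : ℝ≥0∞ :=
  ∑ i, ENNReal.ofReal (stationaryDist Q i) * kl (Q.1 i) (P.1 i)

/-- `D_ℳ^inf(Q, H₀) = inf_{P ∈ H₀} D_ℳ(Q, P)`. -/
def infStationaryKL (Q : TransitionMatrix m) (H₀ : Set (TransitionMatrix m)) : ℝ≥0∞ :=
  ⨅ P ∈ H₀, stationaryKL Q P

/-! ### Two-sided tests -/

/-- The expected stopping time `E_{P,μ}[τ] ∈ [0, ∞]`. -/
def expectedTime (P : TransitionMatrix m) (μ : stdSimplex ℝ (Fin m)) (τ : (ℕ → Fin m) → ℕ∞) :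
    ℝ≥0∞ :=
  ∫⁻ ω, (τ ω : ℝ≥0∞) ∂(chainLaw P μ)

/-- `(τ, D)` is a level-`(α, β)` two-sided sequential test of `H₀` against `H₁`: `τ` is a stopping
time, the decision `D ∈ {0, 1}`, taken when the test stops, is `ℱ_τ`-measurable, and both error
probabilities are controlled for every initial distribution. -/
structure IsLevelTest (H₀ H₁ : Set (TransitionMatrix m)) (α β : ℝ)
    (τ : (ℕ → Fin m) → ℕ∞) (D : (ℕ → Fin m) → Fin 2) : Prop where
  isStoppingTime : IsStoppingTime (natFiltration m) τ
  measurable_decision : Measurable[isStoppingTime.measurableSpace] D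
  error_null : ∀ P ∈ H₀, ∀ μ, chainLaw P μ {ω | τ ω < ⊤ ∧ D ω = 1} ≤ ENNReal.ofReal α
  error_alt : ∀ Q ∈ H₁, ∀ μ, chainLaw Q μ {ω | τ ω < ⊤ ∧ D ω = 0} ≤ ENNReal.ofReal β

/-! ### The one-sided tests and their parallel combination -/

/-- `N_x(t)`: the number of visits to `x` among `X_0, …, X_{t-1}`. -/
def visits (ω : ℕ → Fin m) (t : ℕ) (x : Fin m) : ℕ :=
  ((Finset.range t).filter fun s => ω s = x).card

/-- `N_{x,y}(t)`: the number of transitions from `x` to `y` among the first `t` transitions. -/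
def transitions (ω : ℕ → Fin m) (t : ℕ) (x y : Fin m) : ℕ :=
  ((Finset.range t).filter fun s => ω s = x ∧ ω (s + 1) = y).card

/-- The row `x` of the empirical transition matrix at time `t` (uniform if `x` is unvisited). -/
def empiricalRow (ω : ℕ → Fin m) (t : ℕ) (x y : Fin m) : ℝ :=
  if 0 < visits ω t x then (transitions ω t x y : ℝ) / (visits ω t x : ℝ) else 1 / (m : ℝ)

/-- The statistic `L_t = inf_{P ∈ H₀} ∑_{x : N_x > 0} N_x KL(Q̂_t(x,·), P(x,·))`. -/
def testStatistic (H₀ : Set (TransitionMatrix m)) (ω : ℕ → Fin m) (t : ℕ) : ℝ≥0∞ :=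
  ⨅ P ∈ H₀, ∑ x with 0 < visits ω t x, (visits ω t x : ℝ≥0∞) * kl (empiricalRow ω t x) (P.1 x)

/-- The boundary `log(1/α) + (m-1) ∑_x log(e (1 + N_x/(m-1)))`. -/
def testBoundary (α : ℝ) (ω : ℕ → Fin m) (t : ℕ) : ℝ :=
  Real.log (1 / α) + ((m : ℝ) - 1) *
    ∑ x, Real.log (Real.exp 1 * (1 + (visits ω t x : ℝ) / ((m : ℝ) - 1)))

/-- The one-sided test with null `H₀`: stop (and reject `H₀`) at the first time `t ≥ 1` at which
the statistic reaches the boundary; `⊤` if there is none. -/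
def oneSidedTime (H₀ : Set (TransitionMatrix m)) (α : ℝ) (ω : ℕ → Fin m) : ℕ∞ :=
  ⨅ t : ℕ, ⨅ _ : 1 ≤ t ∧ ENNReal.ofReal (testBoundary α ω t) ≤ testStatistic H₀ ω t, (t : ℕ∞)

/-- The two one-sided tests in parallel: stop as soon as one of them stops. -/
def parallelTime (H₀ H₁ : Set (TransitionMatrix m)) (α β : ℝ) (ω : ℕ → Fin m) : ℕ∞ :=
  min (oneSidedTime H₀ α ω) (oneSidedTime H₁ β ω)

/-- Decide for the alternative iff the test with null `H₀` stops no later than the other one. -/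
def parallelDecision (H₀ H₁ : Set (TransitionMatrix m)) (α β : ℝ) (ω : ℕ → Fin m) : Fin 2 :=
  if oneSidedTime H₀ α ω ≤ oneSidedTime H₁ β ω then 1 else 0

end MarkovTest

end

noncomputable section

namespace MarkovTest

variable {m : ℕ}

/-! ### Stochastic matrices and stationary distributions -/

/-! Lower bound. Fix one alternative `P` with `D = stationaryKL Q P` finite, and let `Z` be the
log-likelihood ratio of `Q` against `P`, stopped at `τ ∧ n`. Its mean under `Q` is squeezed from two
sides. From below, the change of measure `E_Q[1_E e^{-Z}] ≤ P(E)` on the event of deciding 1 by time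
`n`, inserted in the Donsker–Varadhan inequality with a two-valued test function, makes the mean at
least the binary divergence as `n → ∞` (`le_integral_stopped_sum`). From above, the Poisson equation
turns the sum of log-ratios into a martingale plus `D · (τ ∧ n)` plus a boundary term
(`integral_stopped_sum_le`). The mean row divergence is at most `D / π_*` at every state, so its
Poisson solution is bounded by `C_Q D / π_*`; the error is thus proportional to `D` and can be
divided out (`IsErgodic.binaryKL_le_mul`).

The constant `C_Q` comes from summing `P^n f` for centred `f`. Conjugation by `√π` makes `(P^*)^k
P^k` symmetric, its second eigenvalue controls the `L²(π)` contraction of `P^k`, and a `k` attaining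
the pseudo-spectral gap gives geometric decay (`IsErgodic.exists_abs_pow_mulVec_le`).

Level of the test. Predicting each transition by Laplace's add-one rule in its row gives a uniform
Dirichlet mixture likelihood. Its ratio to the likelihood of a true null `P` has mean at most 1,
also when stopped. The mixture is at least the maximum likelihood divided by a product of binomial
coefficients, and the boundary is an upper bound for the logarithm of that product. A crossing
therefore forces the ratio above `1/α`, and Markov's inequality concludes
(`chainLaw_oneSidedTime_lt_top_le`).

Optimality. Transition frequencies deviate from their stationary values with summable probabilities,
again through the Poisson equation. Near those values, compactness and lower semicontinuity make the
statistic at time `n` exceed `nK` for any `K` below the infimal divergence, while the boundary is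
`log(1/α) + O(log n)`. Summing tail probabilities bounds the mean stopping time by `log(1/α)/K' +
C`, with `C` free of `α`, for each `0 < K' < K` (`IsErgodic.exists_expectedTime_le`). The matching
lower bound is the first part applied to the parallel test. -/

theorem TransitionMatrix.nonneg (P : TransitionMatrix m) (i j : Fin m) : 0 ≤ P.1 i j := P.2.1 i j

theorem TransitionMatrix.sum_row (P : TransitionMatrix m) (i : Fin m) : ∑ j, P.1 i j = 1 :=
  (P.row i).2.2

theorem TransitionMatrix.le_one (P : TransitionMatrix m) (i j : Fin m) : P.1 i j ≤ 1 :=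
  (Finset.single_le_sum (fun k _ => P.nonneg i k) (Finset.mem_univ j)).trans_eq (P.sum_row i)

/-- The `n`-step transition matrix. -/
def TransitionMatrix.npow (P : TransitionMatrix m) (n : ℕ) : TransitionMatrix m :=
  ⟨P.1 ^ n, pow_mem P.2 n⟩

theorem isStationary_stationaryDist [Nonempty (Fin m)] (P : TransitionMatrix m) :
    IsStationary P (stationaryDist P) :=
  Classical.epsilon_spec (exists_isStationary P)

theorem sum_stationaryDist [Nonempty (Fin m)] (P : TransitionMatrix m) :
    ∑ i, stationaryDist P i = 1 := (isStationary_stationaryDist P).1.2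

theorem IsStationary.vecMul_pow {P : TransitionMatrix m} {π : Fin m → ℝ} (h : IsStationary P π)
    (n : ℕ) : π ᵥ* P.1 ^ n = π := by
  induction n with
  | zero => simp
  | succ n ih => rw [pow_succ, ← Matrix.vecMul_vecMul, ih, h.2]

theorem IsStationary.npow {P : TransitionMatrix m} {π : Fin m → ℝ} (h : IsStationary P π)
    (n : ℕ) : IsStationary (P.npow n) π := ⟨h.1, h.vecMul_pow n⟩

theorem IsStationary.sum_mul {P : TransitionMatrix m} {π : Fin m → ℝ} (h : IsStationary P π)
    (j : Fin m) : ∑ i, π i * P.1 i j = π j := by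
  simpa [Matrix.vecMul, dotProduct] using congrFun h.2 j

theorem IsStationary.sum_mul_mulVec {P : TransitionMatrix m} {π : Fin m → ℝ}
    (h : IsStationary P π) (f : Fin m → ℝ) : ∑ i, π i * (P.1 *ᵥ f) i = ∑ i, π i * f i := by
  have : π ⬝ᵥ (P.1 *ᵥ f) = π ⬝ᵥ f := by rw [Matrix.dotProduct_mulVec, h.2]
  exact this

/-- The loss of weighted `L²` norm under one step is the mean conditional variance. -/
theorem IsStationary.sum_sq_sub {P : TransitionMatrix m} {π : Fin m → ℝ}
    (h : IsStationary P π) (f : Fin m → ℝ) :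
    ∑ i, π i * f i ^ 2 - ∑ i, π i * (P.1 *ᵥ f) i ^ 2 =
      ∑ i, ∑ j, π i * P.1 i j * (f j - (P.1 *ᵥ f) i) ^ 2 := by
  rw [← h.sum_mul_mulVec fun i => f i ^ 2, ← Finset.sum_sub_distrib]
  refine Finset.sum_congr rfl fun i _ => ?_
  have h1 : ∑ j, P.1 i j * f j = (P.1 *ᵥ f) i := rfl
  have h2 : (P.1 *ᵥ fun i => f i ^ 2) i = ∑ j, P.1 i j * f j ^ 2 := rfl
  rw [h2]
  generalize (P.1 *ᵥ f) i = c at *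
  have h3 : ∀ j, π i * P.1 i j * (f j - c) ^ 2 =
      π i * (P.1 i j * f j ^ 2) - 2 * c * π i * (P.1 i j * f j) + c ^ 2 * π i * P.1 i j := by
    intro j; ring
  simp_rw [h3]
  rw [Finset.sum_add_distrib, Finset.sum_sub_distrib, ← Finset.mul_sum, ← Finset.mul_sum,
    ← Finset.mul_sum, h1, P.sum_row]
  ring

/-- Jensen's inequality: the loss is a variance. Hence every power of `P` is a weak contraction of
`L²(π)`, which takes care of leftover steps when only multiples of some `k` contract strictly. -/
theorem IsStationary.sum_sq_mulVec_le {P : TransitionMatrix m} {π : Fin m → ℝ}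
    (h : IsStationary P π) (f : Fin m → ℝ) :
    ∑ i, π i * (P.1 *ᵥ f) i ^ 2 ≤ ∑ i, π i * f i ^ 2 := by
  rw [← sub_nonneg, h.sum_sq_sub]
  exact Finset.sum_nonneg fun i _ => Finset.sum_nonneg fun j _ =>
    mul_nonneg (mul_nonneg (h.1.1 i) (P.nonneg i j)) (sq_nonneg _)

/-- The return times to a state are closed under addition and have gcd 1, so they contain every
large integer. A path from `i` to `j`, supplied by irreducibility, is then prefixed by a long loop
at `i`. -/
theorem IsErgodic.exists_pow_pos {P : TransitionMatrix m} (h : IsErgodic P) :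
    ∃ N, ∀ n ≥ N, ∀ i j, 0 < (P.1 ^ n) i j := by
  have hk := (Matrix.isIrreducible_iff_exists_pow_pos P.nonneg).1 h.1
  have hmul : ∀ a b i j l, 0 < (P.1 ^ a) i j → 0 < (P.1 ^ b) j l → 0 < (P.1 ^ (a + b)) i l := by
    intro a b i j l h1 h2
    rw [pow_add, Matrix.mul_apply]
    exact Finset.sum_pos' (fun k _ => mul_nonneg ((P.npow a).nonneg i k) ((P.npow b).nonneg k l))
      ⟨j, Finset.mem_univ _, mul_pos h1 h2⟩
  have hN : ∀ i, ∃ N, ∀ n ≥ N, 0 < (P.1 ^ n) i i := by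
    intro i
    let s : Set ℕ := {n | 1 ≤ n ∧ 0 < (P.1 ^ n) i i}
    have hs : Nat.setGcd s = 1 :=
      h.2 i _ fun n h1 h2 => Nat.setGcd_dvd_of_mem ⟨h1, h2⟩
    obtain ⟨N, hN⟩ := Nat.exists_mem_closure_of_ge s
    refine ⟨N, fun n hn => ?_⟩
    have := hN n hn (by rw [hs]; exact one_dvd n)
    refine AddSubmonoid.closure_induction (motive := fun n _ => 0 < (P.1 ^ n) i i)
      (fun n hn => hn.2) (by simp) (fun a b _ _ => hmul a b i i i) this
  choose N hN using hN
  choose k _ hk using hk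
  -- Both sums only serve as bounds uniform in the states: after reserving `k i j` steps for the
  -- path, at least `N i` remain for the loop.
  refine ⟨∑ i, N i + ∑ i, ∑ j, k i j, fun n hn i j => ?_⟩
  have h1 : N i ≤ ∑ i, N i := Finset.single_le_sum (fun _ _ => Nat.zero_le _) (Finset.mem_univ i)
  have h2 : k i j ≤ ∑ j, k i j :=
    Finset.single_le_sum (f := fun j => k i j) (fun _ _ => Nat.zero_le _) (Finset.mem_univ j)
  have h3 : ∑ j, k i j ≤ ∑ i, ∑ j, k i j :=
    Finset.single_le_sum (f := fun i => ∑ j, k i j) (fun _ _ => Nat.zero_le _) (Finset.mem_univ i)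
  have := hmul (n - k i j) (k i j) i i j (hN i _ (by omega)) (hk i j)
  rwa [Nat.sub_add_cancel (by omega)] at this

/-- Some state carries mass, and stationarity under a power with positive entries spreads it to all
states. -/
theorem IsErgodic.stationaryDist_pos [Nonempty (Fin m)] {P : TransitionMatrix m}
    (h : IsErgodic P) (i : Fin m) : 0 < stationaryDist P i := by
  obtain ⟨N, hN⟩ := h.exists_pow_pos
  have hs := isStationary_stationaryDist P
  obtain ⟨k, hk⟩ : ∃ k, 0 < stationaryDist P k := by
    by_contra! hc
    have := sum_stationaryDist P
    have h0 : ∑ i, stationaryDist P i ≤ 0 := Finset.sum_nonpos fun i _ => hc i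
    linarith
  rw [← (hs.npow N).sum_mul i]
  exact Finset.sum_pos' (fun j _ => mul_nonneg (hs.1.1 j) ((P.npow N).nonneg j i))
    ⟨k, Finset.mem_univ _, mul_pos hk (hN N le_rfl k i)⟩

theorem IsErgodic.minStationary_pos [Nonempty (Fin m)] {P : TransitionMatrix m}
    (h : IsErgodic P) : 0 < minStationary P := by
  obtain ⟨i, hi⟩ := exists_eq_ciInf_of_finite (f := stationaryDist P)
  rw [minStationary, ← hi]
  exact h.stationaryDist_pos i

theorem minStationary_le (P : TransitionMatrix m) (i : Fin m) :
    minStationary P ≤ stationaryDist P i :=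
  ciInf_le (Set.finite_range _).bddBelow i

/-! ### The second largest eigenvalue of a symmetric matrix -/

section SecondEigenvalue

variable {A : Matrix (Fin m) (Fin m) ℝ}

/-- The spectral theorem in coordinates. The indices `i₀` and `i₁` carry the largest and second
largest eigenvalues, and the last clause ties `l i₁` to the sorted characteristic roots used by
`spectralGap`. -/
theorem exists_eigenbasis_secondEigenvalue (hA : A.IsHermitian) (hm : 2 ≤ m) :
    ∃ (v : Fin m → Fin m → ℝ) (l : Fin m → ℝ) (i₀ i₁ : Fin m), i₀ ≠ i₁ ∧
      (∀ x y : Fin m → ℝ, x ⬝ᵥ y = ∑ i, (v i ⬝ᵥ x) * (v i ⬝ᵥ y)) ∧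
      (∀ i x, v i ⬝ᵥ (A *ᵥ x) = l i * (v i ⬝ᵥ x)) ∧
      (∀ i j, v i ⬝ᵥ v j = if i = j then 1 else 0) ∧
      (∀ i, i ≠ i₀ → l i ≤ l i₁) ∧ l i₁ ≤ l i₀ ∧
      l i₁ = (A.charpoly.roots.sort (· ≥ ·)).getD 1 0 := by
  let e := (Fintype.equivOfCardEq (Fintype.card_fin (Fintype.card (Fin m))))
  have hc : Fintype.card (Fin m) = m := Fintype.card_fin m
  have hdot : ∀ x y : EuclideanSpace ℝ (Fin m), inner ℝ x y = x.ofLp ⬝ᵥ y.ofLp := by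
    intro x y
    rw [EuclideanSpace.inner_eq_star_dotProduct, star_trivial, dotProduct_comm]
  have hl : ∀ i, hA.eigenvalues (e i) = hA.eigenvalues₀ i := fun i => by
    simp [Matrix.IsHermitian.eigenvalues, e]
  refine ⟨fun i => (hA.eigenvectorBasis i).ofLp, hA.eigenvalues, e ⟨0, by omega⟩, e ⟨1, by omega⟩,
    ?_, ?_, ?_, ?_, ?_, ?_, ?_⟩
  · simp
  · intro x y
    have := hA.eigenvectorBasis.sum_inner_mul_inner (WithLp.toLp 2 x) (WithLp.toLp 2 y)
    rw [hdot] at this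
    rw [← this]
    refine Finset.sum_congr rfl fun i _ => ?_
    rw [hdot, hdot, dotProduct_comm x]
  · intro i x
    rw [Matrix.dotProduct_mulVec, ← Matrix.mulVec_transpose]
    have : Aᵀ = A := by simpa using hA.eq
    rw [this, hA.mulVec_eigenvectorBasis, smul_dotProduct, smul_eq_mul]
  · intro i j
    rw [← hdot]
    exact orthonormal_iff_ite.1 hA.eigenvectorBasis.orthonormal i j
  · intro i hi
    obtain ⟨k, rfl⟩ := e.surjective i
    rw [hl, hl]
    refine hA.eigenvalues₀_antitone ?_
    have : k ≠ ⟨0, by omega⟩ := fun h => hi (by rw [h])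
    rw [Fin.le_def]
    have : (k : ℕ) ≠ 0 := fun h => this (Fin.ext h)
    simp only
    omega
  · rw [hl, hl]
    exact hA.eigenvalues₀_antitone (by simp [Fin.le_def])
  · rw [hl]
    have := hA.sort_roots_charpoly_eq_eigenvalues₀
    have h2 : (A.charpoly.roots.map (RCLike.re : ℝ → ℝ)) = A.charpoly.roots := by
      conv_rhs => rw [← Multiset.map_id A.charpoly.roots]
      rfl
    rw [h2] at this
    rw [this, List.getD_eq_getElem _ _ (by simpa using (show 1 < m by omega))]
    simp

/-- If the second eigenvalue is at least 1, the bound `A ≤ 1` suffices. Otherwise the eigenvalue 1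
of `u` is simple, so `u` spans the line of `v i₀`, and a `g` orthogonal to it only meets eigenvalues
up to `l i₁`. -/
theorem dotProduct_mulVec_le_secondEigenvalue (hA : A.IsHermitian) (hm : 2 ≤ m) {u : Fin m → ℝ} (hu : u ≠ 0)
    (hAu : A *ᵥ u = u) (hle : ∀ g, g ⬝ᵥ (A *ᵥ g) ≤ g ⬝ᵥ g) {g : Fin m → ℝ} (hg : u ⬝ᵥ g = 0) :
    g ⬝ᵥ (A *ᵥ g) ≤ (A.charpoly.roots.sort (· ≥ ·)).getD 1 0 * (g ⬝ᵥ g) := by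
  obtain ⟨v, l, i₀, i₁, hne, hdot, hAv, hv, hl, hl01, hs⟩ :=
    exists_eigenbasis_secondEigenvalue hA hm
  rw [← hs]
  have hgg : 0 ≤ g ⬝ᵥ g := by
    rw [hdot]; exact Finset.sum_nonneg fun i _ => mul_self_nonneg _
  rcases le_or_gt 1 (l i₁) with h1 | h1
  · exact (hle g).trans (le_mul_of_one_le_left hgg h1)
  · have hc : ∀ i, i ≠ i₀ → v i ⬝ᵥ u = 0 := by
      intro i hi
      have := hAv i u
      rw [hAu] at this
      have h2 := hl i hi
      have h3 : (1 - l i) * (v i ⬝ᵥ u) = 0 := by linarith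
      exact (mul_eq_zero.1 h3).resolve_left (by linarith)
    have huu : u ⬝ᵥ u ≠ 0 := fun h => hu (dotProduct_self_eq_zero.1 h)
    rw [hdot, Finset.sum_eq_single i₀ (fun i _ hi => by rw [hc i hi, zero_mul]) (by simp)] at huu hg
    have hg0 : v i₀ ⬝ᵥ g = 0 := (mul_eq_zero.1 hg).resolve_left (left_ne_zero_of_mul huu)
    rw [hdot, hdot g g, Finset.mul_sum]
    refine Finset.sum_le_sum fun i _ => ?_
    rw [hAv]
    rcases eq_or_ne i i₀ with rfl | hi
    · simp [hg0]
    · nlinarith [hl i hi, mul_self_nonneg (v i ⬝ᵥ g)]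

/-- Half of Courant–Fischer: the plane spanned by the top two eigenvectors meets the hyperplane
orthogonal to `u`, and on that plane the Rayleigh quotient is at least the second eigenvalue. -/
theorem exists_secondEigenvalue_le_dotProduct_mulVec (hA : A.IsHermitian) (hm : 2 ≤ m) (u : Fin m → ℝ) :
    ∃ g : Fin m → ℝ, g ≠ 0 ∧ u ⬝ᵥ g = 0 ∧
      (A.charpoly.roots.sort (· ≥ ·)).getD 1 0 * (g ⬝ᵥ g) ≤ g ⬝ᵥ (A *ᵥ g) := by
  obtain ⟨v, l, i₀, i₁, hne, hdot, hAv, hv, hl, hl01, hs⟩ :=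
    exists_eigenbasis_secondEigenvalue hA hm
  rw [← hs]
  obtain ⟨a, b, hab, h0⟩ : ∃ a b : ℝ, 0 < a ^ 2 + b ^ 2 ∧ a * (u ⬝ᵥ v i₀) + b * (u ⬝ᵥ v i₁) = 0 := by
    by_cases h : u ⬝ᵥ v i₀ = 0
    · exact ⟨1, 0, by norm_num, by simp [h]⟩
    · exact ⟨-(u ⬝ᵥ v i₁), u ⬝ᵥ v i₀, by positivity, by ring⟩
  have key : ∀ i, v i ⬝ᵥ (a • v i₀ + b • v i₁) =
      (if i = i₀ then a else 0) + if i = i₁ then b else 0 := by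
    intro i
    simp [dotProduct_add, dotProduct_smul, hv]
  have hgg : (a • v i₀ + b • v i₁) ⬝ᵥ (a • v i₀ + b • v i₁) = a ^ 2 + b ^ 2 := by
    simp [dotProduct_add, dotProduct_smul, hv, add_dotProduct, smul_dotProduct, hne, hne.symm]
    ring
  refine ⟨a • v i₀ + b • v i₁, ?_, by simpa [dotProduct_add, dotProduct_smul] using h0, ?_⟩
  · intro h
    rw [h, dotProduct_zero] at hgg
    linarith
  · have h1 : (a • v i₀ + b • v i₁) ⬝ᵥ (A *ᵥ (a • v i₀ + b • v i₁)) =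
        a ^ 2 * l i₀ + b ^ 2 * l i₁ := by
      rw [add_dotProduct, smul_dotProduct, smul_dotProduct, hAv, hAv, key, key]
      simp [hne, hne.symm]
      ring
    rw [hgg, h1]
    nlinarith [sq_nonneg a]

theorem secondEigenvalue_nonneg (hA : A.IsHermitian) (hm : 2 ≤ m) (h : ∀ g, 0 ≤ g ⬝ᵥ (A *ᵥ g)) :
    0 ≤ (A.charpoly.roots.sort (· ≥ ·)).getD 1 0 := by
  obtain ⟨v, l, i₀, i₁, hne, hdot, hAv, hv, hl, hl01, hs⟩ :=
    exists_eigenbasis_secondEigenvalue hA hm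
  rw [← hs]
  simpa [hAv, hv] using h (v i₁)

end SecondEigenvalue

/-! ### The pseudo-spectral gap -/

theorem conj_diagonal_pow {d d' : Fin m → ℝ} (h : ∀ i, d i * d' i = 1)
    (X : Matrix (Fin m) (Fin m) ℝ) (k : ℕ) :
    (Matrix.diagonal d' * X * Matrix.diagonal d) ^ k =
      Matrix.diagonal d' * X ^ k * Matrix.diagonal d := by
  have h1 : Matrix.diagonal d * Matrix.diagonal d' = 1 := by
    rw [Matrix.diagonal_mul_diagonal]; simp [h]
  have h2 : Matrix.diagonal d' * Matrix.diagonal d = 1 := by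
    rw [Matrix.diagonal_mul_diagonal]; simp [mul_comm, h]
  induction k with
  | zero => simp [h2]
  | succ k ih =>
    rw [pow_succ, ih, pow_succ]
    calc _ = Matrix.diagonal d' * X ^ k * (Matrix.diagonal d * Matrix.diagonal d') * X *
          Matrix.diagonal d := by simp only [Matrix.mul_assoc]
      _ = _ := by rw [h1, Matrix.mul_one]; simp only [Matrix.mul_assoc]

/-- The symmetric matrix similar to `(P^*)^k P^k`. -/
def symmetrizedStep (P : TransitionMatrix m) (k : ℕ) : Matrix (Fin m) (Fin m) ℝ :=
  Matrix.diagonal (fun i => √(stationaryDist P i)) * P.1 ^ k *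
    Matrix.diagonal (fun i => (√(stationaryDist P i))⁻¹)

theorem isHermitian_symmetrizedStep (P : TransitionMatrix m) (k : ℕ) :
    ((symmetrizedStep P k)ᵀ * symmetrizedStep P k).IsHermitian := by
  simpa using Matrix.isHermitian_conjTranspose_mul_self (symmetrizedStep P k)

section Gap

variable [Nonempty (Fin m)] {P : TransitionMatrix m}

theorem IsErgodic.sqrt_stationaryDist_pos (hP : IsErgodic P) (i : Fin m) :
    0 < √(stationaryDist P i) := Real.sqrt_pos.2 (hP.stationaryDist_pos i)

/-- With `Δ = diag(√π)` and `S = Δ P^k Δ⁻¹`, the reversal gives `SᵀS = Δ (P^*)^k P^k Δ⁻¹`, a similar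
matrix. The roots defining the spectral gap are thus the eigenvalues of a symmetric matrix. -/
theorem IsErgodic.charpoly_timeReversal_pow_mul_pow (hP : IsErgodic P) (k : ℕ) :
    (timeReversal P ^ k * P.1 ^ k).charpoly =
      ((symmetrizedStep P k)ᵀ * symmetrizedStep P k).charpoly := by
  have hs := fun i => (hP.sqrt_stationaryDist_pos i).ne'
  have hss := fun i => Real.mul_self_sqrt (hP.stationaryDist_pos i).le
  have hπ := fun i => (hP.stationaryDist_pos i).ne'
  have h1 : timeReversal P = Matrix.diagonal (fun i => (stationaryDist P i)⁻¹) * P.1ᵀ *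
      Matrix.diagonal (stationaryDist P) := by
    ext i j
    simp [timeReversal, Matrix.mul_diagonal, Matrix.diagonal_mul]
    ring
  have h2 : Matrix.diagonal (fun i => (√(stationaryDist P i))⁻¹) *
      Matrix.diagonal (fun i => √(stationaryDist P i)) = 1 := by
    rw [Matrix.diagonal_mul_diagonal]; simp [hs]
  have h3 : Matrix.diagonal (fun i => √(stationaryDist P i)) *
      Matrix.diagonal (fun i => (stationaryDist P i)⁻¹) =
      Matrix.diagonal (fun i => (√(stationaryDist P i))⁻¹) := by
    rw [Matrix.diagonal_mul_diagonal]
    congr 1; ext i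
    have := hss i
    have := hs i
    have := hπ i
    field_simp
    linarith
  have h4 : Matrix.diagonal (stationaryDist P) =
      Matrix.diagonal (fun i => √(stationaryDist P i)) *
      Matrix.diagonal (fun i => √(stationaryDist P i)) := by
    rw [Matrix.diagonal_mul_diagonal]
    simp [hss]
  have h5 : (symmetrizedStep P k)ᵀ * symmetrizedStep P k =
      Matrix.diagonal (fun i => √(stationaryDist P i)) * (timeReversal P ^ k * P.1 ^ k) *
      Matrix.diagonal (fun i => (√(stationaryDist P i))⁻¹) := by
    rw [h1, conj_diagonal_pow (fun i => mul_inv_cancel₀ (hπ i)), symmetrizedStep,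
      Matrix.transpose_mul, Matrix.transpose_mul, Matrix.diagonal_transpose,
      Matrix.diagonal_transpose, Matrix.transpose_pow]
    conv_rhs => rw [← Matrix.mul_assoc, ← Matrix.mul_assoc, ← Matrix.mul_assoc, h3, h4]
    simp only [Matrix.mul_assoc]
  rw [h5, Matrix.charpoly_mul_comm (_ * _) (Matrix.diagonal _), ← Matrix.mul_assoc, h2,
    Matrix.one_mul]

/-- The map `f ↦ √π f` is an isometry from `L²(π)` to Euclidean space, and it turns the quadratic
form of `SᵀS` into `‖P^k f‖²` in `L²(π)`. -/
theorem IsErgodic.dotProduct_symmetrizedStep (hP : IsErgodic P) (k : ℕ) (f : Fin m → ℝ) :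
    (fun i => √(stationaryDist P i) * f i) ⬝ᵥ (((symmetrizedStep P k)ᵀ * symmetrizedStep P k) *ᵥ
      (fun i => √(stationaryDist P i) * f i)) =
      ∑ i, stationaryDist P i * (P.1 ^ k *ᵥ f) i ^ 2 := by
  have h1 : symmetrizedStep P k *ᵥ (fun i => √(stationaryDist P i) * f i) =
      fun i => √(stationaryDist P i) * (P.1 ^ k *ᵥ f) i := by
    have : Matrix.diagonal (fun i => (√(stationaryDist P i))⁻¹) *ᵥ
        (fun i => √(stationaryDist P i) * f i) = f := by
      ext i
      rw [Matrix.mulVec_diagonal, inv_mul_cancel_left₀ (hP.sqrt_stationaryDist_pos i).ne']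
    rw [symmetrizedStep, ← Matrix.mulVec_mulVec, this, ← Matrix.mulVec_mulVec]
    ext i
    rw [Matrix.mulVec_diagonal]
  rw [← Matrix.mulVec_mulVec, Matrix.dotProduct_mulVec, Matrix.vecMul_transpose, h1]
  refine Finset.sum_congr rfl fun i _ => ?_
  have := Real.mul_self_sqrt (hP.stationaryDist_pos i).le
  simp only
  linear_combination ((P.1 ^ k *ᵥ f) i) ^ 2 * this

theorem IsErgodic.dotProduct_sqrt_mul (hP : IsErgodic P) (f g : Fin m → ℝ) :
    (fun i => √(stationaryDist P i) * f i) ⬝ᵥ (fun i => √(stationaryDist P i) * g i) =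
      ∑ i, stationaryDist P i * (f i * g i) := by
  refine Finset.sum_congr rfl fun i _ => ?_
  have := Real.mul_self_sqrt (hP.stationaryDist_pos i).le
  linear_combination (f i * g i) * this

theorem IsErgodic.eq_sqrt_mul (hP : IsErgodic P) (g : Fin m → ℝ) :
    g = fun i => √(stationaryDist P i) * ((√(stationaryDist P i))⁻¹ * g i) := by
  ext i
  rw [mul_inv_cancel_left₀ (hP.sqrt_stationaryDist_pos i).ne']

theorem IsErgodic.dotProduct_symmetrizedStep_le (hP : IsErgodic P) (k : ℕ) (g : Fin m → ℝ) :
    g ⬝ᵥ (((symmetrizedStep P k)ᵀ * symmetrizedStep P k) *ᵥ g) ≤ g ⬝ᵥ g := by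
  rw [hP.eq_sqrt_mul g, hP.dotProduct_symmetrizedStep, hP.dotProduct_sqrt_mul]
  simp_rw [← pow_two]
  exact ((isStationary_stationaryDist P).npow k).sum_sq_mulVec_le _

/-- Contraction of mean-zero functions by the `k`-step matrix. -/
theorem IsErgodic.sum_sq_pow_mulVec_le (hP : IsErgodic P) (hm : 2 ≤ m) (k : ℕ) {f : Fin m → ℝ}
    (hf : ∑ i, stationaryDist P i * f i = 0) :
    ∑ i, stationaryDist P i * (P.1 ^ k *ᵥ f) i ^ 2 ≤
      (1 - spectralGap (timeReversal P ^ k * P.1 ^ k)) * ∑ i, stationaryDist P i * f i ^ 2 := by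
  have hu : (fun i => √(stationaryDist P i) * (1 : Fin m → ℝ) i) ≠ 0 := by
    obtain ⟨i⟩ := ‹Nonempty (Fin m)›
    intro h
    have := congrFun h i
    simp only [Pi.one_apply, mul_one, Pi.zero_apply] at this
    exact (hP.sqrt_stationaryDist_pos i).ne' this
  -- `√π` is fixed by `S` because the constant 1 is harmonic, and by `Sᵀ` because `π` is stationary.
  have hAu : ((symmetrizedStep P k)ᵀ * symmetrizedStep P k) *ᵥ
      (fun i => √(stationaryDist P i) * (1 : Fin m → ℝ) i) =
      (fun i => √(stationaryDist P i) * (1 : Fin m → ℝ) i) := by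
    have hs := fun i => (hP.sqrt_stationaryDist_pos i).ne'
    have hss := fun i => Real.mul_self_sqrt (hP.stationaryDist_pos i).le
    have e1 : symmetrizedStep P k *ᵥ (fun i => √(stationaryDist P i) * (1 : Fin m → ℝ) i) =
        fun i => √(stationaryDist P i) := by
      have e0 : Matrix.diagonal (fun i => (√(stationaryDist P i))⁻¹) *ᵥ
          (fun i => √(stationaryDist P i) * (1 : Fin m → ℝ) i) = 1 := by
        ext i
        rw [Matrix.mulVec_diagonal, inv_mul_cancel_left₀ (hs i)]
      rw [symmetrizedStep, ← Matrix.mulVec_mulVec, e0, ← Matrix.mulVec_mulVec,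
        show P.1 ^ k *ᵥ 1 = 1 from (P.npow k).2.2]
      ext i
      rw [Matrix.mulVec_diagonal]
      simp
    have e2 : (fun i => √(stationaryDist P i)) ᵥ* symmetrizedStep P k =
        fun i => √(stationaryDist P i) := by
      have e0 : (fun i => √(stationaryDist P i)) ᵥ*
          Matrix.diagonal (fun i => √(stationaryDist P i)) = stationaryDist P := by
        ext i
        rw [Matrix.vecMul_diagonal, hss]
      rw [symmetrizedStep, ← Matrix.vecMul_vecMul, ← Matrix.vecMul_vecMul, e0,
        (isStationary_stationaryDist P).vecMul_pow]
      ext i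
      rw [Matrix.vecMul_diagonal, mul_inv_eq_iff_eq_mul₀ (hs i), hss]
    rw [← Matrix.mulVec_mulVec, e1, Matrix.mulVec_transpose, e2]
    simp
  have := dotProduct_mulVec_le_secondEigenvalue (isHermitian_symmetrizedStep P k) hm hu hAu
    (hP.dotProduct_symmetrizedStep_le k) (g := fun i => √(stationaryDist P i) * f i)
    (by rw [hP.dotProduct_sqrt_mul]; simpa using hf)
  rw [hP.dotProduct_symmetrizedStep, hP.dotProduct_sqrt_mul,
    ← hP.charpoly_timeReversal_pow_mul_pow] at this
  simpa [spectralGap, pow_two] using this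

theorem IsErgodic.spectralGap_le_one (hP : IsErgodic P) (hm : 2 ≤ m) (k : ℕ) :
    spectralGap (timeReversal P ^ k * P.1 ^ k) ≤ 1 := by
  have := secondEigenvalue_nonneg (isHermitian_symmetrizedStep P k) hm (fun g => by
    rw [hP.eq_sqrt_mul g, hP.dotProduct_symmetrizedStep]
    exact Finset.sum_nonneg fun i _ => mul_nonneg (hP.stationaryDist_pos i).le (sq_nonneg _))
  rw [← hP.charpoly_timeReversal_pow_mul_pow] at this
  unfold spectralGap
  linarith

/-- If `λ₂ ≥ 1`, some nonzero function of mean zero loses no norm under `P^k`. The variance identity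
with strictly positive weights forces it to be constant, hence zero. -/
theorem IsErgodic.spectralGap_pos (hP : IsErgodic P) (hm : 2 ≤ m) {k : ℕ}
    (hk : ∀ i j, 0 < (P.1 ^ k) i j) :
    0 < spectralGap (timeReversal P ^ k * P.1 ^ k) := by
  obtain ⟨g, hg0, hug, hg⟩ := exists_secondEigenvalue_le_dotProduct_mulVec
    (isHermitian_symmetrizedStep P k) hm (fun i => √(stationaryDist P i) * (1 : Fin m → ℝ) i)
  rw [← hP.charpoly_timeReversal_pow_mul_pow] at hg
  by_contra! hneg
  have hle : 1 ≤ ((timeReversal P ^ k * P.1 ^ k).charpoly.roots.sort (· ≥ ·)).getD 1 0 := by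
    unfold spectralGap at hneg; linarith
  have hgg : 0 ≤ g ⬝ᵥ g := Finset.sum_nonneg fun i _ => mul_self_nonneg _
  have h1 := (le_mul_of_one_le_left hgg hle).trans hg
  have hst := (isStationary_stationaryDist P).npow k
  obtain ⟨f, rfl⟩ : ∃ f : Fin m → ℝ, g = fun i => √(stationaryDist P i) * f i := ⟨_, hP.eq_sqrt_mul g⟩
  rw [hP.dotProduct_symmetrizedStep, hP.dotProduct_sqrt_mul] at h1
  rw [hP.dotProduct_sqrt_mul] at hug
  simp_rw [← pow_two] at h1
  have h2 := hst.sum_sq_sub f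
  change _ - ∑ i, stationaryDist P i * (P.1 ^ k *ᵥ f) i ^ 2 =
    ∑ i, ∑ j, stationaryDist P i * (P.1 ^ k) i j * (f j - (P.1 ^ k *ᵥ f) i) ^ 2 at h2
  have hn : ∀ i j, 0 ≤ stationaryDist P i * (P.1 ^ k) i j * (f j - (P.1 ^ k *ᵥ f) i) ^ 2 :=
    fun i j => mul_nonneg (mul_pos (hP.stationaryDist_pos i) (hk i j)).le (sq_nonneg _)
  have h0 : ∑ i, ∑ j, stationaryDist P i * (P.1 ^ k) i j * (f j - (P.1 ^ k *ᵥ f) i) ^ 2 = 0 :=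
    le_antisymm (by linarith) (Finset.sum_nonneg fun i _ => Finset.sum_nonneg fun j _ => hn i j)
  have hconst : ∀ i j, f j = (P.1 ^ k *ᵥ f) i := by
    intro i j
    have := (Finset.sum_eq_zero_iff_of_nonneg fun j _ => hn i j).1
      ((Finset.sum_eq_zero_iff_of_nonneg fun i _ => Finset.sum_nonneg fun j _ => hn i j).1 h0 i
        (Finset.mem_univ i)) j (Finset.mem_univ j)
    have := (mul_eq_zero.1 this).resolve_left (mul_pos (hP.stationaryDist_pos i) (hk i j)).ne'
    have := pow_eq_zero_iff (two_ne_zero) |>.1 this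
    linarith
  obtain ⟨i₀⟩ := ‹Nonempty (Fin m)›
  have hf : ∀ i, f i = (P.1 ^ k *ᵥ f) i₀ := fun i => hconst i₀ i
  have hf0 : (P.1 ^ k *ᵥ f) i₀ = 0 := by
    have := hug
    simp_rw [Pi.one_apply, one_mul, hf] at this
    rw [← Finset.sum_mul] at this
    rw [sum_stationaryDist] at this
    simpa using this
  exact hg0 (by ext i; simp [hf i, hf0])

theorem IsErgodic.spectralGap_div_le (hP : IsErgodic P) (hm : 2 ≤ m) (k : ℕ+) :
    spectralGap (timeReversal P ^ (k : ℕ) * P.1 ^ (k : ℕ)) / (k : ℕ) ≤ 1 / (k : ℕ) := by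
  gcongr
  exact hP.spectralGap_le_one hm k

theorem IsErgodic.bddAbove_spectralGap_div (hP : IsErgodic P) (hm : 2 ≤ m) :
    BddAbove (Set.range fun k : ℕ+ =>
      spectralGap (timeReversal P ^ (k : ℕ) * P.1 ^ (k : ℕ)) / (k : ℕ)) := by
  refine ⟨1, ?_⟩
  rintro _ ⟨k, rfl⟩
  refine (hP.spectralGap_div_le hm k).trans ?_
  rw [div_le_one (by exact_mod_cast k.pos)]
  exact_mod_cast k.pos

theorem IsErgodic.pseudoSpectralGap_pos (hP : IsErgodic P) (hm : 2 ≤ m) :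
    0 < pseudoSpectralGap P := by
  obtain ⟨N, hN⟩ := hP.exists_pow_pos
  have h1 := hP.spectralGap_pos hm (hN (N + 1) (by omega))
  refine lt_of_lt_of_le ?_ (le_ciSup (hP.bddAbove_spectralGap_div hm) ⟨N + 1, by omega⟩)
  simp only [PNat.mk_coe]
  positivity

/-- The `k`-th term is at most `1/k`, so only finitely many terms compete for the positive supremum,
and it is attained. -/
theorem IsErgodic.exists_pseudoSpectralGap_eq (hP : IsErgodic P) (hm : 2 ≤ m) :
    ∃ k : ℕ, 1 ≤ k ∧
      spectralGap (timeReversal P ^ k * P.1 ^ k) = k * pseudoSpectralGap P := by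
  have hγ := hP.pseudoSpectralGap_pos hm
  set γ := pseudoSpectralGap P with hγdef
  -- Beyond this `n` every term is below `γ / 2`.
  obtain ⟨n, hn⟩ := exists_nat_gt (2 / γ)
  have hn0 : (0 : ℝ) < n := lt_trans (by positivity) hn
  by_contra! hne
  have hlt : ∀ k : ℕ+, spectralGap (timeReversal P ^ (k : ℕ) * P.1 ^ (k : ℕ)) / (k : ℕ) < γ := by
    intro k
    refine lt_of_le_of_ne (le_ciSup (hP.bddAbove_spectralGap_div hm) k) fun h => ?_
    have hk : ((k : ℕ) : ℝ) ≠ 0 := by exact_mod_cast k.pos.ne'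
    rw [div_eq_iff hk] at h
    exact hne k k.pos (by rw [h, mul_comm])
  have hfin : ∃ c < γ, ∀ k : ℕ+, (k : ℕ) ≤ n →
      spectralGap (timeReversal P ^ (k : ℕ) * P.1 ^ (k : ℕ)) / (k : ℕ) ≤ c := by
    have hs : {k : ℕ+ | (k : ℕ) ≤ n}.Finite :=
      Set.Finite.preimage (PNat.coe_injective.injOn) (Set.finite_Iic n)
    obtain ⟨k₀, -, hk₀⟩ := hs.toFinset.exists_max_image
      (fun k : ℕ+ => spectralGap (timeReversal P ^ (k : ℕ) * P.1 ^ (k : ℕ)) / (k : ℕ))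
      ⟨1, by
        simp only [Set.Finite.mem_toFinset, Set.mem_ofPred_eq, PNat.one_coe]
        exact_mod_cast hn0⟩
    exact ⟨_, hlt k₀, fun k hk => hk₀ k (by simpa using hk)⟩
  obtain ⟨c, hc, hck⟩ := hfin
  have : γ ≤ max c (γ / 2) := ciSup_le fun k => by
    rcases le_or_gt (k : ℕ) n with h | h
    · exact (hck k h).trans (le_max_left _ _)
    · refine (hP.spectralGap_div_le hm k).trans (le_trans ?_ (le_max_right _ _))
      have hkn : (n : ℝ) < (k : ℕ) := by exact_mod_cast h
      rw [div_le_iff₀ (hn0.trans hkn)]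
      rw [div_lt_iff₀ hγ] at hn
      nlinarith
  have : max c (γ / 2) < γ := max_lt hc (by linarith)
  linarith

end Gap

/-! ### Geometric ergodicity and the Poisson equation -/

section Poisson

variable [Nonempty (Fin m)] {P : TransitionMatrix m}

theorem sum_stationaryDist_mul_pow_mulVec (P : TransitionMatrix m) (n : ℕ) (f : Fin m → ℝ) :
    ∑ i, stationaryDist P i * (P.1 ^ n *ᵥ f) i = ∑ i, stationaryDist P i * f i :=
  ((isStationary_stationaryDist P).npow n).sum_mul_mulVec f

theorem IsErgodic.pseudoSpectralGap_le_one (hP : IsErgodic P) (hm : 2 ≤ m) :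
    pseudoSpectralGap P ≤ 1 :=
  ciSup_le fun k => (hP.spectralGap_div_le hm k).trans <| by
    rw [div_le_one (by exact_mod_cast k.pos)]
    exact_mod_cast k.pos

/-- For a `k` attaining the gap, each block of `k` steps contracts by `1 - kγ ≤ (1 - γ)^k`
(Bernoulli). The incomplete last block wastes fewer than `k` steps, and `k ≤ 1/γ` because `λ₂ ≥ 0`.
-/
theorem IsErgodic.sum_sq_pow_mulVec_le_rpow (hP : IsErgodic P) (hm : 2 ≤ m)
    (hγ1 : pseudoSpectralGap P < 1) {f : Fin m → ℝ} (hf : ∑ i, stationaryDist P i * f i = 0)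
    (n : ℕ) :
    ∑ i, stationaryDist P i * (P.1 ^ n *ᵥ f) i ^ 2 ≤
      (1 - pseudoSpectralGap P) ^ ((n : ℝ) - 1 / pseudoSpectralGap P) *
        ∑ i, stationaryDist P i * f i ^ 2 := by
  obtain ⟨k, hk1, hk⟩ := hP.exists_pseudoSpectralGap_eq hm
  have hγ := hP.pseudoSpectralGap_pos hm
  have hkle := hP.spectralGap_le_one hm k
  have hcon := fun g hg => hP.sum_sq_pow_mulVec_le hm k (f := g) hg
  rw [hk] at hkle hcon
  set γ := pseudoSpectralGap P
  have hV : ∀ g : Fin m → ℝ, 0 ≤ ∑ i, stationaryDist P i * g i ^ 2 := fun g =>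
    Finset.sum_nonneg fun i _ => mul_nonneg (hP.stationaryDist_pos i).le (sq_nonneg _)
  have hq : ∀ q r : ℕ, ∑ i, stationaryDist P i * (P.1 ^ (k * q + r) *ᵥ f) i ^ 2 ≤
      (1 - k * γ) ^ q * ∑ i, stationaryDist P i * f i ^ 2 := by
    intro q r
    induction q with
    | zero =>
      simpa using (show ∑ i, stationaryDist P i * (P.1 ^ r *ᵥ f) i ^ 2 ≤ _ from
        ((isStationary_stationaryDist P).npow r).sum_sq_mulVec_le f)
    | succ q ih =>
      have e : P.1 ^ (k * (q + 1) + r) *ᵥ f = P.1 ^ k *ᵥ (P.1 ^ (k * q + r) *ᵥ f) := by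
        rw [Matrix.mulVec_mulVec, ← pow_add]
        congr 2; ring
      rw [e]
      refine (hcon _ (by rw [sum_stationaryDist_mul_pow_mulVec, hf])).trans ?_
      rw [pow_succ', mul_assoc]
      exact mul_le_mul_of_nonneg_left ih (by linarith)
  refine (by simpa [Nat.div_add_mod] using hq (n / k) (n % k) :
    ∑ i, stationaryDist P i * (P.1 ^ n *ᵥ f) i ^ 2 ≤
      (1 - k * γ) ^ (n / k) * ∑ i, stationaryDist P i * f i ^ 2).trans ?_
  refine mul_le_mul_of_nonneg_right ?_ (hV f)
  have hb : 1 - k * γ ≤ (1 - γ) ^ k := by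
    have := one_add_mul_le_pow (a := -γ) (by linarith) k
    calc 1 - k * γ = 1 + k * -γ := by ring
      _ ≤ _ := this
      _ = _ := by ring
  calc (1 - k * γ) ^ (n / k) ≤ ((1 - γ) ^ k) ^ (n / k) := by
        gcongr
    _ = (1 - γ) ^ (((k * (n / k) : ℕ) : ℝ)) := by rw [Real.rpow_natCast, pow_mul]
    _ ≤ _ := by
        refine Real.rpow_le_rpow_of_exponent_ge (by linarith) (by linarith) ?_
        have h1 : n < k * (n / k) + k := by
          have := Nat.div_add_mod n k
          have := Nat.mod_lt n (show 0 < k by omega)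
          omega
        have h2 : (n : ℝ) < (k * (n / k) : ℕ) + k := by exact_mod_cast h1
        have h3 : (k : ℝ) ≤ 1 / γ := by rw [le_div_iff₀ hγ]; exact hkle
        linarith

/-- Uniform geometric ergodicity, with the constants of the pseudo-spectral gap. -/
theorem IsErgodic.exists_abs_pow_mulVec_le (hP : IsErgodic P) (hm : 2 ≤ m) {M : ℝ} (hM : 0 ≤ M) :
    ∃ c ρ : ℝ, 0 ≤ ρ ∧ ρ < 1 ∧ c / (1 - ρ) ≤ poissonConst P * M ∧
      ∀ f : Fin m → ℝ, (∀ x, |f x| ≤ M) → ∑ i, stationaryDist P i * f i = 0 →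
        ∀ n x, |(P.1 ^ n *ᵥ f) x| ≤ c * ρ ^ n := by
  have hγ := hP.pseudoSpectralGap_pos hm
  rcases (hP.pseudoSpectralGap_le_one hm).lt_or_eq with h1 | h1
  · have hdec := fun f hf => hP.sum_sq_pow_mulVec_le_rpow hm h1 (f := f) hf
    rw [poissonConst, if_neg h1.ne]
    set γ := pseudoSpectralGap P
    have hπ := hP.minStationary_pos
    have hρ1 : √(1 - γ) < 1 := by rw [Real.sqrt_lt' one_pos]; linarith
    -- The square root of the `L²(π)` bound, with a factor `1/√π_*` for isolating one state. Summing
    -- the geometric series with ratio `√(1 - γ)` yields exactly `C_P M`.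
    refine ⟨M * ((1 - γ) ^ (-(1 / (2 * γ))) / √(minStationary P)), √(1 - γ), Real.sqrt_nonneg _,
      hρ1, le_of_eq (by ring), fun f hfM hf n x => ?_⟩
    refine abs_le_of_sq_le_sq ?_ ?_
    · have hV : ∑ i, stationaryDist P i * f i ^ 2 ≤ M ^ 2 := by
        calc ∑ i, stationaryDist P i * f i ^ 2 ≤ ∑ i, stationaryDist P i * M ^ 2 := by
              refine Finset.sum_le_sum fun i _ => mul_le_mul_of_nonneg_left ?_
                (hP.stationaryDist_pos i).le
              exact sq_le_sq' (by linarith [(abs_le.1 (hfM i)).1]) (abs_le.1 (hfM i)).2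
          _ = M ^ 2 := by rw [← Finset.sum_mul, sum_stationaryDist, one_mul]
      have h2 : minStationary P * (P.1 ^ n *ᵥ f) x ^ 2 ≤
          (1 - γ) ^ ((n : ℝ) - 1 / γ) * M ^ 2 := by
        calc minStationary P * (P.1 ^ n *ᵥ f) x ^ 2
            ≤ stationaryDist P x * (P.1 ^ n *ᵥ f) x ^ 2 :=
              mul_le_mul_of_nonneg_right (minStationary_le P x) (sq_nonneg _)
          _ ≤ ∑ i, stationaryDist P i * (P.1 ^ n *ᵥ f) i ^ 2 :=
              Finset.single_le_sum (f := fun i => stationaryDist P i * (P.1 ^ n *ᵥ f) i ^ 2)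
                (fun i _ => mul_nonneg (hP.stationaryDist_pos i).le (sq_nonneg _))
                (Finset.mem_univ x)
          _ ≤ (1 - γ) ^ ((n : ℝ) - 1 / γ) * ∑ i, stationaryDist P i * f i ^ 2 := hdec f hf n
          _ ≤ _ := mul_le_mul_of_nonneg_left hV (Real.rpow_nonneg (by linarith) _)
      have h3 : (M * ((1 - γ) ^ (-(1 / (2 * γ))) / √(minStationary P)) * √(1 - γ) ^ n) ^ 2 =
          (1 - γ) ^ ((n : ℝ) - 1 / γ) * M ^ 2 / minStationary P := by
        have e1 : ((1 - γ) ^ (-(1 / (2 * γ)))) ^ 2 = (1 - γ) ^ (-(1 / γ)) := by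
          rw [← Real.rpow_mul_natCast (by linarith)]
          congr 1
          field_simp
          norm_num
        have e2 : (√(1 - γ) ^ n) ^ 2 = (1 - γ) ^ n := by
          rw [← pow_mul, mul_comm n 2, pow_mul, Real.sq_sqrt (by linarith)]
        rw [mul_pow, mul_pow, div_pow, e1, e2, Real.sq_sqrt hπ.le, sub_eq_add_neg (n : ℝ),
          Real.rpow_add (by linarith), Real.rpow_natCast]
        ring
      rw [h3, le_div_iff₀ hπ, mul_comm]
      exact h2
    · have : 0 ≤ 1 - γ := by linarith
      positivity
  · refine ⟨M, 0, le_rfl, one_pos, ?_, fun f hfM hf n x => ?_⟩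
    · rw [poissonConst, if_pos h1, sub_zero, div_one]; linarith
    -- When `γ = 1`, the relation `kγ ≤ 1` leaves only `k = 1`, and the contraction factor is 0. So
    -- `P` kills every centred function and only the term `n = 0` survives, in agreement with `0 ^ 0
    -- = 1`.
    · obtain ⟨k, hk1, hk⟩ := hP.exists_pseudoSpectralGap_eq hm
      have hkle := hP.spectralGap_le_one hm k
      have hcon := hP.sum_sq_pow_mulVec_le hm k hf
      rw [hk, h1, mul_one] at hkle hcon
      have hk' : k = 1 := le_antisymm (by exact_mod_cast hkle) hk1
      subst hk'
      simp only [Nat.cast_one, sub_self, zero_mul, pow_one] at hcon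
      have h0 : P.1 *ᵥ f = 0 := by
        ext i
        have hnn : ∀ i, 0 ≤ stationaryDist P i * (P.1 *ᵥ f) i ^ 2 :=
          fun i => mul_nonneg (hP.stationaryDist_pos i).le (sq_nonneg _)
        have := (Finset.sum_eq_zero_iff_of_nonneg fun i _ => hnn i).1
          (le_antisymm hcon (Finset.sum_nonneg fun i _ => hnn i)) i (Finset.mem_univ i)
        have := (mul_eq_zero.1 this).resolve_left (hP.stationaryDist_pos i).ne'
        simpa using this
      rcases n with _ | n
      · simpa using hfM x
      · rw [pow_succ, ← Matrix.mulVec_mulVec, h0]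
        simp

/-- The Poisson equation has a solution bounded by the Poisson constant. -/
theorem IsErgodic.exists_poisson (hP : IsErgodic P) (hm : 2 ≤ m) {M : ℝ} {f : Fin m → ℝ}
    (hf0 : ∀ x, 0 ≤ f x) (hfM : ∀ x, f x ≤ M) :
    ∃ h : Fin m → ℝ, (∀ x, h x - ∑ y, P.1 x y * h y = f x - ∑ i, stationaryDist P i * f i) ∧
      ∀ x, |h x| ≤ poissonConst P * M := by
  obtain ⟨x₀⟩ := ‹Nonempty (Fin m)›
  have hM : 0 ≤ M := (hf0 x₀).trans (hfM x₀)
  obtain ⟨c, ρ, hρ0, hρ1, hcρ, hb⟩ := hP.exists_abs_pow_mulVec_le hm hM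
  set D := ∑ i, stationaryDist P i * f i with hD
  have hD0 : 0 ≤ D := Finset.sum_nonneg fun i _ => mul_nonneg (hP.stationaryDist_pos i).le (hf0 i)
  have hDM : D ≤ M := by
    calc D ≤ ∑ i, stationaryDist P i * M := Finset.sum_le_sum fun i _ =>
          mul_le_mul_of_nonneg_left (hfM i) (hP.stationaryDist_pos i).le
      _ = M := by rw [← Finset.sum_mul, sum_stationaryDist, one_mul]
  let g : Fin m → ℝ := fun x => f x - D
  -- Both `f` and its mean lie in `[0, M]`, so centring costs no factor 2.
  have hgM : ∀ x, |g x| ≤ M := fun x => abs_le.2 ⟨by simp only [g]; linarith [hf0 x],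
    by simp only [g]; linarith [hfM x]⟩
  have hg0 : ∑ i, stationaryDist P i * g i = 0 := by
    simp only [g, mul_sub, Finset.sum_sub_distrib, ← Finset.sum_mul, sum_stationaryDist]
    simp [hD]
  have hu := (hasSum_geometric_of_lt_one hρ0 hρ1).mul_left c
  have hsum : ∀ x, Summable fun n => (P.1 ^ n *ᵥ g) x := fun x =>
    Summable.of_norm_bounded hu.summable fun n => by
      rw [Real.norm_eq_abs]; exact hb g hgM hg0 n x
  -- The Neumann series of the centred function; applying `P` drops its first term.
  refine ⟨fun x => ∑' n, (P.1 ^ n *ᵥ g) x, fun x => ?_, fun x => ?_⟩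
  · have e1 : ∑ y, P.1 x y * ∑' n, (P.1 ^ n *ᵥ g) y = ∑' n, (P.1 ^ (n + 1) *ᵥ g) x := by
      simp_rw [← tsum_mul_left]
      rw [← Summable.tsum_finsetSum fun y _ => (hsum y).mul_left _]
      refine tsum_congr fun n => ?_
      rw [pow_succ', ← Matrix.mulVec_mulVec]
      rfl
    rw [e1]
    simp only
    rw [(hsum x).tsum_eq_zero_add]
    simp [g]
  · have := tsum_of_norm_bounded hu (f := fun n => (P.1 ^ n *ᵥ g) x) fun n => by
      rw [Real.norm_eq_abs]; exact hb g hgM hg0 n x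
    rw [Real.norm_eq_abs, ← div_eq_mul_inv] at this
    exact this.trans hcρ

end Poisson

/-! ### The path law: functions of finitely many coordinates -/

/-- Extend a path of length `n` to an infinite one, by repeating the last state. -/
def extendPath (n : ℕ) (x : (i : Finset.Iic n) → (fun _ : ℕ => Fin m) i) : ℕ → Fin m :=
  fun t => x ⟨min t n, Finset.mem_Iic.2 (min_le_right t n)⟩

theorem extendPath_apply {n t : ℕ} (ht : t ≤ n)
    (x : (i : Finset.Iic n) → (fun _ : ℕ => Fin m) i) :
    extendPath n x t = x ⟨t, Finset.mem_Iic.2 ht⟩ := by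
  exact congrArg x (Subtype.ext (min_eq_left ht))

theorem extendPath_frestrictLe {n t : ℕ} (ht : t ≤ n) (ω : ℕ → Fin m) :
    extendPath n (Preorder.frestrictLe n ω) t = ω t := by
  rw [extendPath_apply ht]; rfl

section DependsOn

variable {β : Type*} {n : ℕ} {f : (ℕ → Fin m) → β}

/-- Such a function factors through the finite discrete space of paths of length `n`, from which
measurability and integrability are automatic. -/
theorem _root_.DependsOn.eq_extendPath (hf : DependsOn f (Set.Iic n)) :
    f = fun ω => f (extendPath n (Preorder.frestrictLe n ω)) :=
  funext fun _ => hf fun _ ht => (extendPath_frestrictLe ht _).symm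

theorem measurable_frestrictLe_natFiltration (n : ℕ) :
    Measurable[natFiltration m n] (Preorder.frestrictLe (π := fun _ : ℕ => Fin m) n) := by
  rw [@measurable_pi_iff]
  intro i
  have hi : (i : ℕ) ≤ n := Finset.mem_Iic.1 i.2
  have h : MeasurableSpace.comap (fun ω : ℕ → Fin m => ω i) inferInstance ≤ natFiltration m n :=
    le_iSup₂ (f := fun (j : ℕ) (_ : j ≤ n) =>
      MeasurableSpace.comap (fun ω : ℕ → Fin m => ω j) inferInstance) (i : ℕ) hi
  exact (comap_measurable _).mono h le_rfl

theorem _root_.DependsOn.measurable_natFiltration [MeasurableSpace β]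
    (hf : DependsOn f (Set.Iic n)) : Measurable[natFiltration m n] f := by
  rw [hf.eq_extendPath]
  exact (Measurable.of_discrete (f := fun x => f (extendPath n x))).comp
    (measurable_frestrictLe_natFiltration n)

theorem _root_.DependsOn.measurable [MeasurableSpace β]
    (hf : DependsOn f (Set.Iic n)) : Measurable f :=
  hf.measurable_natFiltration.mono ((natFiltration m).le n) le_rfl

/-- Turns the abstract measurability in the definition of a test into pathwise statements about
`X_0, …, X_n`. -/
theorem dependsOn_mem_of_measurableSet {S : Set (ℕ → Fin m)}
    (hS : MeasurableSet[natFiltration m n] S) : DependsOn (fun ω => ω ∈ S) (Set.Iic n) := by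
  have h : (natFiltration m n : MeasurableSpace _) ≤
      MeasurableSpace.comap (Preorder.frestrictLe (π := fun _ : ℕ => Fin m) n) inferInstance := by
    refine iSup₂_le fun j hj => ?_
    rw [← measurable_iff_comap_le]
    exact (measurable_pi_apply (X := fun _ : Finset.Iic n => Fin m)
      (⟨j, Finset.mem_Iic.2 hj⟩ : Finset.Iic n)).comp (comap_measurable _)
  obtain ⟨T, -, rfl⟩ := h S hS
  intro x y hxy
  have : Preorder.frestrictLe (π := fun _ : ℕ => Fin m) n x = Preorder.frestrictLe n y :=
    funext fun i => hxy i (Finset.mem_Iic.1 i.2)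
  simp only [Set.mem_preimage, this]

theorem measurableSet_natFiltration_of_dependsOn {S : Set (ℕ → Fin m)}
    (hS : DependsOn (fun ω => ω ∈ S) (Set.Iic n)) : MeasurableSet[natFiltration m n] S :=
  @measurableSet_setOfPred _ (natFiltration m n) _ |>.2 hS.measurable_natFiltration

theorem measurableSet_of_dependsOn {S : Set (ℕ → Fin m)}
    (hS : DependsOn (fun ω => ω ∈ S) (Set.Iic n)) : MeasurableSet S :=
  (natFiltration m).le n _ (measurableSet_natFiltration_of_dependsOn hS)

end DependsOn

/-! ### Expectations, the Markov property and change of measure under the path law. -/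

section Law

variable (P : TransitionMatrix m) (μ : stdSimplex ℝ (Fin m)) {n : ℕ}

/-- The probability that the chain starts by the first `n` steps of the path `x`. -/
def pathWeight (n : ℕ) (x : ℕ → Fin m) : ℝ :=
  μ.1 (x 0) * ∏ t ∈ Finset.range n, P.1 (x t) (x (t + 1))

/-- Expectations of functions of `X_0, …, X_n` are finite sums over paths. -/
theorem lintegral_chainLaw_eq_sum {f : (ℕ → Fin m) → ℝ≥0∞} (hf : DependsOn f (Set.Iic n)) :
    ∫⁻ ω, f ω ∂(chainLaw P μ) = ∑ x : ((i : Finset.Iic n) → (fun _ : ℕ => Fin m) i),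
      f (extendPath n x) * ENNReal.ofReal (pathWeight P μ n (extendPath n x)) := by
  conv_lhs => rw [hf.eq_extendPath]
  rw [← lintegral_map (f := fun x => f (extendPath n x)) Measurable.of_discrete (by fun_prop),
    lintegral_fintype]
  refine Finset.sum_congr rfl fun x _ => ?_
  rw [Measure.map_apply (by fun_prop) (measurableSet_singleton _), pathWeight,
    ← chainLaw_cylinder]
  congr 2
  ext ω
  simp only [Set.mem_preimage, Set.mem_singleton_iff, Set.mem_ofPred_eq, funext_iff]
  constructor
  · intro h t ht
    rw [extendPath_apply ht, ← h]; rfl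
  · intro h i
    have hi := Finset.mem_Iic.1 i.2
    have := h i hi
    rw [extendPath_apply hi] at this
    exact this

theorem map_frestrictLe_compProd :
    (chainLaw P μ).map (Preorder.frestrictLe n) ⊗ₘ pastKernel P n =
      (chainLaw P μ).map (fun ω => (Preorder.frestrictLe n ω, ω (n + 1))) :=
  Kernel.map_frestrictLe_trajMeasure_compProd_eq_map_trajMeasure
    (X := fun _ : ℕ => Fin m) (μ₀ := vecMeasure μ) (κ := pastKernel P) (a := n)

theorem lintegral_vecMeasure (v : stdSimplex ℝ (Fin m)) (g : Fin m → ℝ≥0∞) :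
    ∫⁻ y, g y ∂(vecMeasure v) = ∑ y, ENNReal.ofReal (v.1 y) * g y := by
  rw [lintegral_fintype]
  exact Finset.sum_congr rfl fun y _ => by rw [vecMeasure_singleton, mul_comm]

theorem integral_vecMeasure (v : stdSimplex ℝ (Fin m)) (g : Fin m → ℝ) :
    ∫ y, g y ∂(vecMeasure v) = ∑ y, v.1 y * g y := by
  rw [integral_fintype Integrable.of_finite]
  refine Finset.sum_congr rfl fun y _ => ?_
  rw [Measure.real, vecMeasure_singleton, ENNReal.toReal_ofReal (v.2.1 y), smul_eq_mul]

/-- The Markov property. -/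
theorem lintegral_markov {G : (ℕ → Fin m) → Fin m → ℝ≥0∞}
    (hG : ∀ y, DependsOn (fun ω => G ω y) (Set.Iic n)) :
    ∫⁻ ω, G ω (ω (n + 1)) ∂(chainLaw P μ) =
      ∫⁻ ω, ∑ y, ENNReal.ofReal (P.1 (ω n) y) * G ω y ∂(chainLaw P μ) := by
  have e1 : ∀ ω y, G ω y = G (extendPath n (Preorder.frestrictLe n ω)) y :=
    fun ω y => congrFun (hG y).eq_extendPath ω
  have e2 : ∀ ω : ℕ → Fin m, ω n = extendPath n (Preorder.frestrictLe n ω) n :=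
    fun ω => (extendPath_frestrictLe le_rfl ω).symm
  calc ∫⁻ ω, G ω (ω (n + 1)) ∂(chainLaw P μ)
      = ∫⁻ p, G (extendPath n p.1) p.2 ∂((chainLaw P μ).map
          (fun ω => (Preorder.frestrictLe n ω, ω (n + 1)))) := by
        rw [lintegral_map Measurable.of_discrete (by fun_prop)]
        exact lintegral_congr fun ω => e1 ω _
    _ = ∫⁻ x, ∑ y, ENNReal.ofReal (P.1 (extendPath n x n) y) * G (extendPath n x) y
          ∂((chainLaw P μ).map (Preorder.frestrictLe n)) := by
        rw [← map_frestrictLe_compProd, Measure.lintegral_compProd Measurable.of_discrete]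
        refine lintegral_congr fun x => ?_
        rw [extendPath_apply le_rfl]
        exact lintegral_vecMeasure (P.row _) _
    _ = _ := by
        rw [lintegral_map Measurable.of_discrete (by fun_prop)]
        refine lintegral_congr fun ω => ?_
        simp_rw [← e2, ← e1]

theorem integral_markov {G : (ℕ → Fin m) → Fin m → ℝ}
    (hG : ∀ y, DependsOn (fun ω => G ω y) (Set.Iic n)) :
    ∫ ω, G ω (ω (n + 1)) ∂(chainLaw P μ) =
      ∫ ω, ∑ y, P.1 (ω n) y * G ω y ∂(chainLaw P μ) := by
  have e1 : ∀ ω y, G ω y = G (extendPath n (Preorder.frestrictLe n ω)) y :=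
    fun ω y => congrFun (hG y).eq_extendPath ω
  have e2 : ∀ ω : ℕ → Fin m, ω n = extendPath n (Preorder.frestrictLe n ω) n :=
    fun ω => (extendPath_frestrictLe le_rfl ω).symm
  have hm1 : Measurable (Preorder.frestrictLe (π := fun _ : ℕ => Fin m) n) := by fun_prop
  have hm2 : Measurable fun ω : ℕ → Fin m =>
    (Preorder.frestrictLe (π := fun _ : ℕ => Fin m) n ω, ω (n + 1)) := by fun_prop
  have := Measure.isProbabilityMeasure_map (μ := chainLaw P μ) hm1.aemeasurable
  have := Measure.isProbabilityMeasure_map (μ := chainLaw P μ) hm2.aemeasurable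
  calc ∫ ω, G ω (ω (n + 1)) ∂(chainLaw P μ)
      = ∫ p, G (extendPath n p.1) p.2 ∂((chainLaw P μ).map
          (fun ω => (Preorder.frestrictLe n ω, ω (n + 1)))) := by
        rw [integral_map hm2.aemeasurable
          Measurable.of_discrete.aestronglyMeasurable]
        exact integral_congr_ae (ae_of_all _ fun ω => e1 ω _)
    _ = ∫ x, ∑ y, P.1 (extendPath n x n) y * G (extendPath n x) y
          ∂((chainLaw P μ).map (Preorder.frestrictLe n)) := by
        rw [← map_frestrictLe_compProd, Measure.integral_compProd Integrable.of_finite]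
        refine integral_congr_ae (ae_of_all _ fun x => ?_)
        simp only [extendPath_apply (le_refl n)]
        exact integral_vecMeasure (P.row _) _
    _ = _ := by
        rw [integral_map hm1.aemeasurable Measurable.of_discrete.aestronglyMeasurable]
        refine integral_congr_ae (ae_of_all _ fun ω => ?_)
        simp_rw [← e2, ← e1]

theorem integrable_of_dependsOn {f : (ℕ → Fin m) → ℝ} (hf : DependsOn f (Set.Iic n)) :
    Integrable f (chainLaw P μ) := by
  have hm1 : Measurable (Preorder.frestrictLe (π := fun _ : ℕ => Fin m) n) := by fun_prop
  have := Measure.isProbabilityMeasure_map (μ := chainLaw P μ) hm1.aemeasurable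
  rw [hf.eq_extendPath]
  exact (Integrable.of_finite (μ := (chainLaw P μ).map (Preorder.frestrictLe n))
    (f := fun x => f (extendPath n x))).comp_measurable hm1

theorem dependsOn_prod_step {M : Type*} [CommMonoid M] {ρ : ℕ → (ℕ → Fin m) → Fin m → M}
    (hρ : ∀ t y, DependsOn (fun ω => ρ t ω y) (Set.Iic t)) (n : ℕ) :
    DependsOn (fun ω => ∏ t ∈ Finset.range n, ρ t ω (ω (t + 1))) (Set.Iic n) := by
  intro x y h
  refine Finset.prod_congr rfl fun t ht => ?_
  have ht := Finset.mem_range.1 ht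
  rw [← h (t + 1) (by simpa using ht)]
  exact hρ t _ fun i hi => h i (by simp only [Set.mem_Iic] at *; omega)

/-- A product of nonnegative factors of conditional mean at most `1` has mean at most `1`. -/
theorem lintegral_prod_step_le_one {ρ : ℕ → (ℕ → Fin m) → Fin m → ℝ≥0∞}
    (hρ : ∀ t y, DependsOn (fun ω => ρ t ω y) (Set.Iic t))
    (hle : ∀ t ω, ∑ y, ENNReal.ofReal (P.1 (ω t) y) * ρ t ω y ≤ 1) (n : ℕ) :
    ∫⁻ ω, ∏ t ∈ Finset.range n, ρ t ω (ω (t + 1)) ∂(chainLaw P μ) ≤ 1 := by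
  induction n with
  | zero => simp
  | succ n ih =>
    refine le_trans ?_ ih
    simp_rw [Finset.prod_range_succ]
    have hdep := dependsOn_prod_step hρ n
    rw [lintegral_markov P μ (n := n)
      (G := fun ω y => (∏ t ∈ Finset.range n, ρ t ω (ω (t + 1))) * ρ n ω y)
      (fun y x x' h => congrArg₂ (· * ·) (hdep h) (hρ n y h))]
    refine lintegral_mono fun ω => ?_
    calc ∑ y, ENNReal.ofReal (P.1 (ω n) y) * ((∏ t ∈ Finset.range n, ρ t ω (ω (t + 1))) * ρ n ω y)
        = (∏ t ∈ Finset.range n, ρ t ω (ω (t + 1))) *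
            ∑ y, ENNReal.ofReal (P.1 (ω n) y) * ρ n ω y := by
          rw [Finset.mul_sum]
          exact Finset.sum_congr rfl fun y _ => by ring
      _ ≤ (∏ t ∈ Finset.range n, ρ t ω (ω (t + 1))) * 1 := by gcongr; exact hle n ω
      _ = _ := mul_one _

/-- Change of measure along the first `n` steps. -/
theorem lintegral_mul_prod_le (Q : TransitionMatrix m) {r : Fin m → Fin m → ℝ}
    (hr : ∀ x y, 0 ≤ r x y) (hQr : ∀ x y, Q.1 x y * r x y ≤ P.1 x y)
    {f : (ℕ → Fin m) → ℝ≥0∞} (hf : DependsOn f (Set.Iic n)) :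
    ∫⁻ ω, f ω * ∏ t ∈ Finset.range n, ENNReal.ofReal (r (ω t) (ω (t + 1))) ∂(chainLaw Q μ) ≤
      ∫⁻ ω, f ω ∂(chainLaw P μ) := by
  have hdep : DependsOn (fun ω : ℕ → Fin m =>
      ∏ t ∈ Finset.range n, ENNReal.ofReal (r (ω t) (ω (t + 1)))) (Set.Iic n) :=
    dependsOn_prod_step (ρ := fun t ω y => ENNReal.ofReal (r (ω t) y))
      (fun t y x x' h => by simp only [h t (Set.mem_Iic.2 le_rfl)]) n
  rw [lintegral_chainLaw_eq_sum Q μ (n := n)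
    (fun x y h => congrArg₂ (· * ·) (hf h) (hdep h)), lintegral_chainLaw_eq_sum P μ hf]
  refine Finset.sum_le_sum fun x _ => ?_
  rw [mul_assoc]
  gcongr
  simp only
  rw [← ENNReal.ofReal_prod_of_nonneg fun _ _ => hr _ _,
    ← ENNReal.ofReal_mul (Finset.prod_nonneg fun _ _ => hr _ _)]
  apply ENNReal.ofReal_le_ofReal
  unfold pathWeight
  rw [mul_left_comm, ← Finset.prod_mul_distrib]
  refine mul_le_mul_of_nonneg_left (Finset.prod_le_prod (fun _ _ => ?_) fun _ _ => ?_) (μ.2.1 _)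
  · exact mul_nonneg (hr _ _) (Q.nonneg _ _)
  · rw [mul_comm]; exact hQr _ _

/-- Almost surely, the chain only makes transitions of positive probability. -/
theorem ae_transition_pos : ∀ᵐ ω ∂(chainLaw P μ), ∀ t, 0 < P.1 (ω t) (ω (t + 1)) := by
  rw [ae_all_iff]
  intro n
  have hdep : ∀ y, DependsOn (fun ω : ℕ → Fin m => if 0 < P.1 (ω n) y then (0 : ℝ≥0∞) else 1)
      (Set.Iic n) := fun y x x' h => by simp only [h n (Set.mem_Iic.2 le_rfl)]
  have h0 := lintegral_markov P μ (n := n)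
    (G := fun ω y => if 0 < P.1 (ω n) y then (0 : ℝ≥0∞) else 1) hdep
  have h1 : ∀ ω : ℕ → Fin m, ∑ y, ENNReal.ofReal (P.1 (ω n) y) *
      (if 0 < P.1 (ω n) y then (0 : ℝ≥0∞) else 1) = 0 := by
    intro ω
    refine Finset.sum_eq_zero fun y _ => ?_
    split_ifs with h
    · simp
    · rw [ENNReal.ofReal_of_nonpos (not_lt.1 h), zero_mul]
  simp_rw [h1, lintegral_zero] at h0
  have hmeas : Measurable fun ω : ℕ → Fin m =>
      if 0 < P.1 (ω n) (ω (n + 1)) then (0 : ℝ≥0∞) else 1 :=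
    DependsOn.measurable (n := n + 1) fun x x' h => by
      simp only [h n (by simp), h (n + 1) (by simp)]
  rw [lintegral_eq_zero_iff hmeas] at h0
  filter_upwards [h0] with ω hω
  by_contra hc
  simp [hc] at hω

end Law

/-! ### Divergences between rows -/

theorem kl_of_ac {q p : Fin m → ℝ} (h : ∀ j, p j = 0 → q j = 0) :
    kl q p = ENNReal.ofReal (∑ j, q j * Real.log (q j / p j)) := if_pos h

theorem ac_of_kl_ne_top {q p : Fin m → ℝ} (h : kl q p ≠ ⊤) : ∀ j, p j = 0 → q j = 0 := by
  by_contra hc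
  exact h (if_neg hc)

/-- Gibbs' inequality. -/
theorem sum_mul_log_div_nonneg {q p : Fin m → ℝ} (hq : ∀ j, 0 ≤ q j) (hp : ∀ j, 0 ≤ p j)
    (hqp : ∑ j, p j ≤ ∑ j, q j) (h : ∀ j, p j = 0 → q j = 0) :
    0 ≤ ∑ j, q j * Real.log (q j / p j) := by
  have key : ∀ j, q j - p j ≤ q j * Real.log (q j / p j) := by
    intro j
    rcases (hq j).eq_or_lt' with h0 | h0
    · simp [h0, hp j]
    · have hp0 : 0 < p j := (hp j).lt_of_ne fun h1 => h0.ne' (h j h1.symm)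
      have := Real.one_sub_inv_le_log_of_pos (div_pos h0 hp0)
      have h2 := mul_le_mul_of_nonneg_left this h0.le
      have h3 : q j * (1 - (q j / p j)⁻¹) = q j - p j := by field_simp
      linarith
  calc 0 ≤ ∑ j, (q j - p j) := by rw [Finset.sum_sub_distrib]; linarith
    _ ≤ _ := Finset.sum_le_sum fun j _ => key j

/-! ### Stopping times -/

/-- The layer-cake form of `k`: the `n`-th summand is the indicator of `k > n`. It gives `E[τ] = ∑
P(τ > n)`. -/
theorem toENNReal_eq_tsum (k : ℕ∞) :
    (k : ℝ≥0∞) = ∑' n : ℕ, if k ≤ (n : ℕ∞) then (0 : ℝ≥0∞) else 1 := by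
  induction k using ENat.recTopCoe with
  | top => simp
  | coe k =>
    rw [tsum_eq_sum (s := Finset.range k) fun n hn => by simpa using hn]
    have : ∀ n ∈ Finset.range k,
        (if (k : ℕ∞) ≤ (n : ℕ∞) then (0 : ℝ≥0∞) else 1) = 1 := fun n hn => by
      simpa using hn
    rw [Finset.sum_congr rfl this]
    simp

section Stopping

variable {τ : (ℕ → Fin m) → ℕ∞} (hτ : ∀ n : ℕ, DependsOn (fun ω => τ ω ≤ n) (Set.Iic n))
include hτ

theorem dependsOn_ite_le {β : Type*} (a b : β) (n : ℕ) :
    DependsOn (fun ω => if τ ω ≤ n then a else b) (Set.Iic n) := by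
  intro x y h
  have := hτ n h
  simp only [this]

theorem measurable_toENNReal_of_dependsOn : Measurable fun ω => (τ ω : ℝ≥0∞) := by
  simp_rw [toENNReal_eq_tsum]
  exact Measurable.tsum fun n => (dependsOn_ite_le hτ _ _ n).measurable

theorem expectedTime_eq_tsum (P : TransitionMatrix m) (μ : stdSimplex ℝ (Fin m)) :
    expectedTime P μ τ = ∑' n : ℕ, chainLaw P μ {ω | ¬ τ ω ≤ n} := by
  unfold expectedTime
  simp_rw [toENNReal_eq_tsum]
  rw [lintegral_tsum fun n => (dependsOn_ite_le hτ _ _ n).measurable.aemeasurable]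
  refine tsum_congr fun n => ?_
  have hmeas : MeasurableSet {ω | ¬ τ ω ≤ n} :=
    measurableSet_of_dependsOn (n := n) fun x y h => by
      simpa using congrArg Not (hτ n h)
  rw [← lintegral_indicator_one hmeas]
  refine lintegral_congr fun ω => ?_
  by_cases h : τ ω ≤ n
  · simp [h]
  · rw [if_neg h, Set.indicator_of_mem (show ω ∈ {ω | ¬ τ ω ≤ n} from h)]
    rfl

/-- The likelihood ratio stopped at `τ ∧ n` has mean at most one. -/
theorem lintegral_stopped_prod_le_one (Q : TransitionMatrix m) (μ : stdSimplex ℝ (Fin m))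
    {r : Fin m → Fin m → ℝ} (hr : ∀ x y, 0 ≤ r x y) (hQr : ∀ x, ∑ y, Q.1 x y * r x y ≤ 1)
    (n : ℕ) :
    ∫⁻ ω, ∏ t ∈ Finset.range n, (if τ ω ≤ t then 1 else ENNReal.ofReal (r (ω t) (ω (t + 1))))
      ∂(chainLaw Q μ) ≤ 1 := by
  refine lintegral_prod_step_le_one Q μ
    (ρ := fun t ω y => if τ ω ≤ t then 1 else ENNReal.ofReal (r (ω t) y)) ?_ ?_ n
  · intro t y x x' h
    have := hτ t h
    simp only [this, h t (Set.mem_Iic.2 le_rfl)]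
  · intro t ω
    by_cases h : τ ω ≤ t
    · simp only [h, if_true, mul_one]
      rw [← ENNReal.ofReal_sum_of_nonneg fun y _ => Q.nonneg _ y, Q.sum_row, ENNReal.ofReal_one]
    · simp only [h, if_false]
      simp_rw [← ENNReal.ofReal_mul (Q.nonneg _ _)]
      rw [← ENNReal.ofReal_sum_of_nonneg fun y _ => mul_nonneg (Q.nonneg _ y) (hr _ y)]
      exact ENNReal.ofReal_le_one.2 (hQr _)

/-- Change of measure at a stopping time. -/
theorem lintegral_indicator_mul_stopped_prod_le (Q P : TransitionMatrix m)
    (μ : stdSimplex ℝ (Fin m)) {r : Fin m → Fin m → ℝ} (hr : ∀ x y, 0 ≤ r x y)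
    (hQr : ∀ x y, Q.1 x y * r x y ≤ P.1 x y) {A : Set (ℕ → Fin m)}
    (hA : ∀ n : ℕ, DependsOn (fun ω => ω ∈ A ∧ τ ω ≤ n) (Set.Iic n)) (n : ℕ) :
    ∫⁻ ω, {ω | ω ∈ A ∧ τ ω ≤ n}.indicator 1 ω *
      ∏ t ∈ Finset.range n, (if τ ω ≤ t then 1 else ENNReal.ofReal (r (ω t) (ω (t + 1))))
      ∂(chainLaw Q μ) ≤ chainLaw P μ {ω | ω ∈ A ∧ τ ω ≤ n} := by
  -- `E k` is the event `A ∩ {τ = k}`. On it the stopped product is the ordinary product of `k`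
  -- factors, so the change of measure at the fixed time `k` applies.
  let E : ℕ → Set (ℕ → Fin m) := fun k => {ω | (ω ∈ A ∧ τ ω ≤ k) ∧ ∀ j < k, ¬ τ ω ≤ j}
  have hE : ∀ k, DependsOn (fun ω => ω ∈ E k) (Set.Iic k) := by
    intro k x y h
    have h1 := hA k h
    have h2 : ∀ j < k, (τ x ≤ j) = (τ y ≤ j) := fun j hj =>
      hτ j fun i hi => h i (by simp only [Set.mem_Iic] at *; omega)
    simp only [E, Set.mem_ofPred_eq, eq_iff_iff] at *
    rw [h1]
    exact and_congr_right fun _ => forall₂_congr fun j hj => by rw [h2 j hj]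
  have hEi : ∀ k, DependsOn ((E k).indicator (1 : (ℕ → Fin m) → ℝ≥0∞)) (Set.Iic k) := by
    intro k x y h
    have := hE k h
    simp only [eq_iff_iff] at this
    by_cases hx : x ∈ E k
    · simp [hx, this.1 hx]
    · rw [Set.indicator_of_notMem hx, Set.indicator_of_notMem fun hy => hx (this.2 hy)]
  have hEm : ∀ k, MeasurableSet (E k) := fun k => measurableSet_of_dependsOn (hE k)
  have hEτ : ∀ k ω, ω ∈ E k → τ ω = k := by
    rintro k ω ⟨⟨-, h1⟩, h2⟩
    obtain ⟨l, hl⟩ := ENat.ne_top_iff_exists.1 (ne_top_of_le_ne_top (ENat.natCast_ne_top k) h1)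
    rw [← hl] at h1 h2 ⊢
    have h1' : l ≤ k := by exact_mod_cast h1
    by_contra hne
    exact h2 l (lt_of_le_of_ne h1' fun h => hne (by rw [h])) le_rfl
  have hun : {ω | ω ∈ A ∧ τ ω ≤ n} = ⋃ k ∈ Finset.range (n + 1), E k := by
    ext ω
    simp only [Set.mem_ofPred_eq, Finset.mem_range, Set.mem_iUnion, exists_prop]
    constructor
    · rintro ⟨h1, h2⟩
      obtain ⟨l, hl⟩ := ENat.ne_top_iff_exists.1 (ne_top_of_le_ne_top (ENat.natCast_ne_top n) h2)
      rw [← hl] at h2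
      have h2' : l ≤ n := by exact_mod_cast h2
      refine ⟨l, by omega, ⟨h1, hl.symm.le⟩, fun j hj => ?_⟩
      rw [← hl, not_le]
      exact_mod_cast hj
    · rintro ⟨k, hk, ⟨h1, h2⟩, -⟩
      exact ⟨h1, h2.trans (by exact_mod_cast Nat.lt_succ_iff.1 hk)⟩
  have hdisj : Set.PairwiseDisjoint (↑(Finset.range (n + 1))) E := by
    intro k _ l _ hkl
    rw [Function.onFun, Set.disjoint_left]
    intro ω h1 h2
    have := (hEτ k ω h1).symm.trans (hEτ l ω h2)
    exact hkl (by exact_mod_cast this)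
  have hind : ∀ ω, {ω | ω ∈ A ∧ τ ω ≤ n}.indicator (1 : (ℕ → Fin m) → ℝ≥0∞) ω =
      ∑ k ∈ Finset.range (n + 1), (E k).indicator 1 ω := by
    intro ω
    rw [hun, Finset.indicator_biUnion_apply _ _ hdisj]
  have hprod : ∀ k ∈ Finset.range (n + 1), ∀ ω, (E k).indicator (1 : (ℕ → Fin m) → ℝ≥0∞) ω *
      ∏ t ∈ Finset.range n, (if τ ω ≤ t then 1 else ENNReal.ofReal (r (ω t) (ω (t + 1)))) =
      (E k).indicator 1 ω * ∏ t ∈ Finset.range k, ENNReal.ofReal (r (ω t) (ω (t + 1))) := by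
    intro k hk ω
    by_cases hω : ω ∈ E k
    · congr 1
      have hkn : k ≤ n := Nat.lt_succ_iff.1 (Finset.mem_range.1 hk)
      rw [← Finset.prod_subset (Finset.range_mono hkn)]
      · refine Finset.prod_congr rfl fun t ht => if_neg ?_
        rw [hEτ k ω hω, not_le]
        exact_mod_cast Finset.mem_range.1 ht
      · intro t _ ht
        rw [if_pos]
        rw [hEτ k ω hω]
        exact_mod_cast not_lt.1 (Finset.mem_range.not.1 ht)
    · simp [hω]
  have hmeas : ∀ k, Measurable fun ω : ℕ → Fin m => (E k).indicator (1 : (ℕ → Fin m) → ℝ≥0∞) ω *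
      ∏ t ∈ Finset.range k, ENNReal.ofReal (r (ω t) (ω (t + 1))) := fun k => by
    refine DependsOn.measurable (n := k) fun x y h => ?_
    have h1 := dependsOn_prod_step (ρ := fun t ω y => ENNReal.ofReal (r (ω t) y))
      (fun t y x x' h => by simp only [h t (Set.mem_Iic.2 le_rfl)]) k h
    exact congrArg₂ (· * ·) (hEi k h) h1
  calc _ = ∫⁻ ω, ∑ k ∈ Finset.range (n + 1), (E k).indicator 1 ω *
        ∏ t ∈ Finset.range k, ENNReal.ofReal (r (ω t) (ω (t + 1))) ∂(chainLaw Q μ) := by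
        refine lintegral_congr fun ω => ?_
        rw [hind, Finset.sum_mul]
        exact Finset.sum_congr rfl fun k hk => hprod k hk ω
    _ = ∑ k ∈ Finset.range (n + 1), ∫⁻ ω, (E k).indicator 1 ω *
        ∏ t ∈ Finset.range k, ENNReal.ofReal (r (ω t) (ω (t + 1))) ∂(chainLaw Q μ) :=
        lintegral_finsetSum _ fun k _ => hmeas k
    _ ≤ ∑ k ∈ Finset.range (n + 1), ∫⁻ ω, (E k).indicator 1 ω ∂(chainLaw P μ) :=
        Finset.sum_le_sum fun k _ => lintegral_mul_prod_le P μ Q hr hQr (hEi k)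
    _ = ∑ k ∈ Finset.range (n + 1), chainLaw P μ (E k) :=
        Finset.sum_congr rfl fun k _ => lintegral_indicator_one (hEm k)
    _ = _ := by rw [hun, measure_biUnion_finset hdisj fun k _ => hEm k]

end Stopping

/-! ### The lower bound on the expected stopping time -/

/-- The stopped corrector telescopes to a difference of two values of `h`, at time 0 and at `τ ∧ n`,
hence costs at most `2B`. The second conjunct, before stopping, is what carries the induction. -/
theorem exists_telescope (h : Fin m → ℝ) (ω : ℕ → Fin m) (k : ℕ∞) (n : ℕ) :
    (∃ j, ∑ t ∈ Finset.range n, (if k ≤ t then 0 else h (ω (t + 1)) - h (ω t)) =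
      h (ω j) - h (ω 0)) ∧
    (¬ k ≤ n → ∑ t ∈ Finset.range n, (if k ≤ t then 0 else h (ω (t + 1)) - h (ω t)) =
      h (ω n) - h (ω 0)) := by
  induction n with
  | zero => exact ⟨⟨0, by simp⟩, by simp⟩
  | succ n ih =>
    rw [Finset.sum_range_succ]
    by_cases hk : k ≤ n
    · rw [if_pos hk, add_zero]
      exact ⟨ih.1, fun h => absurd (hk.trans (by exact_mod_cast Nat.le_succ n)) h⟩
    · rw [if_neg hk, ih.2 hk]
      exact ⟨⟨n + 1, by ring⟩, fun _ => by ring⟩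

/-- The separating test function in the variational form of the data-processing inequality. -/
theorem binaryKL_variational {α β : ℝ} (hα : α ∈ Set.Ioo (0 : ℝ) (1 / 2))
    (hβ : β ∈ Set.Ioo (0 : ℝ) (1 / 2)) :
    ∃ a b : ℝ, b < a ∧ Real.exp b + (Real.exp a - Real.exp b) * α = 1 ∧
      binaryKL β (1 - α) = b + (a - b) * (1 - β) := by
  obtain ⟨hα0, hα1⟩ := hα
  obtain ⟨hβ0, hβ1⟩ := hβ
  have h1 : 0 < (1 - β) / α := div_pos (by linarith) hα0
  have h2 : 0 < β / (1 - α) := div_pos hβ0 (by linarith)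
  -- The optimal values: log-ratios of `Ber(1 - β)` to `Ber(α)` on the two outcomes.
  refine ⟨Real.log ((1 - β) / α), Real.log (β / (1 - α)), ?_, ?_, ?_⟩
  · refine Real.log_lt_log h2 ?_
    rw [div_lt_div_iff₀ (by linarith) hα0]
    nlinarith
  · rw [Real.exp_log h1, Real.exp_log h2]
    have : (1 - α) ≠ 0 := by linarith
    field_simp
    ring
  · rw [binaryKL, sub_sub_cancel]
    ring

section LowerBound

variable {τ : (ℕ → Fin m) → ℕ∞} (hτ : ∀ n : ℕ, DependsOn (fun ω => τ ω ≤ n) (Set.Iic n))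
  {A : Set (ℕ → Fin m)} (hA : ∀ n : ℕ, DependsOn (fun ω => ω ∈ A ∧ τ ω ≤ n) (Set.Iic n))
include hτ

/-- Wald's identity for the log-likelihood ratio at `τ ∧ n`, with the Poisson correction. -/
theorem integral_stopped_sum_le (Q : TransitionMatrix m) (μ : stdSimplex ℝ (Fin m))
    {z : Fin m → Fin m → ℝ} {h : Fin m → ℝ} {D B : ℝ} (hD : 0 ≤ D) (hB : ∀ x, |h x| ≤ B)
    (hpo : ∀ x, h x - ∑ y, Q.1 x y * h y = ∑ y, Q.1 x y * z x y - D)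
    (hE : expectedTime Q μ τ ≠ ⊤) (n : ℕ) :
    ∫ ω, ∑ t ∈ Finset.range n, (if τ ω ≤ t then 0 else z (ω t) (ω (t + 1))) ∂(chainLaw Q μ) ≤
      D * (expectedTime Q μ τ).toReal + 2 * B := by
  have hdep : ∀ (w : Fin m → Fin m → ℝ), DependsOn (fun ω : ℕ → Fin m =>
      ∑ t ∈ Finset.range n, (if τ ω ≤ t then 0 else w (ω t) (ω (t + 1)))) (Set.Iic n) := by
    intro w x y hxy
    refine Finset.sum_congr rfl fun t ht => ?_
    have ht := Finset.mem_range.1 ht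
    have h1 := hτ t (x := x) (y := y) fun i hi => hxy i (by simp only [Set.mem_Iic] at *; omega)
    simp only [h1, hxy t (by simp only [Set.mem_Iic]; omega), hxy (t + 1) (by simpa using ht)]
  have hint := fun w => integrable_of_dependsOn Q μ (hdep w)
  -- By the Poisson equation each corrected increment has conditional mean zero, and stopping before
  -- step `t` is decided by `X_0, …, X_t`.
  have hzero : ∫ ω, ∑ t ∈ Finset.range n, (if τ ω ≤ t then 0 else
      (z (ω t) (ω (t + 1)) - D + h (ω (t + 1)) - h (ω t))) ∂(chainLaw Q μ) = 0 := by
    have hdt : ∀ t : ℕ, ∀ y, DependsOn (fun ω : ℕ → Fin m => if τ ω ≤ t then 0 else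
        (z (ω t) y - D + h y - h (ω t))) (Set.Iic t) := by
      intro t y x x' hx
      have := hτ t hx
      simp only [this, hx t (Set.mem_Iic.2 le_rfl)]
    rw [integral_finsetSum]
    · refine Finset.sum_eq_zero fun t _ => ?_
      rw [integral_markov Q μ (G := fun ω y => if τ ω ≤ t then 0 else
        (z (ω t) y - D + h y - h (ω t))) (hdt t)]
      rw [← integral_zero (ℕ → Fin m) ℝ (μ := chainLaw Q μ)]
      refine integral_congr_ae (ae_of_all _ fun ω => ?_)
      by_cases hk : τ ω ≤ t
      · simp [hk]
      · simp only [hk, if_false]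
        have := hpo (ω t)
        have e : ∀ y, Q.1 (ω t) y * (z (ω t) y - D + h y - h (ω t)) =
            Q.1 (ω t) y * z (ω t) y + Q.1 (ω t) y * h y - (D + h (ω t)) * Q.1 (ω t) y := by
          intro y; ring
        simp_rw [e]
        rw [Finset.sum_sub_distrib, Finset.sum_add_distrib, ← Finset.mul_sum, Q.sum_row]
        linarith
    · intro t _
      refine integrable_of_dependsOn Q μ (n := t + 1) fun x y hxy => ?_
      have h1 := hτ t (x := x) (y := y) fun i hi => hxy i (by simp only [Set.mem_Iic] at *; omega)
      simp only [h1, hxy t (by simp), hxy (t + 1) (by simp)]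
  -- The sum counts the steps made before stopping, that is `τ ∧ n`.
  have hN : ∫ ω, ∑ t ∈ Finset.range n, (if τ ω ≤ t then (0 : ℝ) else 1) ∂(chainLaw Q μ) ≤
      (expectedTime Q μ τ).toReal := by
    have hnn : ∀ ω, 0 ≤ ∑ t ∈ Finset.range n, (if τ ω ≤ t then (0 : ℝ) else 1) := fun ω =>
      Finset.sum_nonneg fun t _ => by split_ifs <;> norm_num
    rw [integral_eq_lintegral_of_nonneg_ae (ae_of_all _ hnn)
      (hint fun _ _ => 1).aestronglyMeasurable]
    refine ENNReal.toReal_mono hE (lintegral_mono fun ω => ?_)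
    rw [toENNReal_eq_tsum, ENNReal.ofReal_sum_of_nonneg fun t _ => by split_ifs <;> norm_num]
    refine le_trans (Finset.sum_le_sum fun t _ => ?_) (ENNReal.sum_le_tsum (Finset.range n))
    split_ifs <;> simp
  have hsplit : ∀ ω, ∑ t ∈ Finset.range n, (if τ ω ≤ t then 0 else z (ω t) (ω (t + 1))) ≤
      ∑ t ∈ Finset.range n, (if τ ω ≤ t then 0 else
        (z (ω t) (ω (t + 1)) - D + h (ω (t + 1)) - h (ω t))) +
      (D * ∑ t ∈ Finset.range n, (if τ ω ≤ t then (0 : ℝ) else 1) + 2 * B) := by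
    intro ω
    obtain ⟨j, hj⟩ := (exists_telescope h ω (τ ω) n).1
    have h1 := abs_le.1 (hB (ω j))
    have h2 := abs_le.1 (hB (ω 0))
    have e : ∑ t ∈ Finset.range n, (if τ ω ≤ t then 0 else
        (z (ω t) (ω (t + 1)) - D + h (ω (t + 1)) - h (ω t))) =
        ∑ t ∈ Finset.range n, (if τ ω ≤ t then 0 else z (ω t) (ω (t + 1))) -
        D * ∑ t ∈ Finset.range n, (if τ ω ≤ t then (0 : ℝ) else 1) +
        ∑ t ∈ Finset.range n, (if τ ω ≤ t then 0 else h (ω (t + 1)) - h (ω t)) := by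
      rw [Finset.mul_sum, ← Finset.sum_sub_distrib, ← Finset.sum_add_distrib]
      refine Finset.sum_congr rfl fun t _ => ?_
      split_ifs <;> ring
    rw [e, hj]
    linarith
  have hi1 : Integrable (fun ω => ∑ t ∈ Finset.range n, (if τ ω ≤ t then 0 else
      (z (ω t) (ω (t + 1)) - D + h (ω (t + 1)) - h (ω t)))) (chainLaw Q μ) :=
    hint fun x y => z x y - D + h y - h x
  have hi2 : Integrable (fun ω => D * ∑ t ∈ Finset.range n, (if τ ω ≤ t then (0 : ℝ) else 1) +
      2 * B) (chainLaw Q μ) := ((hint fun _ _ => 1).const_mul D).add (integrable_const _)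
  calc _ ≤ _ := integral_mono (hint z) (hi1.add hi2) hsplit
    _ = D * ∫ ω, ∑ t ∈ Finset.range n, (if τ ω ≤ t then (0 : ℝ) else 1) ∂(chainLaw Q μ) +
        2 * B := by
        simp only [Pi.add_apply]
        rw [integral_add hi1 hi2, hzero, zero_add,
          integral_add ((hint fun _ _ => 1).const_mul D) (integrable_const _),
          integral_const_mul]
        simp
    _ ≤ _ := by gcongr

include hA

/-- Data processing at `τ ∧ n`: the log-likelihood ratio of `Q` against `P` has to exceed the
value of the separating test function. -/
theorem le_integral_stopped_sum (Q P : TransitionMatrix m) (μ : stdSimplex ℝ (Fin m))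
    {z : Fin m → Fin m → ℝ} (hz : ∀ x y, Q.1 x y * Real.exp (-z x y) ≤ P.1 x y)
    {α a b : ℝ} (hab : b < a) (hα0 : 0 ≤ α)
    (hα : Real.exp b + (Real.exp a - Real.exp b) * α = 1)
    (hPA : ∀ n : ℕ, chainLaw P μ {ω | ω ∈ A ∧ τ ω ≤ n} ≤ ENNReal.ofReal α) (n : ℕ) :
    b + (a - b) * (chainLaw Q μ).real {ω | ω ∈ A ∧ τ ω ≤ n} ≤
      ∫ ω, ∑ t ∈ Finset.range n, (if τ ω ≤ t then 0 else z (ω t) (ω (t + 1)))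
        ∂(chainLaw Q μ) := by
  set E : Set (ℕ → Fin m) := {ω | ω ∈ A ∧ τ ω ≤ n} with hE
  set Z : (ℕ → Fin m) → ℝ := fun ω =>
    ∑ t ∈ Finset.range n, (if τ ω ≤ t then 0 else z (ω t) (ω (t + 1))) with hZ
  have hdepZ : DependsOn Z (Set.Iic n) := by
    intro x y hxy
    refine Finset.sum_congr rfl fun t ht => ?_
    have ht := Finset.mem_range.1 ht
    have h1 := hτ t (x := x) (y := y) fun i hi => hxy i (by simp only [Set.mem_Iic] at *; omega)
    simp only [h1, hxy t (by simp only [Set.mem_Iic]; omega), hxy (t + 1) (by simpa using ht)]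
  have hEm : MeasurableSet E := measurableSet_of_dependsOn (hA n)
  have hdepE : DependsOn (E.indicator (1 : (ℕ → Fin m) → ℝ)) (Set.Iic n) := by
    intro x y h
    have : (x ∈ E) = (y ∈ E) := hA n h
    by_cases hx : x ∈ E
    · rw [Set.indicator_of_mem hx, Set.indicator_of_mem (this ▸ hx)]; rfl
    · rw [Set.indicator_of_notMem hx, Set.indicator_of_notMem (this ▸ hx)]
  have hexp : ∀ ω, ENNReal.ofReal (Real.exp (-Z ω)) = ∏ t ∈ Finset.range n,
      (if τ ω ≤ t then 1 else ENNReal.ofReal (Real.exp (-z (ω t) (ω (t + 1))))) := by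
    intro ω
    rw [hZ]
    simp only
    rw [← Finset.sum_neg_distrib, Real.exp_sum, ENNReal.ofReal_prod_of_nonneg fun _ _ =>
      (Real.exp_pos _).le]
    refine Finset.prod_congr rfl fun t _ => ?_
    split_ifs <;> simp
  have hi1 : Integrable (fun ω => Real.exp (-Z ω)) (chainLaw Q μ) :=
    integrable_of_dependsOn Q μ fun x y h => by rw [hdepZ h]
  have hi2 : Integrable (fun ω => E.indicator 1 ω * Real.exp (-Z ω)) (chainLaw Q μ) :=
    integrable_of_dependsOn Q μ fun x y h => by rw [hdepZ h, hdepE h]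
  have hi3 : Integrable (E.indicator (1 : (ℕ → Fin m) → ℝ)) (chainLaw Q μ) :=
    integrable_of_dependsOn Q μ hdepE
  -- Only an inequality: `P` may charge transitions that `Q` never makes.
  have h1 : ∫ ω, Real.exp (-Z ω) ∂(chainLaw Q μ) ≤ 1 := by
    rw [integral_eq_lintegral_of_nonneg_ae (ae_of_all _ fun ω => (Real.exp_pos _).le)
      hi1.aestronglyMeasurable]
    refine ENNReal.toReal_le_of_le_ofReal zero_le_one ?_
    rw [ENNReal.ofReal_one]
    simp_rw [hexp]
    exact lintegral_stopped_prod_le_one hτ Q μ (r := fun x y => Real.exp (-z x y))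
      (fun _ _ => (Real.exp_pos _).le)
      (fun x => (Finset.sum_le_sum fun y _ => hz x y).trans_eq (P.sum_row x)) n
  have h2 : ∫ ω, E.indicator 1 ω * Real.exp (-Z ω) ∂(chainLaw Q μ) ≤ α := by
    have hind : ∀ ω, 0 ≤ E.indicator (1 : (ℕ → Fin m) → ℝ) ω :=
      Set.indicator_nonneg fun _ _ => zero_le_one
    rw [integral_eq_lintegral_of_nonneg_ae (ae_of_all _ fun ω =>
      mul_nonneg (hind ω) (Real.exp_pos _).le) hi2.aestronglyMeasurable]
    refine ENNReal.toReal_le_of_le_ofReal hα0 ((le_of_eq ?_).trans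
      ((lintegral_indicator_mul_stopped_prod_le hτ Q P μ (r := fun x y => Real.exp (-z x y))
        (fun _ _ => (Real.exp_pos _).le) hz hA n).trans (hPA n)))
    refine lintegral_congr fun ω => ?_
    rw [ENNReal.ofReal_mul (hind ω), hexp]
    congr 1
    by_cases hω : ω ∈ E
    · rw [Set.indicator_of_mem hω, Set.indicator_of_mem hω]; simp
    · rw [Set.indicator_of_notMem hω, Set.indicator_of_notMem hω]; simp
  -- This is `g - Z + 1 ≤ exp (g - Z)` with `g = a` on `E` and `g = b` off `E`. The normalisation
  -- `hα` makes the expectation of the right side at most 1.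
  have hpt : ∀ ω, b + (a - b) * E.indicator 1 ω + 1 - (Real.exp b * Real.exp (-Z ω) +
      (Real.exp a - Real.exp b) * (E.indicator 1 ω * Real.exp (-Z ω))) ≤ Z ω := by
    intro ω
    by_cases hω : ω ∈ E
    · rw [Set.indicator_of_mem hω, Pi.one_apply]
      have := Real.add_one_le_exp (a - Z ω)
      rw [sub_eq_add_neg a, Real.exp_add] at this
      linarith
    · rw [Set.indicator_of_notMem hω]
      have := Real.add_one_le_exp (b - Z ω)
      rw [sub_eq_add_neg b, Real.exp_add] at this
      linarith
  have hiL₀ : Integrable (fun ω => b + (a - b) * E.indicator 1 ω) (chainLaw Q μ) :=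
    (integrable_const _).add (hi3.const_mul _)
  have hiL : Integrable (fun ω => b + (a - b) * E.indicator 1 ω + 1) (chainLaw Q μ) :=
    hiL₀.add (integrable_const _)
  have hiR : Integrable (fun ω => Real.exp b * Real.exp (-Z ω) +
      (Real.exp a - Real.exp b) * (E.indicator 1 ω * Real.exp (-Z ω))) (chainLaw Q μ) :=
    (hi1.const_mul _).add (hi2.const_mul _)
  have hfin := integral_mono (hiL.sub hiR) (integrable_of_dependsOn Q μ hdepZ) hpt
  simp only [Pi.sub_apply] at hfin
  rw [integral_sub hiL hiR, integral_add hiL₀ (integrable_const _), integral_add (integrable_const _) (hi3.const_mul _),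
    integral_const_mul, integral_indicator_one hEm, integral_add (hi1.const_mul _)
    (hi2.const_mul _), integral_const_mul, integral_const_mul] at hfin
  simp only [integral_const, probReal_univ, smul_eq_mul, one_mul] at hfin
  have h3 := mul_le_mul_of_nonneg_left h1 (Real.exp_pos b).le
  have h4 := mul_le_mul_of_nonneg_left h2 (sub_pos.2 (Real.exp_lt_exp.2 hab)).le
  linarith

/-- The lower bound against a single alternative, in the finite case. -/
theorem IsErgodic.binaryKL_le_mul {Q P : TransitionMatrix m} (hm : 2 ≤ m) (hQ : IsErgodic Q)
    (μ : stdSimplex ℝ (Fin m)) {α β : ℝ} (hα : α ∈ Set.Ioo (0 : ℝ) (1 / 2))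
    (hβ : β ∈ Set.Ioo (0 : ℝ) (1 / 2))
    (hPA : chainLaw P μ {ω | τ ω < ⊤ ∧ ω ∈ A} ≤ ENNReal.ofReal α)
    (hQA : chainLaw Q μ {ω | τ ω < ⊤ ∧ ω ∉ A} ≤ ENNReal.ofReal β)
    (hE : expectedTime Q μ τ ≠ ⊤) (hKL : stationaryKL Q P ≠ ⊤) :
    binaryKL β (1 - α) ≤ (stationaryKL Q P).toReal *
      ((expectedTime Q μ τ).toReal + 2 * poissonConst Q / minStationary Q) := by
  have : Nonempty (Fin m) := ⟨⟨0, by omega⟩⟩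
  obtain ⟨a, b, hab, h1, hd⟩ := binaryKL_variational hα hβ
  have hac : ∀ x y, P.1 x y = 0 → Q.1 x y = 0 := fun x => by
    refine ac_of_kl_ne_top fun h => hKL ?_
    rw [stationaryKL, ENNReal.sum_eq_top]
    refine ⟨x, Finset.mem_univ _, ?_⟩
    rw [h, ENNReal.mul_top]
    simpa using hQ.stationaryDist_pos x
  set f : Fin m → ℝ := fun x => ∑ y, Q.1 x y * Real.log (Q.1 x y / P.1 x y) with hf
  have hf0 : ∀ x, 0 ≤ f x := fun x => sum_mul_log_div_nonneg (Q.nonneg x) (P.nonneg x)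
    (by rw [Q.sum_row, P.sum_row]) (hac x)
  set D := ∑ x, stationaryDist Q x * f x with hDdef
  have hD0 : 0 ≤ D := Finset.sum_nonneg fun x _ => mul_nonneg (hQ.stationaryDist_pos x).le (hf0 x)
  have hDeq : (stationaryKL Q P).toReal = D := by
    rw [stationaryKL, ← ENNReal.toReal_ofReal hD0, hDdef, ENNReal.ofReal_sum_of_nonneg fun x _ =>
      mul_nonneg (hQ.stationaryDist_pos x).le (hf0 x)]
    congr 1
    refine Finset.sum_congr rfl fun x _ => ?_
    rw [kl_of_ac (hac x), ENNReal.ofReal_mul (hQ.stationaryDist_pos x).le]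
  have hπ := hQ.minStationary_pos
  -- Each weighted row divergence is at most the whole sum `D`. This makes the Poisson error
  -- proportional to `D`, so that it can later be divided out.
  have hfM : ∀ x, f x ≤ D / minStationary Q := by
    intro x
    rw [le_div_iff₀ hπ, mul_comm]
    calc minStationary Q * f x ≤ stationaryDist Q x * f x :=
          mul_le_mul_of_nonneg_right (minStationary_le Q x) (hf0 x)
      _ ≤ D := Finset.single_le_sum (f := fun x => stationaryDist Q x * f x)
          (fun x _ => mul_nonneg (hQ.stationaryDist_pos x).le (hf0 x)) (Finset.mem_univ x)
  obtain ⟨h, hpo, hhB⟩ := hQ.exists_poisson hm hf0 hfM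
  have hz : ∀ x y, Q.1 x y * Real.exp (-Real.log (Q.1 x y / P.1 x y)) ≤ P.1 x y := by
    intro x y
    rcases (Q.nonneg x y).eq_or_lt' with h0 | h0
    · rw [h0, zero_mul]; exact P.nonneg x y
    · have hp0 : 0 < P.1 x y := (P.nonneg x y).lt_of_ne fun h1 => h0.ne' (hac x y h1.symm)
      rw [Real.exp_neg, Real.exp_log (div_pos h0 hp0), inv_div]
      exact (mul_div_cancel₀ _ h0.ne').le
  have hfinite : {ω | τ ω < ⊤ ∧ ω ∈ A} = ⋃ n : ℕ, {ω | ω ∈ A ∧ τ ω ≤ n} := by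
    ext ω
    simp only [Set.mem_ofPred_eq, Set.mem_iUnion]
    constructor
    · rintro ⟨h1, h2⟩
      obtain ⟨l, hl⟩ := ENat.ne_top_iff_exists.1 h1.ne
      exact ⟨l, h2, hl.symm.le⟩
    · rintro ⟨n, h1, h2⟩
      exact ⟨h2.trans_lt (ENat.natCast_lt_top n), h1⟩
  have hmono : Monotone fun n : ℕ => {ω | ω ∈ A ∧ τ ω ≤ n} := fun k l hkl ω hω =>
    ⟨hω.1, hω.2.trans (by exact_mod_cast hkl)⟩
  have hPA' : ∀ n : ℕ, chainLaw P μ {ω | ω ∈ A ∧ τ ω ≤ n} ≤ ENNReal.ofReal α := fun n =>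
    (measure_mono (show {ω | ω ∈ A ∧ τ ω ≤ n} ⊆ {ω | τ ω < ⊤ ∧ ω ∈ A} from
      fun ω hω => ⟨hω.2.trans_lt (ENat.natCast_lt_top n), hω.1⟩)).trans hPA
  have hbound : ∀ n : ℕ, b + (a - b) * (chainLaw Q μ).real {ω | ω ∈ A ∧ τ ω ≤ n} ≤
      D * (expectedTime Q μ τ).toReal + 2 * (poissonConst Q * (D / minStationary Q)) := fun n =>
    (le_integral_stopped_sum hτ hA Q P μ hz hab hα.1.le h1 hPA' n).trans
      (integral_stopped_sum_le hτ Q μ hD0 hhB hpo hE n)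
  have hlim : Tendsto (fun n : ℕ => b + (a - b) * (chainLaw Q μ).real {ω | ω ∈ A ∧ τ ω ≤ n}) atTop
      (𝓝 (b + (a - b) * (chainLaw Q μ).real {ω | τ ω < ⊤ ∧ ω ∈ A})) := by
    refine tendsto_const_nhds.add (tendsto_const_nhds.mul ?_)
    rw [hfinite]
    exact (ENNReal.tendsto_toReal (measure_ne_top _ _)).comp (tendsto_measure_iUnion_atTop hmono)
  have hle := le_of_tendsto' hlim hbound
  -- A finite mean makes `τ` finite almost surely, so not deciding 1 is a decision for 0, up to a
  -- null set.
  have hq : 1 - β ≤ (chainLaw Q μ).real {ω | τ ω < ⊤ ∧ ω ∈ A} := by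
    have hae : ∀ᵐ ω ∂(chainLaw Q μ), (τ ω : ℝ≥0∞) < ⊤ :=
      ae_lt_top (measurable_toENNReal_of_dependsOn hτ) hE
    have h0 : (chainLaw Q μ) {ω | ¬ (τ ω : ℝ≥0∞) < ⊤} = 0 := hae
    have hcov : (Set.univ : Set (ℕ → Fin m)) ⊆ {ω | τ ω < ⊤ ∧ ω ∈ A} ∪
        ({ω | τ ω < ⊤ ∧ ω ∉ A} ∪ {ω | ¬ (τ ω : ℝ≥0∞) < ⊤}) := by
      intro ω _
      by_cases h1 : τ ω < ⊤
      · by_cases h2 : ω ∈ A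
        · exact Or.inl ⟨h1, h2⟩
        · exact Or.inr (Or.inl ⟨h1, h2⟩)
      · refine Or.inr (Or.inr ?_)
        simp only [Set.mem_ofPred_eq]
        rw [not_lt, top_le_iff] at h1
        simp [h1]
    have hu : (1 : ℝ) ≤ (chainLaw Q μ).real {ω | τ ω < ⊤ ∧ ω ∈ A} +
        ((chainLaw Q μ).real {ω | τ ω < ⊤ ∧ ω ∉ A} +
          (chainLaw Q μ).real {ω | ¬ (τ ω : ℝ≥0∞) < ⊤}) := by
      calc (1 : ℝ) = (chainLaw Q μ).real Set.univ := probReal_univ.symm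
        _ ≤ _ := (measureReal_mono hcov).trans ((measureReal_union_le _ _).trans
            (add_le_add_right (measureReal_union_le _ _) _))
    have hb : (chainLaw Q μ).real {ω | τ ω < ⊤ ∧ ω ∉ A} ≤ β :=
      ENNReal.toReal_le_of_le_ofReal hβ.1.le hQA
    have h00 : (chainLaw Q μ).real {ω | ¬ (τ ω : ℝ≥0∞) < ⊤} = 0 := by
      rw [Measure.real, h0, ENNReal.toReal_zero]
    linarith
  rw [hd, hDeq]
  have h5 := mul_le_mul_of_nonneg_left hq (sub_pos.2 hab).le
  have h6 : 2 * (poissonConst Q * (D / minStationary Q)) =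
    D * (2 * poissonConst Q / minStationary Q) := by ring
  rw [mul_add, ← h6]
  linarith

end LowerBound

/-! ### Two-sided tests: structural facts and the lower bound -/

section LevelTest

variable {H₀ H₁ : Set (TransitionMatrix m)} {α β : ℝ} {τ : (ℕ → Fin m) → ℕ∞}
  {D : (ℕ → Fin m) → Fin 2}

theorem IsLevelTest.dependsOn_le (h : IsLevelTest H₀ H₁ α β τ D) (n : ℕ) :
    DependsOn (fun ω => τ ω ≤ n) (Set.Iic n) :=
  dependsOn_mem_of_measurableSet (h.isStoppingTime n)

theorem IsLevelTest.dependsOn_decision (h : IsLevelTest H₀ H₁ α β τ D) (n : ℕ) :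
    DependsOn (fun ω => ω ∈ {ω | D ω = 1} ∧ τ ω ≤ n) (Set.Iic n) := by
  have h1 : MeasurableSet[h.isStoppingTime.measurableSpace] {ω | D ω = 1} :=
    h.measurable_decision (measurableSet_singleton (1 : Fin 2))
  exact dependsOn_mem_of_measurableSet (h1.2 n)

/-- Flipping the decision exchanges the roles of the hypotheses, so only one of the two lower bounds
needs a proof. -/
theorem IsLevelTest.swap (h : IsLevelTest H₀ H₁ α β τ D) :
    IsLevelTest H₁ H₀ β α τ (fun ω => Fin.rev (D ω)) where
  isStoppingTime := h.isStoppingTime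
  measurable_decision := (Measurable.of_discrete (f := Fin.rev (n := 2))).comp h.measurable_decision
  error_null := fun P hP μ => by
    have e : ∀ i : Fin 2, Fin.rev i = 1 ↔ i = 0 := by decide
    simp_rw [e]
    exact h.error_alt P hP μ
  error_alt := fun P hP μ => by
    have e : ∀ i : Fin 2, Fin.rev i = 0 ↔ i = 1 := by decide
    simp_rw [e]
    exact h.error_null P hP μ

theorem IsLevelTest.lower_bound (hm : 2 ≤ m) (hα : α ∈ Set.Ioo (0 : ℝ) (1 / 2))
    (hβ : β ∈ Set.Ioo (0 : ℝ) (1 / 2)) (h : IsLevelTest H₀ H₁ α β τ D)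
    {Q : TransitionMatrix m} (hQH : Q ∈ H₁) (hQ : IsErgodic Q) (μ : stdSimplex ℝ (Fin m)) :
    ENNReal.ofReal (binaryKL β (1 - α)) / infStationaryKL Q H₀
      - ENNReal.ofReal (2 * poissonConst Q / minStationary Q) ≤ expectedTime Q μ τ := by
  rw [tsub_le_iff_right]
  set X := expectedTime Q μ τ + ENNReal.ofReal (2 * poissonConst Q / minStationary Q) with hX
  rcases eq_or_ne (expectedTime Q μ τ) ⊤ with hE | hE
  · rw [hX, hE, top_add]; exact le_top
  have hXtop : X ≠ ⊤ := ENNReal.add_ne_top.2 ⟨hE, ENNReal.ofReal_ne_top⟩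
  have hmul : ∀ P ∈ H₀, stationaryKL Q P ≠ ⊤ →
      ENNReal.ofReal (binaryKL β (1 - α)) ≤ stationaryKL Q P * X := by
    intro P hP hK
    have := hQ.binaryKL_le_mul h.dependsOn_le h.dependsOn_decision (P := P) hm μ hα hβ
      (h.error_null P hP μ) (by
        have e : ∀ i : Fin 2, ¬ i = 1 ↔ i = 0 := by decide
        simp only [Set.mem_ofPred_eq, e]
        exact h.error_alt Q hQH μ) hE hK
    refine (ENNReal.ofReal_le_ofReal this).trans ?_
    rw [ENNReal.ofReal_mul ENNReal.toReal_nonneg, ENNReal.ofReal_toReal hK]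
    gcongr
    refine ENNReal.ofReal_add_le.trans ?_
    rw [ENNReal.ofReal_toReal hE]
  -- This case includes an empty `H₀`: the infimum is `∞` and the quotient is 0.
  by_cases htop : ∀ P ∈ H₀, stationaryKL Q P = ⊤
  · have : infStationaryKL Q H₀ = ⊤ := by
      rw [infStationaryKL, iInf₂_eq_top]; exact htop
    rw [this, ENNReal.div_top]
    exact zero_le
  · push Not at htop
    obtain ⟨P₀, hP₀, hK₀⟩ := htop
    -- If `X = 0`, finiteness of the divergence at `P₀` forces the numerator to vanish. Otherwise
    -- dividing by `X` bounds every divergence from below, and the infimum inherits the bound even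
    -- when it is 0.
    rcases eq_or_ne X 0 with hX0 | hX0
    · have := hmul P₀ hP₀ hK₀
      rw [hX0, mul_zero] at this
      rw [le_antisymm this zero_le, ENNReal.zero_div]
      exact zero_le
    · refine ENNReal.div_le_of_le_mul ?_
      rw [mul_comm]
      refine (ENNReal.div_le_iff hX0 hXtop).1 (le_iInf₂ fun P hP => ?_)
      rcases eq_or_ne (stationaryKL Q P) ⊤ with hK | hK
      · rw [hK]; exact le_top
      · exact ENNReal.div_le_of_le_mul (hmul P hP hK)

end LevelTest

/-! ### The parallel test is a test -/

section Parallel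

theorem dependsOn_visits (t : ℕ) (x : Fin m) :
    DependsOn (fun ω => visits ω t x) (Set.Iic t) := by
  intro ω ω' h
  simp only [visits]
  congr 1
  refine Finset.filter_congr fun s hs => ?_
  rw [h s (by have := Finset.mem_range.1 hs; simp only [Set.mem_Iic]; omega)]

theorem dependsOn_transitions (t : ℕ) (x y : Fin m) :
    DependsOn (fun ω => transitions ω t x y) (Set.Iic t) := by
  intro ω ω' h
  simp only [transitions]
  congr 1
  refine Finset.filter_congr fun s hs => ?_
  have := Finset.mem_range.1 hs
  rw [h s (by simp only [Set.mem_Iic]; omega), h (s + 1) (by simp only [Set.mem_Iic]; omega)]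

theorem dependsOn_crossing (H : Set (TransitionMatrix m)) (α : ℝ) (t : ℕ) :
    DependsOn (fun ω => ENNReal.ofReal (testBoundary α ω t) ≤ testStatistic H ω t)
      (Set.Iic t) := by
  intro ω ω' h
  have h1 : ∀ x, visits ω t x = visits ω' t x := fun x => dependsOn_visits t x h
  have h2 : ∀ x y, transitions ω t x y = transitions ω' t x y :=
    fun x y => dependsOn_transitions t x y h
  have h3 : ∀ x, empiricalRow ω t x = empiricalRow ω' t x := fun x => by
    ext y
    simp only [empiricalRow, h1, h2]
  simp only [testBoundary, testStatistic, h1, h3]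

theorem oneSidedTime_le_iff {H : Set (TransitionMatrix m)} {α : ℝ} {ω : ℕ → Fin m} {n : ℕ} :
    oneSidedTime H α ω ≤ n ↔ ∃ t ≤ n, 1 ≤ t ∧
      ENNReal.ofReal (testBoundary α ω t) ≤ testStatistic H ω t := by
  constructor
  · intro h
    by_contra! hc
    have : ((n + 1 : ℕ) : ℕ∞) ≤ oneSidedTime H α ω := by
      refine le_iInf₂ fun t ht => ?_
      by_contra hlt
      rw [not_le] at hlt
      have hlt : t < n + 1 := by exact_mod_cast hlt
      exact absurd ht.2 (not_le.2 (hc t (by omega) ht.1))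
    have := this.trans h
    have : n + 1 ≤ n := by exact_mod_cast this
    omega
  · rintro ⟨t, htn, ht⟩
    exact (iInf₂_le t ht).trans (by exact_mod_cast htn)

theorem dependsOn_oneSidedTime_le (H : Set (TransitionMatrix m)) (α : ℝ) (n : ℕ) :
    DependsOn (fun ω => oneSidedTime H α ω ≤ n) (Set.Iic n) := by
  intro ω ω' h
  simp only [oneSidedTime_le_iff, eq_iff_iff]
  refine exists_congr fun t => and_congr_right fun ht => and_congr_right fun _ => ?_
  rw [← eq_iff_iff]
  exact dependsOn_crossing H α t fun i hi => h i (by simp only [Set.mem_Iic] at *; omega)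

/-- The comparison `a ≤ b` looks into the unbounded future. Together with stopping by time `n` it
becomes a condition on events decided by time `n`. -/
theorem le_and_min_le_iff {a b : ℕ∞} {n : ℕ} :
    (a ≤ b ∧ min a b ≤ n) ↔ ∃ k ≤ n, a ≤ k ∧ ∀ j < k, ¬ b ≤ j := by
  constructor
  · rintro ⟨h1, h2⟩
    rw [min_eq_left h1] at h2
    obtain ⟨l, rfl⟩ := ENat.ne_top_iff_exists.1 (ne_top_of_le_ne_top (ENat.natCast_ne_top n) h2)
    refine ⟨l, by exact_mod_cast h2, le_rfl, fun j hj hb => ?_⟩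
    have : l ≤ j := by exact_mod_cast h1.trans hb
    omega
  · rintro ⟨k, hk, h1, h2⟩
    refine ⟨?_, (min_le_left _ _).trans (h1.trans (by exact_mod_cast hk))⟩
    by_contra hc
    rw [not_le] at hc
    obtain ⟨j, rfl⟩ := ENat.ne_top_iff_exists.1 (hc.trans_le le_top).ne
    exact h2 j (by exact_mod_cast hc.trans_le h1) le_rfl

theorem dependsOn_parallelTime_le (H₀ H₁ : Set (TransitionMatrix m)) (α β : ℝ) (n : ℕ) :
    DependsOn (fun ω => parallelTime H₀ H₁ α β ω ≤ n) (Set.Iic n) := by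
  intro ω ω' h
  have h1 := dependsOn_oneSidedTime_le H₀ α n h
  have h2 := dependsOn_oneSidedTime_le H₁ β n h
  simp only [parallelTime, min_le_iff, eq_iff_iff] at *
  rw [h1, h2]

theorem dependsOn_parallelDecision (H₀ H₁ : Set (TransitionMatrix m)) (α β : ℝ) (n : ℕ) :
    DependsOn (fun ω => parallelDecision H₀ H₁ α β ω = 1 ∧ parallelTime H₀ H₁ α β ω ≤ n)
      (Set.Iic n) := by
  intro ω ω' h
  have e : ∀ ω, (parallelDecision H₀ H₁ α β ω = 1 ∧ parallelTime H₀ H₁ α β ω ≤ n) ↔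
      ∃ k ≤ n, oneSidedTime H₀ α ω ≤ k ∧ ∀ j < k, ¬ oneSidedTime H₁ β ω ≤ j := by
    intro ω
    rw [← le_and_min_le_iff, parallelTime, parallelDecision]
    refine and_congr_left fun _ => ?_
    split_ifs with h <;> simp [h]
  simp only [e, eq_iff_iff]
  refine exists_congr fun k => and_congr_right fun hk => ?_
  have hres : ∀ j ≤ n, ∀ i ∈ Set.Iic j, ω i = ω' i := fun j hj i hi =>
    h i (by simp only [Set.mem_Iic] at *; omega)
  have h1 := dependsOn_oneSidedTime_le H₀ α k (hres k hk)
  simp only at h1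
  rw [h1]
  refine and_congr_right fun _ => forall₂_congr fun j hj => ?_
  have h2 := dependsOn_oneSidedTime_le H₁ β j (hres j (by omega))
  simp only at h2
  rw [h2]

theorem isStoppingTime_parallelTime (H₀ H₁ : Set (TransitionMatrix m)) (α β : ℝ) :
    IsStoppingTime (natFiltration m) (parallelTime H₀ H₁ α β) := fun n =>
  measurableSet_natFiltration_of_dependsOn (dependsOn_parallelTime_le H₀ H₁ α β n)

theorem measurable_parallelDecision (H₀ H₁ : Set (TransitionMatrix m)) (α β : ℝ) :
    Measurable[(isStoppingTime_parallelTime H₀ H₁ α β).measurableSpace]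
      (parallelDecision H₀ H₁ α β) := by
  have h1 : MeasurableSet[(isStoppingTime_parallelTime H₀ H₁ α β).measurableSpace]
      (parallelDecision H₀ H₁ α β ⁻¹' {1}) := by
    have hs : ∀ n : ℕ, MeasurableSet[natFiltration m n]
        (parallelDecision H₀ H₁ α β ⁻¹' {1} ∩ {ω | parallelTime H₀ H₁ α β ω ≤ n}) :=
      fun n => measurableSet_natFiltration_of_dependsOn
        (dependsOn_parallelDecision H₀ H₁ α β n)
    refine ⟨?_, hs⟩
    have hfil : ∀ n (S : Set (ℕ → Fin m)), MeasurableSet[natFiltration m n] S →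
        MeasurableSet[⨆ t, natFiltration m t] S := fun n S hS =>
      le_iSup (fun t => (natFiltration m t : MeasurableSpace _)) n S hS
    -- On paths that never stop both times are `⊤`, the tie rule gives decision 1, and that whole
    -- event belongs to the set.
    have e : parallelDecision H₀ H₁ α β ⁻¹' {1} =
        (⋂ n : ℕ, {ω | parallelTime H₀ H₁ α β ω ≤ n}ᶜ) ∪
        ⋃ n : ℕ, parallelDecision H₀ H₁ α β ⁻¹' {1} ∩ {ω | parallelTime H₀ H₁ α β ω ≤ n} := by
      rw [← Set.inter_iUnion, ← Set.compl_iUnion]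
      have : (⋃ n : ℕ, {ω | parallelTime H₀ H₁ α β ω ≤ n})ᶜ ⊆
          parallelDecision H₀ H₁ α β ⁻¹' {1} := by
        intro ω hω
        simp only [Set.mem_compl_iff, Set.mem_iUnion, Set.mem_ofPred_eq, not_exists] at hω
        have htop : parallelTime H₀ H₁ α β ω = ⊤ := by
          by_contra hc
          obtain ⟨l, hl⟩ := ENat.ne_top_iff_exists.1 hc
          exact hω l hl.symm.le
        rw [parallelTime, min_eq_top] at htop
        simp [parallelDecision, htop.1, htop.2]
      generalize (⋃ n : ℕ, {ω | parallelTime H₀ H₁ α β ω ≤ n}) = U at *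
      ext ω
      by_cases hω : ω ∈ U
      · simp [hω]
      · simpa [hω] using this hω
    rw [e]
    exact (MeasurableSet.iInter fun n => (hfil n _
      (isStoppingTime_parallelTime H₀ H₁ α β n)).compl).union
        (MeasurableSet.iUnion fun n => hfil n _ (hs n))
  have e : ∀ i : Fin 2, i ≠ 1 → i = 0 := by decide
  refine @measurable_to_countable' _ _ _ _ (_) _ fun i => ?_
  by_cases hi : i = 1
  · rw [hi]; exact h1
  · rw [e i hi]
    convert! h1.compl using 1
    ext ω
    have : ∀ i : Fin 2, i = 0 ↔ ¬ i = 1 := by decide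
    simp [this]

end Parallel

/-! ### Counts along a path -/

section Counts

variable (ω : ℕ → Fin m)

theorem visits_zero (x : Fin m) : visits ω 0 x = 0 := by simp [visits]

theorem transitions_zero (x y : Fin m) : transitions ω 0 x y = 0 := by simp [transitions]

theorem visits_succ (t : ℕ) (x : Fin m) :
    visits ω (t + 1) x = visits ω t x + if ω t = x then 1 else 0 := by
  simp only [visits, Finset.card_filter, Finset.sum_range_succ]

theorem transitions_succ (t : ℕ) (x y : Fin m) :
    transitions ω (t + 1) x y =
      transitions ω t x y + if ω t = x ∧ ω (t + 1) = y then 1 else 0 := by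
  simp only [transitions, Finset.card_filter, Finset.sum_range_succ]

theorem sum_transitions (t : ℕ) (x : Fin m) : ∑ y, transitions ω t x y = visits ω t x := by
  induction t with
  | zero => simp [visits_zero, transitions_zero]
  | succ t ih =>
    simp only [transitions_succ, visits_succ, Finset.sum_add_distrib, ih]
    congr 1
    by_cases h : ω t = x <;> simp [h]

theorem sum_visits (t : ℕ) : ∑ x, visits ω t x = t := by
  induction t with
  | zero => simp [visits_zero]
  | succ t ih => simp [visits_succ, Finset.sum_add_distrib, ih]

theorem visits_le (t : ℕ) (x : Fin m) : visits ω t x ≤ t := by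
  conv_rhs => rw [← sum_visits ω t]
  exact Finset.single_le_sum (fun _ _ => Nat.zero_le _) (Finset.mem_univ x)

theorem transitions_pos_imp {P : TransitionMatrix m} (h : ∀ t, 0 < P.1 (ω t) (ω (t + 1)))
    {t : ℕ} {x y : Fin m} (hxy : transitions ω t x y ≠ 0) : 0 < P.1 x y := by
  rw [transitions, Finset.card_ne_zero] at hxy
  obtain ⟨s, hs⟩ := hxy
  obtain ⟨-, rfl, rfl⟩ := Finset.mem_filter.1 hs
  exact h s

theorem prod_prod_ite_eq {M : Type*} [CommMonoid M] (a : Fin m → Fin m → M) (i j : Fin m) :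
    ∏ x, ∏ y, (if i = x ∧ j = y then a x y else 1) = a i j := by
  rw [Finset.prod_eq_single i (fun x _ hx => ?_) (by simp)]
  · simp
  · exact Finset.prod_eq_one fun y _ => if_neg fun h => hx h.1.symm

theorem prod_range_transition {M : Type*} [CommMonoid M] (a : Fin m → Fin m → M) (n : ℕ) :
    ∏ t ∈ Finset.range n, a (ω t) (ω (t + 1)) = ∏ x, ∏ y, a x y ^ transitions ω n x y := by
  induction n with
  | zero => simp [transitions_zero]
  | succ n ih =>
    rw [Finset.prod_range_succ, ih, ← prod_prod_ite_eq a (ω n) (ω (n + 1)),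
      ← Finset.prod_mul_distrib]
    refine Finset.prod_congr rfl fun x _ => ?_
    rw [← Finset.prod_mul_distrib]
    refine Finset.prod_congr rfl fun y _ => ?_
    rw [transitions_succ]
    split_ifs <;> simp [pow_succ]

/-- The Laplace (uniform Dirichlet) mixture likelihood in closed form. -/
theorem prod_range_laplace (hm : 2 ≤ m) (n : ℕ) :
    ∏ t ∈ Finset.range n, (((transitions ω t (ω t) (ω (t + 1)) : ℝ) + 1) /
      ((visits ω t (ω t) : ℝ) + m)) =
    ∏ x, ((∏ y, ((transitions ω n x y).factorial : ℝ)) * ((m - 1).factorial : ℝ) /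
      ((visits ω n x + (m - 1)).factorial : ℝ)) := by
  induction n with
  | zero =>
    simp only [Finset.range_zero, Finset.prod_empty, transitions_zero, visits_zero,
      Nat.factorial_zero, Nat.cast_one, Finset.prod_const_one, one_mul, zero_add]
    rw [div_self (by positivity)]
    simp
  | succ n ih =>
    rw [Finset.prod_range_succ, ih]
    have e1 : ∀ x, (∏ y, ((transitions ω (n + 1) x y).factorial : ℝ)) =
        (∏ y, ((transitions ω n x y).factorial : ℝ)) *
          ∏ y, (if ω n = x ∧ ω (n + 1) = y then (transitions ω n x y : ℝ) + 1 else 1) := by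
      intro x
      rw [← Finset.prod_mul_distrib]
      refine Finset.prod_congr rfl fun y _ => ?_
      rw [transitions_succ]
      split_ifs
      · rw [Nat.factorial_succ]; push_cast; ring
      · simp
    have e2 : ∀ x, ((visits ω (n + 1) x + (m - 1)).factorial : ℝ) =
        ((visits ω n x + (m - 1)).factorial : ℝ) *
          (if ω n = x then (visits ω n x : ℝ) + m else 1) := by
      intro x
      rw [visits_succ]
      split_ifs
      · rw [show visits ω n x + 1 + (m - 1) = (visits ω n x + (m - 1)) + 1 by ring,
          Nat.factorial_succ, show visits ω n x + (m - 1) + 1 = visits ω n x + m by omega]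
        push_cast; ring
      · simp
    simp_rw [e1, e2]
    have e3 := prod_prod_ite_eq (fun x y => (transitions ω n x y : ℝ) + 1) (ω n) (ω (n + 1))
    have e4 : ∏ x, (if ω n = x then (visits ω n x : ℝ) + m else 1) = (visits ω n (ω n) : ℝ) + m := by
      rw [Finset.prod_ite_eq]; simp
    rw [← e3, ← e4, ← Finset.prod_div_distrib, ← Finset.prod_mul_distrib]
    exact Finset.prod_congr rfl fun x _ => by ring

end Counts

/-! ### The mixture likelihood dominates the maximum likelihood up to the boundary -/

theorem pow_eq_exp_mul_log {x : ℝ} (k : ℕ) (h : k ≠ 0 → 0 < x) :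
    x ^ k = Real.exp (k * Real.log x) := by
  rcases eq_or_ne k 0 with rfl | hk
  · simp
  · rw [Real.exp_nat_mul, Real.exp_log (h hk)]

/-- Under multinomial sampling with probabilities `c y / n`, the count vector `c` itself has
probability at most 1: it is one term of the multinomial expansion. -/
theorem factorial_mul_prod_pow_le (c : Fin m → ℕ) :
    ((∑ y, c y).factorial : ℝ) * ∏ y, ((c y : ℝ) / (∑ y, c y : ℕ)) ^ c y ≤
      ∏ y, ((c y).factorial : ℝ) := by
  rcases Nat.eq_zero_or_pos (∑ y, c y) with h0 | hpos
  · have : ∀ y, c y = 0 := by simpa using h0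
    simp [this]
  · set n := ∑ y, c y with hn
    have h1 : (∑ y, (c y : ℝ) / n) ^ n = 1 := by
      rw [← Finset.sum_div, ← Nat.cast_sum, ← hn, div_self (by positivity), one_pow]
    rw [Finset.sum_pow_eq_sum_piAntidiag] at h1
    have h2 : (Nat.multinomial Finset.univ c : ℝ) * ∏ y, ((c y : ℝ) / n) ^ c y ≤ 1 := by
      rw [← h1]
      exact Finset.single_le_sum
        (f := fun k => (Nat.multinomial Finset.univ k : ℝ) * ∏ y, ((c y : ℝ) / n) ^ k y)
        (fun k _ => by positivity) (by simp [Finset.mem_piAntidiag, hn])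
    have h3 : (∏ y, ((c y).factorial : ℝ)) * Nat.multinomial Finset.univ c = (n.factorial : ℝ) := by
      exact_mod_cast Nat.multinomial_spec Finset.univ c
    rw [← h3, mul_assoc]
    exact mul_le_of_le_one_right (by positivity) h2

/-- From `(n + k).choose k ≤ (n + k)^k / k!` and `k^k / k! ≤ e^k`. With `k = m - 1` the exponent is
the boundary contribution of one row. -/
theorem choose_le_exp_boundary (n k : ℕ) (hk : 1 ≤ k) :
    ((n + k).choose k : ℝ) ≤ Real.exp (k * Real.log (Real.exp 1 * (1 + n / k))) := by
  have hk0 : (0 : ℝ) < k := by exact_mod_cast hk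
  have h1 : ((n + k).choose k : ℝ) ≤ ((n + k : ℕ) : ℝ) ^ k / (k.factorial : ℝ) :=
    Nat.choose_le_pow_div k (n + k)
  have h2 := Real.pow_div_factorial_le_exp (k : ℝ) hk0.le k
  rw [Real.exp_nat_mul, Real.exp_log (by positivity), mul_pow, ← Real.exp_nat_mul, mul_one]
  refine h1.trans ?_
  have e : ((n + k : ℕ) : ℝ) ^ k / (k.factorial : ℝ) =
      ((k : ℝ) ^ k / (k.factorial : ℝ)) * (1 + n / k) ^ k := by
    have : (1 + n / k : ℝ) = ((n + k : ℕ) : ℝ) / k := by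
      push_cast; field_simp; ring
    rw [this, div_pow]
    field_simp
  rw [e]
  gcongr

/-- The Dirichlet mixture weight of one row is `(∏ c_y! / n!)` divided by the binomial coefficient
`(n + m - 1).choose (m - 1)`. The first factor is at least the maximum likelihood, and the second is
paid for by the boundary. -/
theorem exp_le_dirichlet (hm : 2 ≤ m) (c : Fin m → ℕ) :
    Real.exp (∑ y, c y * Real.log ((c y : ℝ) / (∑ y, c y : ℕ)) -
      ((m : ℝ) - 1) * Real.log (Real.exp 1 * (1 + ((∑ y, c y : ℕ) : ℝ) / ((m : ℝ) - 1)))) ≤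
    (∏ y, ((c y).factorial : ℝ)) * ((m - 1).factorial : ℝ) /
      ((∑ y, c y + (m - 1)).factorial : ℝ) := by
  have h1 := factorial_mul_prod_pow_le c
  have h2 := choose_le_exp_boundary (∑ y, c y) (m - 1) (by omega)
  have h3 := Nat.add_choose_mul_factorial_mul_factorial (∑ y, c y) (m - 1)
  have hcast : ((m - 1 : ℕ) : ℝ) = (m : ℝ) - 1 := by rw [Nat.cast_sub (by omega), Nat.cast_one]
  have h4 : ∏ y, ((c y : ℝ) / (∑ y, c y : ℕ)) ^ c y =
      Real.exp (∑ y, c y * Real.log ((c y : ℝ) / (∑ y, c y : ℕ))) := by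
    rw [Real.exp_sum]
    refine Finset.prod_congr rfl fun y _ => pow_eq_exp_mul_log _ fun hy => ?_
    have : c y ≤ ∑ y, c y := Finset.single_le_sum (fun _ _ => Nat.zero_le _) (Finset.mem_univ y)
    have h5 : 0 < c y := Nat.pos_of_ne_zero hy
    have h6 : 0 < ∑ y, c y := by omega
    exact div_pos (by exact_mod_cast h5) (by exact_mod_cast h6)
  rw [← hcast, Real.exp_sub, ← h4]
  generalize (∑ y, c y) = n at *
  have h3' : ((n + (m - 1)).choose (m - 1) : ℝ) * n.factorial * (m - 1).factorial =
    ((n + (m - 1)).factorial : ℝ) := by exact_mod_cast h3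
  rw [← h3', div_le_div_iff₀ (Real.exp_pos _) (by
    have : 0 < (n + (m - 1)).choose (m - 1) := Nat.choose_pos (by omega)
    positivity)]
  set X := ∏ y, ((c y : ℝ) / (n : ℕ)) ^ c y with hX
  have hX0 : 0 ≤ X := Finset.prod_nonneg fun y _ => by positivity
  calc X * (((n + (m - 1)).choose (m - 1) : ℝ) * n.factorial * (m - 1).factorial)
      = (n.factorial * X) * ((m - 1).factorial * ((n + (m - 1)).choose (m - 1) : ℝ)) := by ring
    _ ≤ (∏ y, ((c y).factorial : ℝ)) * ((m - 1).factorial *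
        Real.exp ((m - 1 : ℕ) * Real.log (Real.exp 1 * (1 + n / (m - 1 : ℕ))))) := by
        gcongr
    _ = _ := by ring

/-- The real value of the statistic `∑_x N_x KL(Q̂_t(x,·), P(x,·))`. -/
def rowStatistic (P : TransitionMatrix m) (ω : ℕ → Fin m) (t : ℕ) : ℝ :=
  ∑ x, ∑ y, transitions ω t x y * Real.log (((transitions ω t x y : ℝ) / visits ω t x) / P.1 x y)

/-- Along a path that `P` can generate the empirical rows are absolutely continuous, so the
statistic at `P` is a finite real number. Its sign is recorded because comparing values of
`ENNReal.ofReal` needs it. -/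
theorem testStatistic_le_ofReal {H : Set (TransitionMatrix m)} {P : TransitionMatrix m}
    (hP : P ∈ H) {ω : ℕ → Fin m} (hω : ∀ t, 0 < P.1 (ω t) (ω (t + 1))) (t : ℕ) :
    testStatistic H ω t ≤ ENNReal.ofReal (rowStatistic P ω t) ∧ 0 ≤ rowStatistic P ω t := by
  have hac : ∀ x y, P.1 x y = 0 → transitions ω t x y = 0 := fun x y h => by
    by_contra hc
    exact (transitions_pos_imp ω hω hc).ne' h
  have hrow : ∀ x, 0 < visits ω t x →
      ∑ y, transitions ω t x y * Real.log (((transitions ω t x y : ℝ) / visits ω t x) / P.1 x y) =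
      visits ω t x * ∑ y, empiricalRow ω t x y * Real.log (empiricalRow ω t x y / P.1 x y) := by
    intro x hx
    have hx' : (visits ω t x : ℝ) ≠ 0 := by positivity
    rw [Finset.mul_sum]
    refine Finset.sum_congr rfl fun y _ => ?_
    simp only [empiricalRow, if_pos hx]
    field_simp
  have hac' : ∀ x, 0 < visits ω t x → ∀ y, P.1 x y = 0 → empiricalRow ω t x y = 0 := by
    intro x hx y h
    simp [empiricalRow, hx, hac x y h]
  have hgibbs : ∀ x, 0 < visits ω t x →
      0 ≤ ∑ y, empiricalRow ω t x y * Real.log (empiricalRow ω t x y / P.1 x y) := by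
    intro x hx
    refine sum_mul_log_div_nonneg (fun y => ?_) (P.nonneg x) ?_ (hac' x hx)
    · simp only [empiricalRow, if_pos hx]; positivity
    · rw [P.sum_row]
      simp only [empiricalRow, if_pos hx]
      rw [← Finset.sum_div, ← Nat.cast_sum, sum_transitions, div_self (by positivity)]
  have hsum : rowStatistic P ω t = ∑ x with 0 < visits ω t x,
      visits ω t x * ∑ y, empiricalRow ω t x y * Real.log (empiricalRow ω t x y / P.1 x y) := by
    rw [rowStatistic, Finset.sum_filter]
    refine Finset.sum_congr rfl fun x _ => ?_
    split_ifs with hx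
    · exact hrow x hx
    · have h0 : ∑ y, transitions ω t x y = 0 := by rw [sum_transitions]; omega
      have : ∀ y, transitions ω t x y = 0 := by simpa using h0
      simp [this]
  constructor
  · refine (iInf₂_le P hP).trans (le_of_eq ?_)
    rw [hsum, ENNReal.ofReal_sum_of_nonneg fun x hx =>
      mul_nonneg (Nat.cast_nonneg _) (hgibbs x (Finset.mem_filter.1 hx).2)]
    refine Finset.sum_congr rfl fun x hx => ?_
    have hx := (Finset.mem_filter.1 hx).2
    rw [kl_of_ac (hac' x hx), ENNReal.ofReal_mul (Nat.cast_nonneg _), ENNReal.ofReal_natCast]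
  · rw [hsum]
    exact Finset.sum_nonneg fun x hx =>
      mul_nonneg (Nat.cast_nonneg _) (hgibbs x (Finset.mem_filter.1 hx).2)

/-- At a crossing, the mixture likelihood ratio is at least `1 / α`. -/
theorem inv_le_prod_laplace (hm : 2 ≤ m) {H : Set (TransitionMatrix m)} {P : TransitionMatrix m}
    (hP : P ∈ H) {ω : ℕ → Fin m} (hω : ∀ t, 0 < P.1 (ω t) (ω (t + 1))) {α : ℝ} (hα : 0 < α)
    {k : ℕ} (hk : ENNReal.ofReal (testBoundary α ω k) ≤ testStatistic H ω k) :
    1 / α ≤ ∏ t ∈ Finset.range k, (((transitions ω t (ω t) (ω (t + 1)) : ℝ) + 1) /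
      ((visits ω t (ω t) : ℝ) + m) / P.1 (ω t) (ω (t + 1))) := by
  obtain ⟨h1, h2⟩ := testStatistic_le_ofReal hP hω k
  have h3 := (ENNReal.ofReal_le_ofReal_iff h2).1 (hk.trans h1)
  -- The likelihood depends on the path only through its transition counts, and zero counts hide the
  -- undefined logarithms.
  have hPk : ∏ t ∈ Finset.range k, P.1 (ω t) (ω (t + 1)) =
      ∏ x, Real.exp (∑ y, transitions ω k x y * Real.log (P.1 x y)) := by
    rw [prod_range_transition ω (fun x y => P.1 x y)]
    refine Finset.prod_congr rfl fun x _ => ?_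
    rw [Real.exp_sum]
    exact Finset.prod_congr rfl fun y _ => pow_eq_exp_mul_log _ (transitions_pos_imp ω hω)
  rw [Finset.prod_div_distrib, prod_range_laplace ω hm, hPk, ← Finset.prod_div_distrib]
  have hrow : ∀ x, Real.exp (∑ y, transitions ω k x y *
      Real.log (((transitions ω k x y : ℝ) / visits ω k x) / P.1 x y) -
      ((m : ℝ) - 1) * Real.log (Real.exp 1 * (1 + (visits ω k x : ℝ) / ((m : ℝ) - 1)))) ≤
      (∏ y, ((transitions ω k x y).factorial : ℝ)) * ((m - 1).factorial : ℝ) /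
      ((visits ω k x + (m - 1)).factorial : ℝ) /
      Real.exp (∑ y, transitions ω k x y * Real.log (P.1 x y)) := by
    intro x
    have := exp_le_dirichlet hm (fun y => transitions ω k x y)
    rw [sum_transitions] at this
    rw [le_div_iff₀ (Real.exp_pos _), ← Real.exp_add]
    refine (Real.exp_le_exp.2 (le_of_eq ?_)).trans this
    rw [sub_add_eq_add_sub, ← Finset.sum_add_distrib]
    congr 1
    refine Finset.sum_congr rfl fun y _ => ?_
    rcases eq_or_ne (transitions ω k x y) 0 with h0 | h0
    · simp [h0]
    · have hp := transitions_pos_imp ω hω h0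
      have hv : 0 < visits ω k x := by
        rw [← sum_transitions]
        exact lt_of_lt_of_le (Nat.pos_of_ne_zero h0)
          (Finset.single_le_sum (f := fun y => transitions ω k x y) (fun _ _ => Nat.zero_le _)
            (Finset.mem_univ y))
      have hn : 0 < transitions ω k x y := Nat.pos_of_ne_zero h0
      rw [Real.log_div (div_pos (by exact_mod_cast hn) (by exact_mod_cast hv)).ne' hp.ne']
      ring
  refine le_trans ?_ (Finset.prod_le_prod (fun x _ => (Real.exp_pos _).le) fun x _ => hrow x)
  rw [← Real.exp_sum, Finset.sum_sub_distrib, ← Finset.mul_sum, ← Real.exp_log (one_div_pos.2 hα)]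
  refine Real.exp_le_exp.2 ?_
  unfold testBoundary rowStatistic at h3
  linarith

/-- The one-sided test rejects a true null with probability at most `α`. -/
theorem chainLaw_oneSidedTime_lt_top_le (hm : 2 ≤ m) {H : Set (TransitionMatrix m)}
    {P : TransitionMatrix m} (hP : P ∈ H) (μ : stdSimplex ℝ (Fin m)) {α : ℝ} (hα : 0 < α) :
    chainLaw P μ {ω | oneSidedTime H α ω < ⊤} ≤ ENNReal.ofReal α := by
  -- The ratio of the Laplace predictive probability to the true one. In `ρ` it is frozen at 1 after
  -- the crossing, so the product at time `n` remembers its value at the crossing.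
  let r : ℕ → (ℕ → Fin m) → Fin m → ℝ := fun t ω y =>
    ((transitions ω t (ω t) y : ℝ) + 1) / ((visits ω t (ω t) : ℝ) + m) / P.1 (ω t) y
  let ρ : ℕ → (ℕ → Fin m) → Fin m → ℝ≥0∞ := fun t ω y =>
    if oneSidedTime H α ω ≤ t then 1 else ENNReal.ofReal (r t ω y)
  have hr0 : ∀ t ω y, 0 ≤ r t ω y := fun t ω y =>
    div_nonneg (by positivity) (P.nonneg _ _)
  have hρ : ∀ t y, DependsOn (fun ω => ρ t ω y) (Set.Iic t) := by
    intro t y ω ω' h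
    have h1 := dependsOn_oneSidedTime_le H α t h
    have h2 : ∀ x, visits ω t x = visits ω' t x := fun x => dependsOn_visits t x h
    have h3 : ∀ x y, transitions ω t x y = transitions ω' t x y :=
      fun x y => dependsOn_transitions t x y h
    simp only at h1
    simp only [ρ, r, h1, h2, h3, h t (Set.mem_Iic.2 le_rfl)]
  have hle : ∀ t ω, ∑ y, ENNReal.ofReal (P.1 (ω t) y) * ρ t ω y ≤ 1 := by
    intro t ω
    by_cases h : oneSidedTime H α ω ≤ t
    · simp only [ρ, h, if_true, mul_one]
      rw [← ENNReal.ofReal_sum_of_nonneg fun y _ => P.nonneg _ y, P.sum_row, ENNReal.ofReal_one]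
    · simp only [ρ, h, if_false]
      simp_rw [← ENNReal.ofReal_mul (P.nonneg _ _)]
      rw [← ENNReal.ofReal_sum_of_nonneg fun y _ => mul_nonneg (P.nonneg _ y) (hr0 _ _ y)]
      refine ENNReal.ofReal_le_one.2 ?_
      have hden : (0 : ℝ) < (visits ω t (ω t) : ℝ) + m := by
        have : (0 : ℝ) < m := by exact_mod_cast (show 0 < m by omega)
        positivity
      calc ∑ y, P.1 (ω t) y * r t ω y
          ≤ ∑ y, ((transitions ω t (ω t) y : ℝ) + 1) / ((visits ω t (ω t) : ℝ) + m) := by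
            refine Finset.sum_le_sum fun y _ => ?_
            -- Impossible transitions contribute 0, which is why the conditional mean may fall below
            -- 1.
            rcases (P.nonneg (ω t) y).eq_or_lt' with h0 | h0
            · rw [h0, zero_mul]; positivity
            · exact (mul_div_cancel₀ _ h0.ne').le
        _ = 1 := by
            rw [← Finset.sum_div, Finset.sum_add_distrib, ← Nat.cast_sum, sum_transitions]
            simp [div_self hden.ne']
  have hn : ∀ n : ℕ, chainLaw P μ {ω | oneSidedTime H α ω ≤ n} ≤ ENNReal.ofReal α := by
    intro n
    have h1 := lintegral_prod_step_le_one P μ hρ hle n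
    have hmeas : MeasurableSet {ω : ℕ → Fin m | oneSidedTime H α ω ≤ n} :=
      measurableSet_of_dependsOn (dependsOn_oneSidedTime_le H α n)
    have h2 : ENNReal.ofReal (1 / α) * chainLaw P μ {ω | oneSidedTime H α ω ≤ n} ≤ 1 := by
      rw [← lintegral_indicator_const hmeas]
      refine (lintegral_mono_ae ?_).trans h1
      filter_upwards [ae_transition_pos P μ] with ω hω
      by_cases hT : oneSidedTime H α ω ≤ n
      · rw [Set.indicator_of_mem (show ω ∈ {ω | oneSidedTime H α ω ≤ n} from hT)]
        obtain ⟨k, hk⟩ := ENat.ne_top_iff_exists.1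
          (ne_top_of_le_ne_top (ENat.natCast_ne_top n) hT)
        have hkn : k ≤ n := by rw [← hk] at hT; exact_mod_cast hT
        obtain ⟨j, hjk, hj1, hj⟩ := oneSidedTime_le_iff.1 hk.symm.le
        -- The time `k` is the first crossing, so the crossing found at `j ≤ k` occurs exactly at
        -- `k`.
        have hjk' : k ≤ j := by
          have := oneSidedTime_le_iff (H := H) (α := α) (ω := ω).2 ⟨j, le_rfl, hj1, hj⟩
          rw [← hk] at this
          exact_mod_cast this
        obtain rfl : j = k := le_antisymm hjk hjk'
        have h3 := inv_le_prod_laplace hm hP hω hα hj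
        calc ENNReal.ofReal (1 / α) ≤ ENNReal.ofReal (∏ t ∈ Finset.range j, r t ω (ω (t + 1))) :=
              ENNReal.ofReal_le_ofReal h3
          _ = ∏ t ∈ Finset.range j, ρ t ω (ω (t + 1)) := by
              rw [ENNReal.ofReal_prod_of_nonneg fun t _ => hr0 _ _ _]
              refine Finset.prod_congr rfl fun t ht => (if_neg ?_).symm
              rw [← hk, not_le]
              exact_mod_cast Finset.mem_range.1 ht
          _ = ∏ t ∈ Finset.range n, ρ t ω (ω (t + 1)) := by
              refine Finset.prod_subset (Finset.range_mono hkn) fun t _ ht => if_pos ?_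
              rw [← hk]
              exact_mod_cast not_lt.1 (Finset.mem_range.not.1 ht)
      · rw [Set.indicator_of_notMem (show ω ∉ {ω | oneSidedTime H α ω ≤ n} from hT)]
        exact zero_le
    rw [one_div, ENNReal.ofReal_inv_of_pos hα] at h2
    have hα' : ENNReal.ofReal α ≠ 0 := by simpa using hα
    rw [mul_comm, ← div_eq_mul_inv, ENNReal.div_le_iff hα' ENNReal.ofReal_ne_top, one_mul] at h2
    exact h2
  have hun : {ω | oneSidedTime H α ω < ⊤} = ⋃ n : ℕ, {ω : ℕ → Fin m | oneSidedTime H α ω ≤ n} := by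
    ext ω
    simp only [Set.mem_ofPred_eq, Set.mem_iUnion]
    constructor
    · intro h
      obtain ⟨l, hl⟩ := ENat.ne_top_iff_exists.1 h.ne
      exact ⟨l, hl.symm.le⟩
    · rintro ⟨n, h⟩
      exact h.trans_lt (ENat.natCast_lt_top n)
  have hmono : Monotone fun n : ℕ => {ω : ℕ → Fin m | oneSidedTime H α ω ≤ n} :=
    fun k l hkl ω (hω : oneSidedTime H α ω ≤ k) =>
      show oneSidedTime H α ω ≤ l from hω.trans (by exact_mod_cast hkl)
  rw [hun, hmono.measure_iUnion]
  exact iSup_le hn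

theorem isLevelTest_parallel (hm : 2 ≤ m) (H₀ H₁ : Set (TransitionMatrix m)) {α β : ℝ}
    (hα : 0 < α) (hβ : 0 < β) :
    IsLevelTest H₀ H₁ α β (parallelTime H₀ H₁ α β) (parallelDecision H₀ H₁ α β) where
  isStoppingTime := isStoppingTime_parallelTime H₀ H₁ α β
  measurable_decision := measurable_parallelDecision H₀ H₁ α β
  error_null := fun P hP μ => by
    refine (measure_mono ?_).trans (chainLaw_oneSidedTime_lt_top_le hm hP μ hα)
    rintro ω ⟨h1, h2⟩
    have h3 : oneSidedTime H₀ α ω ≤ oneSidedTime H₁ β ω := by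
      by_contra hc
      simp [parallelDecision, hc] at h2
    rwa [parallelTime, min_eq_left h3] at h1
  error_alt := fun Q hQ μ => by
    refine (measure_mono ?_).trans (chainLaw_oneSidedTime_lt_top_le hm hQ μ hβ)
    rintro ω ⟨h1, h2⟩
    have h3 : ¬ oneSidedTime H₀ α ω ≤ oneSidedTime H₁ β ω := by
      intro hc
      simp [parallelDecision, hc] at h2
    rwa [parallelTime, min_eq_right (not_le.1 h3).le] at h1

/-! ### Exponential concentration of additive functionals -/

section Concentration

variable {Q : TransitionMatrix m}

/-- A function of mean zero under the stationary law of transitions has a bounded corrector making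
its partial sums a martingale. -/
theorem IsErgodic.exists_corrector (hm : 2 ≤ m) (hQ : IsErgodic Q) {F : Fin m → Fin m → ℝ}
    (hF : ∑ x, stationaryDist Q x * ∑ y, Q.1 x y * F x y = 0) :
    ∃ h : Fin m → ℝ, ∀ x, ∑ y, Q.1 x y * (F x y + h y - h x) = 0 := by
  have : Nonempty (Fin m) := ⟨⟨0, by omega⟩⟩
  set f : Fin m → ℝ := fun x => ∑ y, Q.1 x y * F x y with hf
  set B := ∑ x, |f x| with hB
  have hfB : ∀ x, |f x| ≤ B := fun x =>
    Finset.single_le_sum (f := fun x => |f x|) (fun _ _ => abs_nonneg _) (Finset.mem_univ x)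
  -- The shift by `B` only supplies nonnegativity; the constant cancels when the mean is subtracted.
  obtain ⟨h, hh, -⟩ := hQ.exists_poisson hm (f := fun x => f x + B) (M := B + B)
    (fun x => by linarith [(abs_le.1 (hfB x)).1]) (fun x => by linarith [(abs_le.1 (hfB x)).2])
  refine ⟨h, fun x => ?_⟩
  have h1 := hh x
  simp only [mul_add, Finset.sum_add_distrib] at h1
  rw [hF, ← Finset.sum_mul, sum_stationaryDist] at h1
  have e : ∀ y, Q.1 x y * (F x y + h y - h x) =
      Q.1 x y * F x y + Q.1 x y * h y - h x * Q.1 x y := fun y => by ring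
  simp_rw [e]
  rw [Finset.sum_sub_distrib, Finset.sum_add_distrib, ← Finset.mul_sum, Q.sum_row]
  change f x + _ - _ = 0
  linarith

/-- One step of an exponential supermartingale: `e^u ≤ 1 + u + u²` for `|u| ≤ 1`, the linear term
averages to 0, and `1 + s ≤ e^s` absorbs the rest. -/
theorem sum_mul_exp_le {q ξ : Fin m → ℝ} (hq : ∀ y, 0 ≤ q y) (hq1 : ∑ y, q y = 1)
    (hξ : ∑ y, q y * ξ y = 0) {c l : ℝ} (hl : 0 ≤ l) (hc : ∀ y, |ξ y| ≤ c) (hlc : l * c ≤ 1) :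
    ∑ y, q y * Real.exp (l * ξ y - l ^ 2 * c ^ 2) ≤ 1 := by
  have hexp : ∀ y, Real.exp (l * ξ y) ≤ 1 + l * ξ y + l ^ 2 * c ^ 2 := by
    intro y
    have h1 : |l * ξ y| ≤ l * c := by
      rw [abs_mul, abs_of_nonneg hl]
      exact mul_le_mul_of_nonneg_left (hc y) hl
    have h2 := (abs_le.1 (Real.abs_exp_sub_one_sub_id_le (h1.trans hlc))).2
    have h3 : (l * ξ y) ^ 2 ≤ (l * c) ^ 2 := sq_le_sq' (abs_le.1 h1).1 (abs_le.1 h1).2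
    nlinarith
  calc ∑ y, q y * Real.exp (l * ξ y - l ^ 2 * c ^ 2)
      = (∑ y, q y * Real.exp (l * ξ y)) * Real.exp (-(l ^ 2 * c ^ 2)) := by
        rw [Finset.sum_mul]
        exact Finset.sum_congr rfl fun y _ => by rw [sub_eq_add_neg, Real.exp_add, mul_assoc]
    _ ≤ (∑ y, q y * (1 + l * ξ y + l ^ 2 * c ^ 2)) * Real.exp (-(l ^ 2 * c ^ 2)) := by
        gcongr with y
        · exact hq y
        · exact hexp y
    _ = (1 + l ^ 2 * c ^ 2) * Real.exp (-(l ^ 2 * c ^ 2)) := by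
        congr 1
        have e : ∀ y, q y * (1 + l * ξ y + l ^ 2 * c ^ 2) =
            (1 + l ^ 2 * c ^ 2) * q y + l * (q y * ξ y) := fun y => by ring
        simp_rw [e]
        rw [Finset.sum_add_distrib, ← Finset.mul_sum, ← Finset.mul_sum, hq1, hξ]
        ring
    _ ≤ Real.exp (l ^ 2 * c ^ 2) * Real.exp (-(l ^ 2 * c ^ 2)) := by
        gcongr
        linarith [Real.add_one_le_exp (l ^ 2 * c ^ 2)]
    _ = 1 := by rw [← Real.exp_add]; simp

/-- A Chernoff bound for the corrected sums. The corrector changes a sum by at most `2B`, a constant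
factor in the bound, so the tails decay geometrically. -/
theorem IsErgodic.tsum_chainLaw_additive_ne_top (hm : 2 ≤ m) (hQ : IsErgodic Q)
    (μ : stdSimplex ℝ (Fin m)) {F : Fin m → Fin m → ℝ}
    (hF : ∑ x, stationaryDist Q x * ∑ y, Q.1 x y * F x y = 0) {δ : ℝ} (hδ : 0 < δ) :
    ∑' n : ℕ, chainLaw Q μ {ω | δ * n ≤ ∑ t ∈ Finset.range n, F (ω t) (ω (t + 1))} ≠ ⊤ := by
  obtain ⟨h, hh⟩ := hQ.exists_corrector hm hF
  set ξ : Fin m → Fin m → ℝ := fun x y => F x y + h y - h x with hξ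
  set c : ℝ := 1 + ∑ x, ∑ y, |ξ x y| with hcdef
  have hc1 : 1 ≤ c := by
    have : 0 ≤ ∑ x, ∑ y, |ξ x y| := Finset.sum_nonneg fun x _ => Finset.sum_nonneg fun y _ =>
      abs_nonneg _
    linarith
  have hξc : ∀ x y, |ξ x y| ≤ c := by
    intro x y
    have h1 : |ξ x y| ≤ ∑ y, |ξ x y| :=
      Finset.single_le_sum (f := fun y => |ξ x y|) (fun _ _ => abs_nonneg _) (Finset.mem_univ y)
    have h2 : ∑ y, |ξ x y| ≤ ∑ x, ∑ y, |ξ x y| :=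
      Finset.single_le_sum (f := fun x => ∑ y, |ξ x y|)
        (fun _ _ => Finset.sum_nonneg fun _ _ => abs_nonneg _) (Finset.mem_univ x)
    linarith
  -- The first bound keeps the exponents in the range of `sum_mul_exp_le`. The second keeps the
  -- quadratic loss `l²c²` below half of the gain `lδ`.
  set l : ℝ := min (1 / c) (δ / (2 * c ^ 2)) with hl
  have hc0 : 0 < c := by linarith
  have hl0 : 0 < l := lt_min (by positivity) (by positivity)
  have hlc : l * c ≤ 1 := by
    rw [← le_div_iff₀ hc0]; exact min_le_left _ _
  have hlδ : l ^ 2 * c ^ 2 ≤ l * δ / 2 := by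
    have : l * (2 * c ^ 2) ≤ δ := by
      rw [← le_div_iff₀ (by positivity)]; exact min_le_right _ _
    nlinarith
  set B := ∑ x, |h x| with hB
  have hhB : ∀ x, |h x| ≤ B := fun x =>
    Finset.single_le_sum (f := fun x => |h x|) (fun _ _ => abs_nonneg _) (Finset.mem_univ x)
  have hbound : ∀ n : ℕ, chainLaw Q μ {ω | δ * n ≤ ∑ t ∈ Finset.range n, F (ω t) (ω (t + 1))} ≤
      ENNReal.ofReal (Real.exp (2 * l * B) * Real.exp (-(l * δ / 2)) ^ n) := by
    intro n
    let ρ : ℕ → (ℕ → Fin m) → Fin m → ℝ≥0∞ := fun t ω y =>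
      ENNReal.ofReal (Real.exp (l * ξ (ω t) y - l ^ 2 * c ^ 2))
    have h1 := lintegral_prod_step_le_one Q μ (ρ := ρ)
      (fun t y ω ω' hω => by simp only [ρ, hω t (Set.mem_Iic.2 le_rfl)])
      (fun t ω => by
        simp_rw [ρ, ← ENNReal.ofReal_mul (Q.nonneg _ _)]
        rw [← ENNReal.ofReal_sum_of_nonneg fun y _ =>
          mul_nonneg (Q.nonneg _ y) (Real.exp_pos _).le]
        exact ENNReal.ofReal_le_one.2 (sum_mul_exp_le (Q.nonneg _) (Q.sum_row _) (hh _) hl0.le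
          (hξc _) hlc)) n
    have hdep : DependsOn (fun ω : ℕ → Fin m =>
        δ * n ≤ ∑ t ∈ Finset.range n, F (ω t) (ω (t + 1))) (Set.Iic n) := by
      intro ω ω' hω
      have : ∑ t ∈ Finset.range n, F (ω t) (ω (t + 1)) =
          ∑ t ∈ Finset.range n, F (ω' t) (ω' (t + 1)) := by
        refine Finset.sum_congr rfl fun t ht => ?_
        have ht := Finset.mem_range.1 ht
        rw [hω t (by simp only [Set.mem_Iic]; omega), hω (t + 1) (by simpa using ht)]
      simp only [this]
    have hmeas : MeasurableSet
        {ω : ℕ → Fin m | δ * n ≤ ∑ t ∈ Finset.range n, F (ω t) (ω (t + 1))} :=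
      measurableSet_of_dependsOn hdep
    set E := {ω : ℕ → Fin m | δ * n ≤ ∑ t ∈ Finset.range n, F (ω t) (ω (t + 1))}
    set K := Real.exp (2 * l * B) * Real.exp (-(l * δ / 2)) ^ n with hK
    have hK0 : 0 < K := by positivity
    have h2 : ENNReal.ofReal K⁻¹ * chainLaw Q μ E ≤ 1 := by
      rw [← lintegral_indicator_const hmeas]
      refine (lintegral_mono fun ω => ?_).trans h1
      by_cases hω : ω ∈ E
      · rw [Set.indicator_of_mem hω]
        simp only [ρ]
        rw [← ENNReal.ofReal_prod_of_nonneg fun _ _ => (Real.exp_pos _).le, ← Real.exp_sum]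
        refine ENNReal.ofReal_le_ofReal ?_
        have hsum : ∑ t ∈ Finset.range n, (l * ξ (ω t) (ω (t + 1)) - l ^ 2 * c ^ 2) =
            l * (∑ t ∈ Finset.range n, F (ω t) (ω (t + 1)) + (h (ω n) - h (ω 0))) -
              n * (l ^ 2 * c ^ 2) := by
          rw [Finset.sum_sub_distrib, ← Finset.mul_sum, ← Finset.sum_range_sub (fun t => h (ω t)),
            ← Finset.sum_add_distrib]
          simp [hξ, add_sub_assoc]
        have hKe : K⁻¹ = Real.exp (n * (l * δ / 2) - 2 * l * B) := by
          rw [hK, ← Real.exp_nat_mul, ← Real.exp_add, ← Real.exp_neg]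
          congr 1; ring
        rw [hsum, hKe]
        refine Real.exp_le_exp.2 ?_
        have h3 : δ * n ≤ ∑ t ∈ Finset.range n, F (ω t) (ω (t + 1)) := hω
        have h4 := abs_le.1 (hhB (ω n))
        have h5 := abs_le.1 (hhB (ω 0))
        have h6 : δ * n - 2 * B ≤ ∑ t ∈ Finset.range n, F (ω t) (ω (t + 1)) +
          (h (ω n) - h (ω 0)) := by linarith
        have h7 := mul_le_mul_of_nonneg_left h6 hl0.le
        have h8 := mul_le_mul_of_nonneg_left hlδ (Nat.cast_nonneg (α := ℝ) n)
        nlinarith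
      · rw [Set.indicator_of_notMem hω]; exact zero_le
    rw [ENNReal.ofReal_inv_of_pos hK0] at h2
    have hK' : ENNReal.ofReal K ≠ 0 := by simpa using hK0
    rw [mul_comm, ← div_eq_mul_inv, ENNReal.div_le_iff hK' ENNReal.ofReal_ne_top, one_mul] at h2
    exact h2
  refine ne_top_of_le_ne_top ?_ (ENNReal.tsum_le_tsum hbound)
  have hsum : Summable fun n : ℕ => Real.exp (2 * l * B) * Real.exp (-(l * δ / 2)) ^ n := by
    refine (summable_geometric_of_lt_one (Real.exp_pos _).le ?_).mul_left _
    rw [Real.exp_lt_one_iff]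
    have := mul_pos hl0 hδ
    linarith
  exact hsum.tsum_ofReal_ne_top

/-- The transition frequencies concentrate, with summable deviation probabilities. -/
theorem IsErgodic.tsum_chainLaw_deviation_ne_top (hm : 2 ≤ m) (hQ : IsErgodic Q)
    (μ : stdSimplex ℝ (Fin m)) {δ : ℝ} (hδ : 0 < δ) :
    ∑' n : ℕ, chainLaw Q μ {ω | ∃ x y, δ * n ≤
      |(transitions ω n x y : ℝ) - n * (stationaryDist Q x * Q.1 x y)|} ≠ ⊤ := by
  have : Nonempty (Fin m) := ⟨⟨0, by omega⟩⟩
  -- The centred indicator of one transition; the sign `s = ±1` covers both tails.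
  let F : Fin m → Fin m → ℝ → Fin m → Fin m → ℝ := fun x y s x' y' =>
    s * ((if x' = x ∧ y' = y then 1 else 0) - stationaryDist Q x * Q.1 x y)
  have hF : ∀ x y s, ∑ x', stationaryDist Q x' * ∑ y', Q.1 x' y' * F x y s x' y' = 0 := by
    intro x y s
    have e : ∀ x', ∑ y', Q.1 x' y' * F x y s x' y' =
        s * ((if x' = x then Q.1 x y else 0) - stationaryDist Q x * Q.1 x y) := by
      intro x'
      have e1 : ∀ y', Q.1 x' y' * F x y s x' y' = s * ((if y' = y then
          (if x' = x then Q.1 x y else 0) else 0) - stationaryDist Q x * Q.1 x y * Q.1 x' y') := by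
        intro y'
        by_cases hx : x' = x
        · by_cases hy : y' = y
          · simp only [F, hx, hy, and_self, if_true]; ring
          · simp only [F, hx, hy, and_false, if_true, if_false]; ring
        · simp only [F, hx, false_and, if_false, ite_self]; ring
      simp_rw [e1]
      rw [← Finset.mul_sum, Finset.sum_sub_distrib, ← Finset.mul_sum, Q.sum_row,
        Finset.sum_ite_eq']
      simp
    simp_rw [e]
    have e2 : ∀ x', stationaryDist Q x' * (s * ((if x' = x then Q.1 x y else 0) -
        stationaryDist Q x * Q.1 x y)) = s * ((if x' = x then stationaryDist Q x * Q.1 x y else 0) -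
        (stationaryDist Q x * Q.1 x y) * stationaryDist Q x') := by
      intro x'
      by_cases hx : x' = x
      · simp only [hx, if_true]; ring
      · simp only [hx, if_false]; ring
    simp_rw [e2]
    rw [← Finset.mul_sum, Finset.sum_sub_distrib, ← Finset.mul_sum, sum_stationaryDist,
      Finset.sum_ite_eq']
    simp
  have hsum : ∀ x y s (ω : ℕ → Fin m) (n : ℕ),
      ∑ t ∈ Finset.range n, F x y s (ω t) (ω (t + 1)) =
      s * ((transitions ω n x y : ℝ) - n * (stationaryDist Q x * Q.1 x y)) := by
    intro x y s ω n
    simp only [F]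
    rw [← Finset.mul_sum, Finset.sum_sub_distrib]
    simp [transitions]
  have hfin : ∑' n : ℕ, ∑ p : Fin m × Fin m × Bool, chainLaw Q μ
      {ω | δ * n ≤ ∑ t ∈ Finset.range n,
        F p.1 p.2.1 (if p.2.2 then 1 else -1) (ω t) (ω (t + 1))} ≠ ⊤ := by
    rw [Summable.tsum_finsetSum fun _ _ => ENNReal.summable]
    exact ENNReal.sum_ne_top.2 fun p _ => hQ.tsum_chainLaw_additive_ne_top hm μ (hF _ _ _) hδ
  refine ne_top_of_le_ne_top hfin (ENNReal.tsum_le_tsum fun n => ?_)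
  refine (measure_mono ?_).trans (measure_biUnion_finset_le Finset.univ _)
  rintro ω ⟨x, y, hxy⟩
  simp only [Set.mem_iUnion]
  rcases le_abs.1 hxy with h | h
  · exact ⟨(x, y, true), Finset.mem_univ _, by
      simp only [Set.mem_ofPred_eq, hsum, if_true, one_mul]; exact h⟩
  · exact ⟨(x, y, false), Finset.mem_univ _, by
      simp only [Set.mem_ofPred_eq, hsum, Bool.false_eq_true, if_false]; linarith⟩

end Concentration

/-! ### Lower semicontinuity of the statistic -/

/-- A continuous lower bound of `∑_x v_x KL(v(x,·)/v_x, P(x,·))`, with `P` shifted by `ε`. -/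
def softKL (ε : ℝ) (v : Fin m → Fin m → ℝ) (P : TransitionMatrix m) : ℝ :=
  ∑ x, (∑ y, v x y * Real.log (v x y) - (∑ y, v x y) * Real.log (∑ y, v x y) -
    ∑ y, v x y * Real.log (P.1 x y + ε))

theorem softKL_eq (ε : ℝ) (v : Fin m → Fin m → ℝ) (P : TransitionMatrix m) :
    softKL ε v P = ∑ x, ∑ y, v x y * (Real.log (v x y) - Real.log (∑ y, v x y) -
      Real.log (P.1 x y + ε)) := by
  refine Finset.sum_congr rfl fun x _ => ?_
  rw [Finset.sum_mul, ← Finset.sum_sub_distrib, ← Finset.sum_sub_distrib]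
  exact Finset.sum_congr rfl fun y _ => by ring

/-- Joint continuity holds because `x log x` extends continuously to 0 and the shift `ε` keeps the
remaining logarithm away from its singularity. -/
theorem continuous_softKL {ε : ℝ} (hε : 0 < ε) :
    Continuous fun p : (Fin m → Fin m → ℝ) × TransitionMatrix m => softKL ε p.1 p.2 := by
  unfold softKL
  have h1 : ∀ x y, Continuous fun p : (Fin m → Fin m → ℝ) × TransitionMatrix m => p.1 x y :=
    fun x y => by fun_prop
  have h2 : ∀ x y, Continuous fun p : (Fin m → Fin m → ℝ) × TransitionMatrix m =>
      p.2.1 x y := fun x y => by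
    have h0 : Continuous fun P : TransitionMatrix m => (P.1 : Matrix (Fin m) (Fin m) ℝ) :=
      continuous_subtype_val
    exact (h0.comp continuous_snd).matrix_elem x y
  refine continuous_finsetSum _ fun x _ => ((continuous_finsetSum _ fun y _ => ?_).sub ?_).sub
    (continuous_finsetSum _ fun y _ => ?_)
  · exact Real.continuous_mul_log.comp (h1 x y)
  · exact Real.continuous_mul_log.comp (continuous_finsetSum _ fun y _ => h1 x y)
  · refine (h1 x y).mul (((h2 x y).add continuous_const).log fun p => ?_)
    have := p.2.nonneg x y
    exact (add_pos_of_nonneg_of_pos this hε).ne'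

section Stationary

variable {Q : TransitionMatrix m}

/-- The stationary law of a transition `(X_t, X_{t+1})`. -/
def transitionLaw (Q : TransitionMatrix m) (x y : Fin m) : ℝ := stationaryDist Q x * Q.1 x y

theorem sum_transitionLaw (Q : TransitionMatrix m) (x : Fin m) :
    ∑ y, transitionLaw Q x y = stationaryDist Q x := by
  simp only [transitionLaw, ← Finset.mul_sum, Q.sum_row, mul_one]

theorem IsErgodic.softKL_zero [Nonempty (Fin m)] (hQ : IsErgodic Q) {P : TransitionMatrix m}
    (hac : ∀ x y, P.1 x y = 0 → Q.1 x y = 0) :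
    softKL 0 (transitionLaw Q) P = (stationaryKL Q P).toReal := by
  have hnn : ∀ x, 0 ≤ ∑ y, Q.1 x y * Real.log (Q.1 x y / P.1 x y) := fun x =>
    sum_mul_log_div_nonneg (Q.nonneg x) (P.nonneg x) (by rw [Q.sum_row, P.sum_row]) (hac x)
  rw [stationaryKL, ENNReal.toReal_sum fun x _ => by
    rw [kl_of_ac (hac x)]; exact ENNReal.mul_ne_top ENNReal.ofReal_ne_top ENNReal.ofReal_ne_top,
    softKL_eq]
  refine Finset.sum_congr rfl fun x _ => ?_
  rw [kl_of_ac (hac x), ENNReal.toReal_mul, ENNReal.toReal_ofReal (hQ.stationaryDist_pos x).le,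
    ENNReal.toReal_ofReal (hnn x), Finset.mul_sum]
  refine Finset.sum_congr rfl fun y _ => ?_
  rw [sum_transitionLaw, transitionLaw, add_zero, mul_assoc]
  rcases eq_or_ne (Q.1 x y) 0 with h | h
  · simp [h]
  · rw [Real.log_mul (hQ.stationaryDist_pos x).ne' h, Real.log_div h fun h0 => h (hac x y h0)]
    ring

/-- Letting `ε` tend to 0 recovers the divergence. Under absolute continuity this is continuity at
`ε = 0`. Otherwise one transition has positive stationary weight and `P`-probability 0, and its term
`-v log ε` is unbounded. -/
theorem IsErgodic.exists_lt_softKL [Nonempty (Fin m)] (hQ : IsErgodic Q) {P : TransitionMatrix m}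
    {K : ℝ} (hK : ENNReal.ofReal K < stationaryKL Q P) :
    ∃ ε > 0, K < softKL ε (transitionLaw Q) P := by
  have hv0 : ∀ x y, 0 ≤ transitionLaw Q x y := fun x y =>
    mul_nonneg (hQ.stationaryDist_pos x).le (Q.nonneg x y)
  by_cases hac : ∀ x y, P.1 x y = 0 → Q.1 x y = 0
  · have hlim : ContinuousAt (fun ε => softKL ε (transitionLaw Q) P) 0 := by
      unfold softKL
      refine tendsto_finsetSum _ fun x _ => tendsto_const_nhds.sub
        (tendsto_finsetSum _ fun y _ => ?_)
      rcases eq_or_ne (Q.1 x y) 0 with h | h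
      · simp [transitionLaw, h]
      · have hp : P.1 x y ≠ 0 := fun h0 => h (hac x y h0)
        refine tendsto_const_nhds.mul ?_
        have : ContinuousAt (fun ε : ℝ => Real.log (P.1 x y + ε)) 0 :=
          (continuousAt_const.add continuousAt_id).log (by simpa using hp)
        exact this
    have hlt : K < softKL 0 (transitionLaw Q) P := by
      rw [hQ.softKL_zero hac]
      have htop : stationaryKL Q P ≠ ⊤ := by
        rw [stationaryKL]
        refine ENNReal.sum_ne_top.2 fun x _ => ?_
        rw [kl_of_ac (hac x)]
        exact ENNReal.mul_ne_top ENNReal.ofReal_ne_top ENNReal.ofReal_ne_top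
      have := (ENNReal.toReal_lt_toReal ENNReal.ofReal_ne_top htop).2 hK
      rw [ENNReal.toReal_ofReal'] at this
      exact (le_max_left _ _).trans_lt this
    have hev : ∀ᶠ ε in 𝓝[>] (0 : ℝ), K < softKL ε (transitionLaw Q) P :=
      (hlim.eventually (lt_mem_nhds hlt)).filter_mono nhdsWithin_le_nhds
    obtain ⟨ε, h1, h2⟩ := (hev.and self_mem_nhdsWithin).exists
    exact ⟨ε, h2, h1⟩
  · push Not at hac
    obtain ⟨x₀, y₀, hP0, hQ0⟩ := hac
    have hv : 0 < transitionLaw Q x₀ y₀ :=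
      mul_pos (hQ.stationaryDist_pos x₀) ((Q.nonneg x₀ y₀).lt_of_ne' hQ0)
    set v := transitionLaw Q
    set C := ∑ x, (∑ y, v x y * Real.log (v x y) - (∑ y, v x y) * Real.log (∑ y, v x y)) with hC
    set S := ∑ x, ∑ y, v x y * Real.log 2 with hS
    -- Chosen so that `v x₀ y₀ * log ε ≤ -(K + 1 + S - C)`. The cap at 1 gives `P + ε ≤ 2`, so the
    -- other terms sum to at most `S`.
    set ε := min 1 (Real.exp (-((K + 1 + S - C) / v x₀ y₀))) with hεdef
    have hε : 0 < ε := lt_min one_pos (Real.exp_pos _)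
    refine ⟨ε, hε, ?_⟩
    have hlog : Real.log ε ≤ -((K + 1 + S - C) / v x₀ y₀) := by
      rw [Real.log_le_iff_le_exp hε]
      exact min_le_right _ _
    have hterm : ∀ x y, v x y * Real.log (P.1 x y + ε) ≤ v x y * Real.log 2 := by
      intro x y
      refine mul_le_mul_of_nonneg_left (Real.log_le_log ?_ ?_) (hv0 x y)
      · have := P.nonneg x y; positivity
      · have := P.le_one x y
        have : ε ≤ 1 := min_le_left _ _
        linarith
    have hsum : ∑ x, ∑ y, v x y * Real.log (P.1 x y + ε) ≤ S + v x₀ y₀ * Real.log ε := by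
      have h2 : 0 ≤ Real.log 2 := Real.log_nonneg (by norm_num)
      have hstep : ∀ x y, v x y * Real.log (P.1 x y + ε) ≤ v x y * Real.log 2 +
          if x₀ = x ∧ y₀ = y then v x₀ y₀ * Real.log ε else 0 := by
        intro x y
        split_ifs with h
        · obtain ⟨rfl, rfl⟩ := h
          rw [hP0, zero_add]
          have := mul_nonneg (hv0 x₀ y₀) h2
          linarith
        · rw [add_zero]; exact hterm x y
      refine (Finset.sum_le_sum fun x _ => Finset.sum_le_sum fun y _ => hstep x y).trans ?_
      simp only [Finset.sum_add_distrib]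
      refine add_le_add le_rfl (le_of_eq ?_)
      rw [Finset.sum_eq_single x₀ (fun x _ hx => ?_) (by simp)]
      · simp
      · exact Finset.sum_eq_zero fun y _ => if_neg fun h => hx h.1.symm
    have hsoft : softKL ε v P = C - ∑ x, ∑ y, v x y * Real.log (P.1 x y + ε) := by
      rw [softKL, Finset.sum_sub_distrib]
    have h3 := mul_le_mul_of_nonneg_left hlog hv.le
    have h4 : v x₀ y₀ * -((K + 1 + S - C) / v x₀ y₀) = -(K + 1 + S - C) := by
      rw [mul_neg, mul_div_cancel₀ _ hv.ne']
    rw [hsoft]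
    linarith

/-- Uniformly over a compact null, the statistic is large near the stationary law. -/
theorem IsErgodic.exists_delta [Nonempty (Fin m)] (hQ : IsErgodic Q)
    {H : Set (TransitionMatrix m)} (hH : IsCompact H) {K : ℝ}
    (hK : ENNReal.ofReal K < infStationaryKL Q H) :
    ∃ δ > 0, ∀ v : Fin m → Fin m → ℝ, (∀ x y, |v x y - transitionLaw Q x y| < δ) →
      ∀ P ∈ H, ∃ ε > 0, K < softKL ε v P := by
  have hev : ∀ᶠ v in 𝓝 (transitionLaw Q), ∀ P ∈ H, ∃ ε > 0, K < softKL ε v P := by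
    -- A tube-lemma argument: each `P` has its own `ε`, valid on a joint neighbourhood, and
    -- compactness of `H` yields one neighbourhood of the stationary law.
    refine hH.eventually_forall_of_forall_eventually
      (P := fun v P => ∃ ε > 0, K < softKL ε v P) fun P hP => ?_
    obtain ⟨ε, hε, h⟩ := hQ.exists_lt_softKL (hK.trans_le (iInf₂_le P hP))
    have := (continuous_softKL (m := m) hε).continuousAt (x := (transitionLaw Q, P))
    exact (this.eventually (lt_mem_nhds h)).mono fun p hp => ⟨ε, hε, hp⟩
  obtain ⟨δ, hδ, h⟩ := Metric.eventually_nhds_iff.1 hev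
  refine ⟨δ, hδ, fun v hv => h ?_⟩
  rw [dist_pi_lt_iff hδ]
  intro x
  rw [dist_pi_lt_iff hδ]
  intro y
  rw [Real.dist_eq]
  exact hv x y

end Stationary

theorem ofReal_sum_le_sum_ofReal {ι : Type*} (s : Finset ι) (f : ι → ℝ) :
    ENNReal.ofReal (∑ i ∈ s, f i) ≤ ∑ i ∈ s, ENNReal.ofReal (f i) :=
  Finset.le_sum_of_subadditive ENNReal.ofReal ENNReal.ofReal_zero.le
    (fun _ _ => ENNReal.ofReal_add_le) s f

/-- Adding `ε` to `P` only lowers the divergence, and normalising the counts by `n` cancels inside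
the logarithms. Where absolute continuity fails at a visited state, the right side is `∞`. -/
theorem ofReal_mul_softKL_le (P : TransitionMatrix m) {ε : ℝ} (hε : 0 < ε) (ω : ℕ → Fin m) {n : ℕ}
    (hn : 0 < n) :
    ENNReal.ofReal (n * softKL ε (fun x y => (transitions ω n x y : ℝ) / n) P) ≤
      ∑ x with 0 < visits ω n x, (visits ω n x : ℝ≥0∞) * kl (empiricalRow ω n x) (P.1 x) := by
  by_cases hac : ∀ x, 0 < visits ω n x → ∀ y, P.1 x y = 0 → empiricalRow ω n x y = 0
  · have hrow : n * softKL ε (fun x y => (transitions ω n x y : ℝ) / n) P ≤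
        ∑ x with 0 < visits ω n x, visits ω n x *
          ∑ y, empiricalRow ω n x y * Real.log (empiricalRow ω n x y / P.1 x y) := by
      rw [softKL_eq, Finset.mul_sum, Finset.sum_filter]
      refine Finset.sum_le_sum fun x _ => ?_
      have hsum : ∑ y, (transitions ω n x y : ℝ) / n = (visits ω n x : ℝ) / n := by
        rw [← Finset.sum_div, ← Nat.cast_sum, sum_transitions]
      rw [hsum]
      split_ifs with hx
      · rw [Finset.mul_sum, Finset.mul_sum]
        refine Finset.sum_le_sum fun y _ => ?_
        have hn' : (0 : ℝ) < n := by exact_mod_cast hn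
        have hx' : (0 : ℝ) < visits ω n x := by exact_mod_cast hx
        have hemp : empiricalRow ω n x y = (transitions ω n x y : ℝ) / visits ω n x := by
          simp [empiricalRow, hx]
        rcases Nat.eq_zero_or_pos (transitions ω n x y) with h0 | h0
        · simp [hemp, h0]
        · have ht : (0 : ℝ) < transitions ω n x y := by exact_mod_cast h0
          have hp : 0 < P.1 x y := by
            refine (P.nonneg x y).lt_of_ne' fun h1 => ?_
            have := hac x hx y h1
            rw [hemp] at this
            exact (div_pos ht hx').ne' this
          have hlog : Real.log (P.1 x y) ≤ Real.log (P.1 x y + ε) :=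
            Real.log_le_log hp (by linarith)
          have e1 : (n : ℝ) * ((transitions ω n x y : ℝ) / n * (Real.log ((transitions ω n x y : ℝ) / n)
              - Real.log ((visits ω n x : ℝ) / n) - Real.log (P.1 x y + ε))) =
              transitions ω n x y * (Real.log (transitions ω n x y) - Real.log (visits ω n x) -
                Real.log (P.1 x y + ε)) := by
            rw [Real.log_div ht.ne' hn'.ne', Real.log_div hx'.ne' hn'.ne']
            field_simp
            ring
          have e2 : (visits ω n x : ℝ) * (empiricalRow ω n x y *
              Real.log (empiricalRow ω n x y / P.1 x y)) =
              transitions ω n x y * (Real.log (transitions ω n x y) - Real.log (visits ω n x) -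
                Real.log (P.1 x y)) := by
            rw [hemp, Real.log_div (div_pos ht hx').ne' hp.ne', Real.log_div ht.ne' hx'.ne']
            field_simp
          rw [e1, e2]
          exact mul_le_mul_of_nonneg_left (by linarith) ht.le
      · have h0 : ∑ y, transitions ω n x y = 0 := by rw [sum_transitions]; omega
        have : ∀ y, transitions ω n x y = 0 := by simpa using h0
        simp [this]
    refine (ENNReal.ofReal_le_ofReal hrow).trans ((ofReal_sum_le_sum_ofReal _ _).trans ?_)
    refine Finset.sum_le_sum fun x hx => ?_
    rw [kl_of_ac (hac x (Finset.mem_filter.1 hx).2), ENNReal.ofReal_mul (Nat.cast_nonneg _),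
      ENNReal.ofReal_natCast]
  · push Not at hac
    obtain ⟨x, hx, y, hy, hxy⟩ := hac
    have : ∑ x with 0 < visits ω n x,
        (visits ω n x : ℝ≥0∞) * kl (empiricalRow ω n x) (P.1 x) = ⊤ := by
      rw [ENNReal.sum_eq_top]
      refine ⟨x, by simpa using hx, ?_⟩
      have : kl (empiricalRow ω n x) (P.1 x) = ⊤ := if_neg fun h => hxy (h y hy)
      rw [this, ENNReal.mul_top]
      exact_mod_cast hx.ne'
    rw [this]
    exact le_top

/-! ### The upper bound on the expected stopping time -/

theorem testBoundary_le (hm : 2 ≤ m) (α : ℝ) (ω : ℕ → Fin m) (n : ℕ) :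
    testBoundary α ω n ≤ Real.log (1 / α) + ((m : ℝ) - 1) * (m * (1 + Real.log (n + 1))) := by
  have hm1 : (1 : ℝ) ≤ (m : ℝ) - 1 := by
    have : (2 : ℝ) ≤ m := by exact_mod_cast hm
    linarith
  unfold testBoundary
  gcongr
  have hx : ∀ x, Real.log (Real.exp 1 * (1 + (visits ω n x : ℝ) / ((m : ℝ) - 1))) ≤
      1 + Real.log (n + 1) := by
    intro x
    rw [Real.log_mul (Real.exp_pos 1).ne' (by positivity), Real.log_exp,
      add_comm (n : ℝ) 1]
    gcongr
    calc (visits ω n x : ℝ) / ((m : ℝ) - 1) ≤ visits ω n x := div_le_self (by positivity) hm1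
      _ ≤ n := by exact_mod_cast visits_le ω n x
  refine (Finset.sum_le_sum fun x _ => hx x).trans (le_of_eq ?_)
  simp [mul_add]

theorem eventually_log_le (A c : ℝ) (hA : 0 < A) (hc : 0 < c) :
    ∀ᶠ n : ℕ in atTop, A * (1 + Real.log (n + 1)) ≤ c * n := by
  have h1 : Tendsto (fun n : ℕ => (n : ℝ) + 1) atTop atTop :=
    tendsto_atTop_add_const_right _ _ tendsto_natCast_atTop_atTop
  have h2 := h1.eventually (Real.isLittleO_log_id_atTop.bound
    (show 0 < c / (2 * A) by positivity))
  have h3 : ∀ᶠ n : ℕ in atTop, 2 * A / c + 1 ≤ (n : ℝ) :=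
    tendsto_natCast_atTop_atTop.eventually_ge_atTop _
  filter_upwards [h2, h3] with n hn hn'
  simp only [id, Real.norm_eq_abs] at hn
  have h4 : Real.log (n + 1) ≤ c / (2 * A) * (n + 1) := by
    refine (le_abs_self _).trans (hn.trans_eq ?_)
    rw [abs_of_nonneg (by positivity)]
  have h5 : A * (c / (2 * A) * (n + 1)) = c * (n + 1) / 2 := by field_simp
  have h6 := mul_le_mul_of_nonneg_left h4 hA.le
  have h7 : 2 * A + c ≤ c * n := by
    have := mul_le_mul_of_nonneg_left hn' hc.le
    have e : c * (2 * A / c + 1) = 2 * A + c := by field_simp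
    linarith
  linarith

/-- After time `N` the test can still be running only if the transition frequencies are off by `δ`.
The tail sum for the mean is then at most `N` plus the total deviation probability, and the latter
does not involve `α`. -/
theorem IsErgodic.exists_expectedTime_le {Q : TransitionMatrix m} (hm : 2 ≤ m) (hQ : IsErgodic Q)
    (μ : stdSimplex ℝ (Fin m)) {H : Set (TransitionMatrix m)} (hH : IsCompact H) {K K' : ℝ}
    (hK' : 0 < K') (hKK : K' < K) (hK : ENNReal.ofReal K < infStationaryKL Q H) :
    ∃ C : ℝ, ∀ α ∈ Set.Ioo (0 : ℝ) 1,
      expectedTime Q μ (oneSidedTime H α) ≤ ENNReal.ofReal (Real.log (1 / α) / K' + C) := by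
  have : Nonempty (Fin m) := ⟨⟨0, by omega⟩⟩
  obtain ⟨δ, hδ, hδK⟩ := hQ.exists_delta hH hK
  set Bad : ℕ → Set (ℕ → Fin m) := fun n => {ω | ∃ x y, δ * n ≤
    |(transitions ω n x y : ℝ) - n * (stationaryDist Q x * Q.1 x y)|} with hBad
  have hS := hQ.tsum_chainLaw_deviation_ne_top hm μ hδ
  set S := ∑' n : ℕ, chainLaw Q μ (Bad n) with hSdef
  have hm1 : (0 : ℝ) < ((m : ℝ) - 1) * m := by
    have : (2 : ℝ) ≤ m := by exact_mod_cast hm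
    nlinarith
  obtain ⟨n₀, hn₀⟩ := eventually_atTop.1
    (eventually_log_le (((m : ℝ) - 1) * m) (K - K') hm1 (by linarith))
  refine ⟨n₀ + 2 + S.toReal, fun α hα => ?_⟩
  have hlog : 0 < Real.log (1 / α) := Real.log_pos (by rw [lt_div_iff₀ hα.1]; linarith [hα.2])
  -- From here on `log(1/α) ≤ K' n`, and the logarithmic part of the boundary fits in the remaining
  -- `(K - K') n`. The extra 1 ensures `n ≥ 1`.
  set N := max n₀ ⌈Real.log (1 / α) / K'⌉₊ + 1 with hN
  have hsub : ∀ n, N ≤ n → {ω | ¬ oneSidedTime H α ω ≤ n} ⊆ Bad n := by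
    intro n hNn ω hω
    by_contra hbad
    refine hω (oneSidedTime_le_iff.2 ⟨n, le_rfl, by omega, ?_⟩)
    have hn0 : 0 < n := by omega
    have hn0' : (0 : ℝ) < n := by exact_mod_cast hn0
    have hb : testBoundary α ω n ≤ n * K := by
      have h1 := testBoundary_le hm α ω n
      have h2 := hn₀ n (by have := le_max_left n₀ ⌈Real.log (1 / α) / K'⌉₊; omega)
      have h3 : Real.log (1 / α) ≤ K' * n := by
        have h4 : Real.log (1 / α) / K' ≤ n := by
          refine (Nat.le_ceil _).trans ?_
          have := le_max_right n₀ ⌈Real.log (1 / α) / K'⌉₊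
          exact_mod_cast (show ⌈Real.log (1 / α) / K'⌉₊ ≤ n by omega)
        rw [div_le_iff₀ hK'] at h4
        linarith
      rw [mul_assoc] at h2
      linarith
    refine le_iInf₂ fun P hP => ?_
    obtain ⟨ε, hε, hlt⟩ := hδK (fun x y => (transitions ω n x y : ℝ) / n) (fun x y => by
      simp only [hBad, Set.mem_ofPred_eq, not_exists, not_le] at hbad
      have h := hbad x y
      have e : (transitions ω n x y : ℝ) / n - transitionLaw Q x y =
          ((transitions ω n x y : ℝ) - n * (stationaryDist Q x * Q.1 x y)) / n := by
        rw [transitionLaw]; field_simp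
      rw [e, abs_div, abs_of_pos hn0', div_lt_iff₀ hn0']
      exact h) P hP
    refine le_trans (ENNReal.ofReal_le_ofReal ?_) (ofReal_mul_softKL_le P hε ω hn0)
    exact hb.trans (mul_le_mul_of_nonneg_left hlt.le hn0'.le)
  rw [expectedTime_eq_tsum (dependsOn_oneSidedTime_le H α)]
  calc ∑' n : ℕ, chainLaw Q μ {ω | ¬ oneSidedTime H α ω ≤ n}
      ≤ ∑' n : ℕ, ((if (N : ℕ∞) ≤ (n : ℕ∞) then (0 : ℝ≥0∞) else 1) + chainLaw Q μ (Bad n)) := by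
        refine ENNReal.tsum_le_tsum fun n => ?_
        split_ifs with h
        · rw [zero_add]; exact measure_mono (hsub n (by exact_mod_cast h))
        · exact prob_le_one.trans le_self_add
    _ = N + S := by
        rw [ENNReal.tsum_add, ← toENNReal_eq_tsum]; simp [hSdef]
    _ = ENNReal.ofReal (N + S.toReal) := by
        rw [ENNReal.ofReal_add (by positivity) ENNReal.toReal_nonneg, ENNReal.ofReal_toReal hS,
          ENNReal.ofReal_natCast]
    _ ≤ _ := by
        refine ENNReal.ofReal_le_ofReal ?_
        have h1 : (N : ℝ) ≤ n₀ + (Real.log (1 / α) / K' + 1) + 1 := by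
          rw [hN]
          push_cast
          have h2 := (Nat.ceil_lt_add_one (div_pos hlog hK').le).le
          have h3 : max (n₀ : ℝ) (⌈Real.log (1 / α) / K'⌉₊ : ℝ) ≤
              n₀ + (Real.log (1 / α) / K' + 1) := by
            refine max_le ?_ ?_
            · have := (div_pos hlog hK').le; linarith
            · have : (0 : ℝ) ≤ n₀ := Nat.cast_nonneg _
              linarith
          linarith
        linarith

/-! ### Asymptotic optimality of the parallel test -/

section Asymptotics

/-- The filter `(α, β) → (0, 0)` with `α, β > 0`. -/
abbrev levelFilter : Filter (ℝ × ℝ) := 𝓝[>] 0 ×ˢ 𝓝[>] 0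

theorem tendsto_log_inv_level :
    Tendsto (fun p : ℝ × ℝ => Real.log (1 / p.1)) levelFilter atTop := by
  simp_rw [one_div]
  exact Real.tendsto_log_atTop.comp (tendsto_inv_nhdsGT_zero.comp tendsto_fst)

theorem eventually_level_mem {c : ℝ} (hc : 0 < c) :
    ∀ᶠ p : ℝ × ℝ in levelFilter, p.1 ∈ Set.Ioo 0 c ∧ p.2 ∈ Set.Ioo 0 c :=
  Filter.prod_mem_prod (Ioo_mem_nhdsGT hc) (Ioo_mem_nhdsGT hc)

theorem tendsto_level_nhds : Tendsto id levelFilter (𝓝 ((0 : ℝ), (0 : ℝ))) := by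
  rw [nhds_prod_eq]
  exact tendsto_id'.2 (Filter.prod_mono nhdsWithin_le_nhds nhdsWithin_le_nhds)

theorem tendsto_binaryKL_ratio (a c : ℝ) :
    Tendsto (fun p : ℝ × ℝ => (binaryKL p.2 (1 - p.1) * a - c) / Real.log (1 / p.1))
      levelFilter (𝓝 a) := by
  -- The remainder in `d(β, 1 - α) = (1 - β) log(1/α) + g`. It vanishes in the joint limit, with no
  -- relation between the rates of `α` and `β`.
  let g : ℝ × ℝ → ℝ := fun p => p.2 * Real.log p.2 - p.2 * Real.log (1 - p.1) +
    (1 - p.2) * Real.log (1 - p.2)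
  have hg : Tendsto g levelFilter (𝓝 0) := by
    have hc : ContinuousAt g (0, 0) := by
      have h1 : ContinuousAt (fun p : ℝ × ℝ => p.2 * Real.log p.2) (0, 0) :=
        (Real.continuous_mul_log.comp continuous_snd).continuousAt
      have h2 : ContinuousAt (fun p : ℝ × ℝ => Real.log (1 - p.1)) (0, 0) :=
        ((continuous_const.sub continuous_fst).continuousAt).log (by simp)
      have h3 : ContinuousAt (fun p : ℝ × ℝ => (1 - p.2) * Real.log (1 - p.2)) (0, 0) :=
        (Real.continuous_mul_log.comp (continuous_const.sub continuous_snd)).continuousAt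
      exact (h1.sub (continuous_snd.continuousAt.mul h2)).add h3
    have h0 : g (0, 0) = 0 := by simp [g]
    have := hc.tendsto.comp tendsto_level_nhds
    rwa [h0] at this
  have hβ : Tendsto (fun p : ℝ × ℝ => p.2) levelFilter (𝓝 0) :=
    (continuous_snd.tendsto ((0 : ℝ), (0 : ℝ))).comp tendsto_level_nhds
  have hlim : Tendsto (fun p : ℝ × ℝ => a * (1 - p.2) + (a * g p - c) * (Real.log (1 / p.1))⁻¹)
      levelFilter (𝓝 (a * (1 - 0) + (a * 0 - c) * 0)) :=
    (tendsto_const_nhds.mul (tendsto_const_nhds.sub hβ)).add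
      (((tendsto_const_nhds.mul hg).sub tendsto_const_nhds).mul
        (tendsto_inv_atTop_zero.comp tendsto_log_inv_level))
  rw [show a * (1 - 0) + (a * 0 - c) * 0 = a by ring] at hlim
  refine hlim.congr' ?_
  filter_upwards [eventually_level_mem (c := 1 / 2) (by norm_num),
    tendsto_log_inv_level.eventually_gt_atTop 0] with p ⟨⟨h1, h2⟩, h3, h4⟩ hL
  have e1 : Real.log (p.2 / (1 - p.1)) = Real.log p.2 - Real.log (1 - p.1) :=
    Real.log_div h3.ne' (by linarith)
  have e2 : Real.log ((1 - p.2) / p.1) = Real.log (1 - p.2) + Real.log (1 / p.1) := by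
    rw [Real.log_div (by linarith) h1.ne', one_div, Real.log_inv]; ring
  rw [binaryKL, sub_sub_cancel, e1, e2]
  simp only [g]
  field_simp
  ring

theorem expectedTime_parallelTime_le (Q : TransitionMatrix m) (μ : stdSimplex ℝ (Fin m))
    (H₀ H₁ : Set (TransitionMatrix m)) (α β : ℝ) :
    expectedTime Q μ (parallelTime H₀ H₁ α β) ≤ expectedTime Q μ (oneSidedTime H₀ α) :=
  lintegral_mono fun _ => ENat.toENNReal_le.2 (min_le_left _ _)

theorem IsErgodic.tendsto_expectedTime_parallel {Q : TransitionMatrix m} (hm : 2 ≤ m)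
    (hQ : IsErgodic Q) {H₀ H₁ : Set (TransitionMatrix m)} (hH₀ : IsCompact H₀) (hQH : Q ∈ H₁)
    (μ : stdSimplex ℝ (Fin m)) :
    Tendsto (fun p : ℝ × ℝ => expectedTime Q μ (parallelTime H₀ H₁ p.1 p.2) /
      ENNReal.ofReal (Real.log (1 / p.1))) levelFilter (𝓝 (1 / infStationaryKL Q H₀)) := by
  rw [one_div]
  set D := infStationaryKL Q H₀ with hD
  refine tendsto_order.2 ⟨fun a ha => ?_, fun b hb => ?_⟩
  -- A finite `a'` strictly below `D⁻¹` replaces division by `D`, so `D = 0` and `D = ∞` need no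
  -- separate treatment. The maximum with 0 in `c` permits subtraction inside `ENNReal.ofReal`.
  · obtain ⟨a', haa', ha'⟩ := ENNReal.lt_iff_exists_nnreal_btwn.1 ha
    set c := max (2 * poissonConst Q / minStationary Q) 0 with hc
    have hlim := (ENNReal.continuous_ofReal.tendsto _).comp (tendsto_binaryKL_ratio (a' : ℝ) c)
    rw [ENNReal.ofReal_coe_nnreal] at hlim
    filter_upwards [hlim.eventually (lt_mem_nhds haa'), eventually_level_mem (c := 1 / 2)
      (by norm_num), tendsto_log_inv_level.eventually_gt_atTop 0] with p hp ⟨hα, hβ⟩ hL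
    refine hp.trans_le ?_
    have hlow := (isLevelTest_parallel hm H₀ H₁ hα.1 hβ.1).lower_bound hm hα hβ hQH hQ μ
    simp only [Function.comp_apply]
    rw [ENNReal.ofReal_div_of_pos hL, ENNReal.ofReal_sub _ (le_max_right _ _)]
    refine ENNReal.div_le_div_right (le_trans (tsub_le_tsub ?_ ?_) hlow) _
    · rw [mul_comm, ENNReal.ofReal_mul a'.coe_nonneg, ENNReal.ofReal_coe_nnreal, mul_comm,
        div_eq_mul_inv]
      exact mul_le_mul_right ha'.le _
    · exact ENNReal.ofReal_le_ofReal (le_max_left _ _)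
  -- Two real rates `K' < K < D` with `1/K' < b`; the other one-sided test can only shorten the run.
  · obtain ⟨K', hbK', hK'D⟩ := ENNReal.lt_iff_exists_nnreal_btwn.1 (ENNReal.inv_lt_iff_inv_lt.1 hb)
    obtain ⟨K, hK'K, hKD⟩ := ENNReal.lt_iff_exists_nnreal_btwn.1 hK'D
    have hK'0 : (0 : ℝ) < K' := by
      have : (0 : ℝ≥0∞) < K' := zero_le.trans_lt hbK'
      exact_mod_cast this
    obtain ⟨C, hC⟩ := hQ.exists_expectedTime_le hm μ hH₀ hK'0
      (show (K' : ℝ) < K by exact_mod_cast hK'K) (by rwa [ENNReal.ofReal_coe_nnreal])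
    have hlim : Tendsto (fun p : ℝ × ℝ => ENNReal.ofReal (1 / K' + C * (Real.log (1 / p.1))⁻¹))
        levelFilter (𝓝 (ENNReal.ofReal (1 / K' + C * 0))) :=
      (ENNReal.continuous_ofReal.tendsto _).comp (tendsto_const_nhds.add
        (tendsto_const_nhds.mul (tendsto_inv_atTop_zero.comp tendsto_log_inv_level)))
    rw [mul_zero, add_zero, one_div, ENNReal.ofReal_inv_of_pos hK'0, ENNReal.ofReal_coe_nnreal]
      at hlim
    have hKb : (K' : ℝ≥0∞)⁻¹ < b := ENNReal.inv_lt_iff_inv_lt.1 hbK'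
    filter_upwards [hlim.eventually (gt_mem_nhds hKb), eventually_level_mem (c := 1) one_pos,
      tendsto_log_inv_level.eventually_gt_atTop 0] with p hp ⟨hα, _⟩ hL
    refine lt_of_le_of_lt ?_ hp
    have hle := (expectedTime_parallelTime_le Q μ H₀ H₁ p.1 p.2).trans (hC p.1 hα)
    refine (ENNReal.div_le_div_right hle _).trans (le_of_eq ?_)
    rw [← ENNReal.ofReal_div_of_pos hL]
    congr 1
    field_simp

theorem parallelTime_comm (H₀ H₁ : Set (TransitionMatrix m)) (α β : ℝ) :
    parallelTime H₁ H₀ β α = parallelTime H₀ H₁ α β := by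
  ext ω : 1
  exact min_comm _ _

end Asymptotics

end MarkovTest

end

/-! ### The lower bound and asymptotic optimality combined. -/

theorem theorem3 (m : ℕ) (hm : 2 ≤ m) (H₀ H₁ : Set (MarkovTest.TransitionMatrix m))
    (hdisj : Disjoint H₀ H₁) :
    (∀ (α β : ℝ), α ∈ Set.Ioo (0 : ℝ) (1 / 2) → β ∈ Set.Ioo (0 : ℝ) (1 / 2) →
      ∀ (τ : (ℕ → Fin m) → ℕ∞) (D : (ℕ → Fin m) → Fin 2),
        MarkovTest.IsLevelTest H₀ H₁ α β τ D →
        (∀ Q ∈ H₁, MarkovTest.IsErgodic Q → ∀ μ : stdSimplex ℝ (Fin m),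
          ENNReal.ofReal (MarkovTest.binaryKL β (1 - α)) / MarkovTest.infStationaryKL Q H₀
              - ENNReal.ofReal (2 * MarkovTest.poissonConst Q / MarkovTest.minStationary Q)
            ≤ MarkovTest.expectedTime Q μ τ) ∧
        (∀ P ∈ H₀, MarkovTest.IsErgodic P → ∀ μ : stdSimplex ℝ (Fin m),
          ENNReal.ofReal (MarkovTest.binaryKL α (1 - β)) / MarkovTest.infStationaryKL P H₁
              - ENNReal.ofReal (2 * MarkovTest.poissonConst P / MarkovTest.minStationary P)
            ≤ MarkovTest.expectedTime P μ τ)) ∧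
    (IsCompact H₀ → IsCompact H₁ →
      (∀ (α β : ℝ), α ∈ Set.Ioo (0 : ℝ) 1 → β ∈ Set.Ioo (0 : ℝ) 1 →
        MarkovTest.IsLevelTest H₀ H₁ α β
          (MarkovTest.parallelTime H₀ H₁ α β) (MarkovTest.parallelDecision H₀ H₁ α β)) ∧
      (∀ Q ∈ H₁, MarkovTest.IsErgodic Q → ∀ μ : stdSimplex ℝ (Fin m),
        Filter.Tendsto
          (fun p : ℝ × ℝ =>
            MarkovTest.expectedTime Q μ (MarkovTest.parallelTime H₀ H₁ p.1 p.2)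
              / ENNReal.ofReal (Real.log (1 / p.1)))
          (nhdsWithin 0 (Set.Ioi 0) ×ˢ nhdsWithin 0 (Set.Ioi 0))
          (nhds (1 / MarkovTest.infStationaryKL Q H₀))) ∧
      (∀ P ∈ H₀, MarkovTest.IsErgodic P → ∀ μ : stdSimplex ℝ (Fin m),
        Filter.Tendsto
          (fun p : ℝ × ℝ =>
            MarkovTest.expectedTime P μ (MarkovTest.parallelTime H₀ H₁ p.1 p.2)
              / ENNReal.ofReal (Real.log (1 / p.2)))
          (nhdsWithin 0 (Set.Ioi 0) ×ˢ nhdsWithin 0 (Set.Ioi 0))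
          (nhds (1 / MarkovTest.infStationaryKL P H₁)))) := by
  refine ⟨fun α β hα hβ τ D h => ⟨fun Q hQH hQ μ => h.lower_bound hm hα hβ hQH hQ μ,
    fun P hPH hP μ => h.swap.lower_bound hm hβ hα hPH hP μ⟩, fun hH₀ hH₁ => ⟨fun α β hα hβ =>
    MarkovTest.isLevelTest_parallel hm H₀ H₁ hα.1 hβ.1, fun Q hQH hQ μ =>
    hQ.tendsto_expectedTime_parallel hm hH₀ hQH μ, fun P hPH hP μ => ?_⟩⟩
  -- The second limit is the first with hypotheses and levels exchanged. The tie rule is not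
  -- symmetric, but only the stopping time enters here, and it is.
  have h := (hP.tendsto_expectedTime_parallel hm hH₁ hPH μ).comp
    (Filter.tendsto_snd.prodMk Filter.tendsto_fst)
  simpa only [Function.comp_def, MarkovTest.parallelTime_comm] using h
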